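/- Consider the integer linear optimization problem on a UTVPI system with non-negative objective function and non-negative variables: \[ \text{minimize } w^{\mathrm T}x \quad\text{subject to}\quad Ax\ge b,\; x\ge 0,\; x\in\mathbb{Z}^n, \] where $m,n$ are positive integers, $A\in\{-1,0,1\}^{m\times n}$ has at most two nonzero entries in each row, $b\in\mathbb{Z}^m$, and $w\in\mathbb{Q}^n$ with $w\ge 0$. This problem is $2$-approximable: there is an algorithm that, on every instance $(A,b,w)$, runs in time polynomial in the bit length of the instance and, if the instance is feasible, outputs a feasible integer solution $x$ such that $w^{\mathrm T}x$ is at most twice the optimal value (which is attained); if the instance is infeasible, it reports this. -/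

import Mathlib

/-! ## The machine model: a random access machine with logarithmic (bit) cost

Programs are structured programs over finitely many named integer arrays, indexed by integers,
with the arithmetic operations `+`, `-`, `*` and integer division. The cost of an operation is
the total bit length of all the integers it handles (addresses, operands and results), so that
polynomial time here is polynomial time on Turing machines. -/

namespace RAM

/-- The bit length of an integer, counting its sign. -/
def bitLength (z : ℤ) : ℕ := Nat.size z.natAbs + 1

/-- A memory: `M a i` is the content of cell `i` of the array named `a`. -/
abbrev Mem : Type := ℕ → ℤ → ℤ

/-- Expressions. `read a e` is the content of the cell of array `a` whose address is the value
of `e`. Scalar variables are cells at fixed addresses. -/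
inductive Expr : Type
  | const (c : ℤ)
  | read (a : ℕ) (addr : Expr)
  | add (e₁ e₂ : Expr)
  | sub (e₁ e₂ : Expr)
  | mul (e₁ e₂ : Expr)
  | div (e₁ e₂ : Expr)

/-- The value of an expression. Division is Euclidean; division by zero gives zero. -/
def Expr.val (M : Mem) : Expr → ℤ
  | .const c => c
  | .read a e => M a (e.val M)
  | .add e₁ e₂ => e₁.val M + e₂.val M
  | .sub e₁ e₂ => e₁.val M - e₂.val M
  | .mul e₁ e₂ => e₁.val M * e₂.val M
  | .div e₁ e₂ => e₁.val M / e₂.val M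

/-- The cost of evaluating an expression: the total bit length of the values of all its
subexpressions, itself included. -/
def Expr.cost (M : Mem) : Expr → ℕ
  | .const c => bitLength c
  | .read a e => e.cost M + bitLength ((Expr.read a e).val M)
  | .add e₁ e₂ => e₁.cost M + e₂.cost M + bitLength ((Expr.add e₁ e₂).val M)
  | .sub e₁ e₂ => e₁.cost M + e₂.cost M + bitLength ((Expr.sub e₁ e₂).val M)
  | .mul e₁ e₂ => e₁.cost M + e₂.cost M + bitLength ((Expr.mul e₁ e₂).val M)
  | .div e₁ e₂ => e₁.cost M + e₂.cost M + bitLength ((Expr.div e₁ e₂).val M)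

/-- Programs. `write a i e` stores the value of `e` in cell `i` of array `a`; `branch e p q`
runs `p` if `e` is positive and `q` otherwise; `loop e p` runs `p` as long as `e` is positive. -/
inductive Program : Type
  | skip
  | write (a : ℕ) (addr e : Expr)
  | seq (p q : Program)
  | branch (e : Expr) (p q : Program)
  | loop (e : Expr) (p : Program)

/-- The memory after storing `v` in cell `i` of array `a`. -/
def Mem.store (M : Mem) (a : ℕ) (i v : ℤ) : Mem :=
  fun a' i' => if a' = a ∧ i' = i then v else M a' i'

/-- `Exec p M t M'`: started in memory `M`, the program `p` halts in memory `M'` at total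
cost `t`. -/
inductive Exec : Program → Mem → ℕ → Mem → Prop
  | skip (M : Mem) : Exec .skip M 1 M
  | write (M : Mem) (a : ℕ) (i e : Expr) :
      Exec (.write a i e) M (i.cost M + e.cost M + 1) (M.store a (i.val M) (e.val M))
  | seq {p q : Program} {M M' M'' : Mem} {s t : ℕ} :
      Exec p M s M' → Exec q M' t M'' → Exec (.seq p q) M (s + t) M''
  | branch_pos {e : Expr} {p q : Program} {M M' : Mem} {t : ℕ} :
      0 < e.val M → Exec p M t M' → Exec (.branch e p q) M (e.cost M + 1 + t) M'
  | branch_nonpos {e : Expr} {p q : Program} {M M' : Mem} {t : ℕ} :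
      e.val M ≤ 0 → Exec q M t M' → Exec (.branch e p q) M (e.cost M + 1 + t) M'
  | loop_pos {e : Expr} {p : Program} {M M' M'' : Mem} {s t : ℕ} :
      0 < e.val M → Exec p M s M' → Exec (.loop e p) M' t M'' →
      Exec (.loop e p) M (e.cost M + 1 + s + t) M''
  | loop_nonpos {e : Expr} {p : Program} {M : Mem} :
      e.val M ≤ 0 → Exec (.loop e p) M (e.cost M + 1) M

/-- The initial memory on an input list: array `0` holds the list (from cell `0` on), cell `0`
of array `1` holds its length, and all other cells are zero. -/
def initMem (l : List ℤ) : Mem := fun a i =>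
  if a = 0 ∧ 0 ≤ i then l.getD i.toNat 0
  else if a = 1 ∧ i = 0 then (l.length : ℤ)
  else 0

/-- The output list in a final memory: it is held by array `2` (from cell `0` on), and its
length by cell `0` of array `3`. -/
def output (M : Mem) : List ℤ := (List.range (M 3 0).toNat).map fun i => M 2 (i : ℤ)

/-- The size of an input: the total bit length of its entries. -/
def inputSize (l : List ℤ) : ℕ := (l.map bitLength).sum

/-- On input `l`, the program halts within cost `T` and outputs `out`. -/
def Program.OutputsWithin (p : Program) (l out : List ℤ) (T : ℕ) : Prop :=
  ∃ (t : ℕ) (M : Mem), Exec p (initMem l) t M ∧ t ≤ T ∧ output M = out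

end RAM

/-! ## Integer linear optimization on UTVPI systems -/

/-- An instance of: minimize `wᵀx` subject to `Ax ≥ b`, `x ≥ 0`, `x ∈ ℤⁿ`, where `A` has entries
in `{-1, 0, 1}` and at most two nonzero entries per row, `b` is integral, and `w` is rational
and non-negative. -/
structure UTVPIProblem where
  m : ℕ
  n : ℕ
  m_pos : 0 < m
  n_pos : 0 < n
  A : Matrix (Fin m) (Fin n) ℤ
  b : Fin m → ℤ
  w : Fin n → ℚ
  A_mem : ∀ i j, A i j = -1 ∨ A i j = 0 ∨ A i j = 1
  A_row : ∀ i, (Finset.univ.filter fun j => A i j ≠ 0).card ≤ 2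
  w_nonneg : ∀ j, 0 ≤ w j

namespace UTVPIProblem

/-- The feasible (integer) solutions. -/
def Feasible (I : UTVPIProblem) (x : Fin I.n → ℤ) : Prop :=
  (∀ i, I.b i ≤ ∑ j, I.A i j * x j) ∧ ∀ j, 0 ≤ x j

/-- The objective value. -/
def objective (I : UTVPIProblem) (x : Fin I.n → ℤ) : ℚ := ∑ j, I.w j * (x j : ℚ)

/-- The optimal integer solutions. -/
def IsOptimal (I : UTVPIProblem) (x : Fin I.n → ℤ) : Prop :=
  I.Feasible x ∧ ∀ y, I.Feasible y → I.objective x ≤ I.objective y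

/-- The problem has an optimal solution, and `x` is a feasible solution whose objective value
is at most `ρ` times the optimal value. -/
def IsApproxSolution (I : UTVPIProblem) (ρ : ℚ) (x : Fin I.n → ℤ) : Prop :=
  I.Feasible x ∧ ∃ z, I.IsOptimal z ∧ I.objective x ≤ ρ * I.objective z

/-- The encoding of an instance as a list of integers: `m`, `n`, the entries of `A` row by row,
the entries of `b`, the numerators of the entries of `w`, and their denominators. -/
def encode (I : UTVPIProblem) : List ℤ :=
  [(I.m : ℤ), (I.n : ℤ)] ++ (List.ofFn fun i => List.ofFn (I.A i)).flatten ++ List.ofFn I.b ++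
    (List.ofFn fun j => (I.w j).num) ++ List.ofFn fun j => ((I.w j).den : ℤ)

/-- The correct answers of a `ρ`-approximation algorithm: `1` followed by the entries of a
`ρ`-approximate solution if the problem is feasible, and `0` if it is infeasible. -/
def IsApproxAnswer (I : UTVPIProblem) (ρ : ℚ) (out : List ℤ) : Prop :=
  (∃ x, I.IsApproxSolution ρ x ∧ out = 1 :: List.ofFn x) ∨
    ((¬ ∃ x, I.Feasible x) ∧ out = [0])

end UTVPIProblem

/-! Give each variable two nodes, `j + 1` for `x j` and `-(j + 1)` for `- x j`, and add a node `0`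
for the constant. If `u` and `v` are the signed variables of a row with right-hand side `b` (with
`0` for a missing one), the row becomes the two difference constraints `b ≤ p u - p (-v)` and `b ≤ p
v - p (-u)`. Odd integral potentials `p` correspond to feasible points (`represents`). Dropping
oddness leaves the dual of a minimum cost flow problem.

Let `p` be an integral potential minimizing `∑ w j * (p (j + 1) - p (-(j + 1)))`, its optimality
certified by a flow (`weak_duality`). Then `X u = p u - p (-u)` is odd as a function and satisfies
the doubled constraints, so `X / 2` is a half-integral point of the linear relaxation. Comparing `p`
with the odd potential of a feasible `z` gives `∑ w j * X (j + 1) ≤ 2 * ∑ w j * z j`.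

Rounding (`round_spec`): if `X s` is an odd number, lower `X` by one on the nodes reached from `s`
along tight arcs and raise it by one on their negatives. The reached values are all odd, and the
doubled constraints survive unless `s` reaches `-s`. For a feasible integral `z` the inequality `2 *
z < X` passes along tight arcs, and `2 * z s ≠ X s`, so one of `s`, `-s` does not reach its negative
(`Distances.neg_not_reached`). In the end all values are even, and an odd value `X ≥ 1` has become
at most `X + 1 ≤ 2 * X`. The rounded point therefore costs at most `∑ w j * X (j + 1)`, which is at
most twice the optimum.

The flow comes from successive shortest paths with scaling over the bits of the weights, made
integral by the product of their denominators. Doubling the flow keeps it complementary, and each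
bit then needs at most one augmentation per variable (`run_solveCmd`, `augment_spec`). Distances use
lengths `S * (reduced cost) + 1`: the quotient by `S` is the cost and the remainder counts arcs.
Lengths are then strictly positive, so tracing a shortest path backwards cannot cycle.

The phases carry guarantees only if a feasible point exists, but the program always halts, and it
ends by checking its candidate. The check succeeds if the instance is feasible, so a failed check
proves infeasibility.

For the running time, `S` is the input size plus one; it bounds the numbers of nodes and arcs and
the bit lengths of the weights. After `S` is computed (`exec_sizeProgram`), every loop runs exactly
`S` times and products are only with `S`, so bit lengths and costs stay polynomial (`Cmd.exec_run`).
-/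

namespace RAM

/-! ## A language of bounded loops

Commands with loops that run exactly `S` times, where `S` is the content of a cell that is never
written. Multiplication is only allowed by `S`, so the bit lengths of the numbers grow by a
polynomial in `S` only. -/

instance : Add Expr := ⟨Expr.add⟩
instance : Sub Expr := ⟨Expr.sub⟩
instance : Div Expr := ⟨Expr.div⟩
instance (n : ℕ) : OfNat Expr n := ⟨Expr.const n⟩

/-- The scalar variable held by cell `0` of array `a`. -/
def var (a : ℕ) : Expr := .read a 0

/-- The bound `S` of all loops. -/
def sizeVar : Expr := var 4

/-- Multiplication by the loop bound. -/
def scale (e : Expr) : Expr := .mul sizeVar e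

@[simp] theorem val_add (M : Mem) (e f : Expr) : (e + f).val M = e.val M + f.val M := rfl
@[simp] theorem val_sub (M : Mem) (e f : Expr) : (e - f).val M = e.val M - f.val M := rfl
@[simp] theorem val_div (M : Mem) (e f : Expr) : (e / f).val M = e.val M / f.val M := rfl
@[simp] theorem val_two (M : Mem) : (2 : Expr).val M = 2 := rfl
@[simp] theorem val_zero (M : Mem) : (0 : Expr).val M = 0 := rfl
@[simp] theorem val_one (M : Mem) : (1 : Expr).val M = 1 := rfl
@[simp] theorem val_read (M : Mem) (a : ℕ) (e : Expr) :
    (Expr.read a e).val M = M a (e.val M) := rfl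
@[simp] theorem val_var (M : Mem) (a : ℕ) : (var a).val M = M a 0 := rfl
@[simp] theorem val_sizeVar (M : Mem) : sizeVar.val M = M 4 0 := rfl
@[simp] theorem val_scale (M : Mem) (e : Expr) : (scale e).val M = M 4 0 * e.val M := rfl

theorem Mem.store_apply (M : Mem) (a b : ℕ) (i v : ℤ) :
    M.store a i v b = if b = a then Function.update (M a) i v else M b := by
  funext j
  by_cases h : b = a
  · subst h
    by_cases hj : j = i <;> simp [Mem.store, Function.update, hj]
  · simp [Mem.store, h]

@[simp] theorem Mem.store_self (M : Mem) (a : ℕ) (i v : ℤ) :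
    M.store a i v a = Function.update (M a) i v := by
  simp [Mem.store_apply]

theorem Mem.store_ne (M : Mem) {a b : ℕ} (h : b ≠ a) (i v : ℤ) : M.store a i v b = M b := by
  simp [Mem.store_apply, h]

/-- Expressions whose only products are products with the loop bound. -/
def Expr.Tame : Expr → Prop
  | .const _ => True
  | .read _ e => e.Tame
  | .add e f => e.Tame ∧ f.Tame
  | .sub e f => e.Tame ∧ f.Tame
  | .mul e f => e = sizeVar ∧ f.Tame
  | .div e f => e.Tame ∧ f.Tame

/-- A measure of the size of an expression. -/
def Expr.weight : Expr → ℕ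
  | .const c => c.natAbs + 1
  | .read _ e => e.weight + 1
  | .add e f => e.weight + f.weight + 1
  | .sub e f => e.weight + f.weight + 1
  | .mul e f => e.weight + f.weight + 1
  | .div e f => e.weight + f.weight + 1

theorem bitLength_le {z : ℤ} {k : ℕ} (h : z.natAbs ≤ 2 ^ k) : bitLength z ≤ k + 2 := by
  unfold bitLength
  have : Nat.size z.natAbs ≤ k + 1 :=
    Nat.size_le.2 (lt_of_le_of_lt h (Nat.pow_lt_pow_right (by norm_num) (by omega)))
  omega

/-- Each unit of weight pays for `S + 1` more bits: a sum or difference needs one, a product with `S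
≤ 2 ^ S` needs `S`, and a quotient is no larger than its dividend. -/
theorem natAbs_val_le {M : Mem} {S k : ℕ} (hS : M 4 0 = S)
    (hM : ∀ a i, (M a i).natAbs ≤ 2 ^ k) (e : Expr) (he : e.Tame) :
    (e.val M).natAbs ≤ 2 ^ (k + e.weight * (S + 1)) := by
  have two : ∀ {x y : ℤ} {p q : ℕ}, x.natAbs ≤ 2 ^ (k + p * (S + 1)) →
      y.natAbs ≤ 2 ^ (k + q * (S + 1)) →
      x.natAbs + y.natAbs ≤ 2 ^ (k + (p + q + 1) * (S + 1)) := by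
    intro x y p q hx hy
    have h1 : 2 ^ (k + p * (S + 1)) ≤ 2 ^ (k + (p + q) * (S + 1)) :=
      Nat.pow_le_pow_right (by norm_num) (by gcongr; omega)
    have h2 : 2 ^ (k + q * (S + 1)) ≤ 2 ^ (k + (p + q) * (S + 1)) :=
      Nat.pow_le_pow_right (by norm_num) (by gcongr; omega)
    calc x.natAbs + y.natAbs ≤ 2 ^ (k + (p + q) * (S + 1) + 1) := by rw [pow_succ]; omega
      _ ≤ _ := Nat.pow_le_pow_right (by norm_num) (by ring_nf; omega)
  induction e with
  | const c =>
    calc c.natAbs ≤ 2 ^ c.natAbs := Nat.lt_two_pow_self.le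
      _ ≤ _ := Nat.pow_le_pow_right (by norm_num) (by
        simp only [Expr.weight]; nlinarith [Nat.zero_le (c.natAbs * S)])
  | read a e ih =>
    exact (hM _ _).trans (Nat.pow_le_pow_right (by norm_num) (by omega))
  | add e f ihe ihf => exact (Int.natAbs_add_le _ _).trans (two (ihe he.1) (ihf he.2))
  | sub e f ihe ihf => exact (Int.natAbs_sub_le _ _).trans (two (ihe he.1) (ihf he.2))
  | mul e f ihe ihf =>
    obtain ⟨rfl, hf⟩ := he
    have : (Expr.val M (.mul sizeVar f)).natAbs = S * (f.val M).natAbs := by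
      change (M 4 0 * f.val M).natAbs = _
      rw [hS, Int.natAbs_mul, Int.natAbs_natCast]
    rw [this]
    calc S * (f.val M).natAbs ≤ 2 ^ S * 2 ^ (k + f.weight * (S + 1)) :=
          Nat.mul_le_mul Nat.lt_two_pow_self.le (ihf hf)
      _ = 2 ^ (S + (k + f.weight * (S + 1))) := (pow_add _ _ _).symm
      _ ≤ _ := Nat.pow_le_pow_right (by norm_num) (by simp only [Expr.weight]; nlinarith)
  | div e f ihe ihf =>
    have := two (ihe he.1) (ihf he.2)
    have h2 : (Expr.val M (.div e f)).natAbs ≤ (e.val M).natAbs := Int.natAbs_ediv_le_natAbs _ _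
    exact h2.trans (le_trans (Nat.le_add_right _ _) this)

/-- The weight bounds the number of subexpressions, and each of their values obeys the bit bound of
the whole expression. -/
theorem cost_le {M : Mem} {S k : ℕ} (hS : M 4 0 = S)
    (hM : ∀ a i, (M a i).natAbs ≤ 2 ^ k) (e : Expr) (he : e.Tame) :
    e.cost M ≤ e.weight * (k + e.weight * (S + 1) + 2) := by
  have hb := fun (e : Expr) he => bitLength_le (natAbs_val_le hS hM e he)
  have two : ∀ {c p q : ℕ} {x y : ℕ}, x ≤ p * (k + p * (S + 1) + 2) →
      y ≤ q * (k + q * (S + 1) + 2) → c ≤ k + (p + q + 1) * (S + 1) + 2 →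
      x + y + c ≤ (p + q + 1) * (k + (p + q + 1) * (S + 1) + 2) := by
    intro c p q x y hx hy hc
    have h1 : p * (k + p * (S + 1) + 2) ≤ p * (k + (p + q + 1) * (S + 1) + 2) := by
      gcongr; omega
    have h2 : q * (k + q * (S + 1) + 2) ≤ q * (k + (p + q + 1) * (S + 1) + 2) := by
      gcongr; omega
    linarith
  induction e with
  | const c =>
    have := hb (.const c) he
    change bitLength c ≤ _ at this
    refine this.trans ?_
    simp only [Expr.weight]
    nlinarith [Nat.zero_le (c.natAbs * (k + (c.natAbs + 1) * (S + 1) + 2))]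
  | read a e ih =>
    have := hb (.read a e) he
    exact two (q := 0) (y := 0) (ih he) (by omega) this
  | add e f ihe ihf => exact two (ihe he.1) (ihf he.2) (hb (.add e f) he)
  | sub e f ihe ihf => exact two (ihe he.1) (ihf he.2) (hb (.sub e f) he)
  | mul e f ihe ihf =>
    refine two (ihe ?_) (ihf he.2) (hb (.mul e f) he)
    rw [he.1]; trivial
  | div e f ihe ihf => exact two (ihe he.1) (ihf he.2) (hb (.div e f) he)

/-- Commands. `rep a c` runs `c` for the values `0, …, S - 1` of the counter `a`. -/
inductive Cmd : Type
  | skip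
  | write (a : ℕ) (i e : Expr)
  | seq (c d : Cmd)
  | ite (e : Expr) (c d : Cmd)
  | rep (a : ℕ) (c : Cmd)

/-- The memory after `n` rounds of a loop with counter `a` and body `f`. -/
def rounds (a : ℕ) (f : Mem → Mem) (M : Mem) : ℕ → Mem
  | 0 => M.store a 0 0
  | k + 1 => (f (rounds a f M k)).store a 0 ((k : ℤ) + 1)

namespace Cmd

/-- The effect of a command on the memory. -/
def run (S : ℕ) : Cmd → Mem → Mem
  | .skip, M => M
  | .write a i e, M => M.store a (i.val M) (e.val M)
  | .seq c d, M => d.run S (c.run S M)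
  | .ite e c d, M => if 0 < e.val M then c.run S M else d.run S M
  | .rep a c, M => rounds a (c.run S) M S

/-- The translation of commands to programs. -/
def toProgram : Cmd → Program
  | .skip => .skip
  | .write a i e => .write a i e
  | .seq c d => .seq c.toProgram d.toProgram
  | .ite e c d => .branch e c.toProgram d.toProgram
  | .rep a c => .seq (.write a 0 0)
      (.loop (sizeVar - var a) (.seq c.toProgram (.write a 0 (var a + 1))))

/-- The arrays a command may write to. -/
def writes : Cmd → List ℕ
  | .skip => []
  | .write a _ _ => [a]
  | .seq c d => c.writes ++ d.writes
  | .ite _ c d => c.writes ++ d.writes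
  | .rep a c => a :: c.writes

/-- Well-formed commands: their expressions are tame, the loop bound is not written, and the
bodies of loops do not write the counters. -/
def WF : Cmd → Prop
  | .skip => True
  | .write a i e => a ≠ 4 ∧ i.Tame ∧ e.Tame
  | .seq c d => c.WF ∧ d.WF
  | .ite e c d => e.Tame ∧ c.WF ∧ d.WF
  | .rep a c => a ≠ 4 ∧ a ∉ c.writes ∧ c.WF

/-- The frame rule. It lets every command be specified only on the arrays that it computes; the side
condition is settled by `decide` for concrete commands. -/
theorem run_frame (S : ℕ) (c : Cmd) {b : ℕ} (hb : b ∉ c.writes) (M : Mem) :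
    c.run S M b = M b := by
  induction c generalizing M with
  | skip => rfl
  | write a i e =>
    simp only [writes, List.mem_singleton] at hb
    exact M.store_ne hb _ _
  | seq c d ihc ihd =>
    simp only [writes, List.mem_append, not_or] at hb
    exact (ihd hb.2 _).trans (ihc hb.1 _)
  | ite e c d ihc ihd =>
    simp only [writes, List.mem_append, not_or] at hb
    simp only [run]
    split
    exacts [ihc hb.1 _, ihd hb.2 _]
  | rep a c ih =>
    simp only [writes, List.mem_cons, not_or] at hb
    suffices ∀ n, rounds a (c.run S) M n b = M b from this S
    intro n
    induction n with
    | zero => exact M.store_ne hb.1 _ _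
    | succ k ihk => exact (Mem.store_ne _ hb.1 _ _).trans ((ih hb.2 _).trans ihk)

theorem WF.size_notMem {c : Cmd} (h : c.WF) : 4 ∉ c.writes := by
  induction c with
  | skip => simp [writes]
  | write a i e => simpa [writes] using h.1.symm
  | seq c d ihc ihd => simp [writes, ihc h.1, ihd h.2]
  | ite e c d ihc ihd => simp [writes, ihc h.2.1, ihd h.2.2]
  | rep a c ih => simp [writes, ih h.2.2, h.1.symm]

theorem rounds_counter {S : ℕ} {a : ℕ} {c : Cmd} (M : Mem) (n : ℕ) :
    rounds a (c.run S) M n a 0 = n := by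
  cases n <;> simp [rounds]

theorem natAbs_store_le {M : Mem} {B : ℕ} (hM : ∀ a i, (M a i).natAbs ≤ B) {v : ℤ}
    (hv : v.natAbs ≤ B) (a : ℕ) (i : ℤ) (b : ℕ) (j : ℤ) : (M.store a i v b j).natAbs ≤ B := by
  unfold Mem.store
  split
  exacts [hv, hM _ _]

/-- A well-formed command runs in time polynomial in the loop bound and the bit length of the
numbers in the memory. -/
theorem exec_run (c : Cmd) (hc : c.WF) : ∃ G Q : Polynomial ℕ, ∀ (S k : ℕ) (M : Mem),
    M 4 0 = S → (∀ a i, (M a i).natAbs ≤ 2 ^ k) →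
    (∀ a i, (c.run S M a i).natAbs ≤ 2 ^ (k + G.eval S)) ∧
      ∃ t ≤ Q.eval S * (k + 1), Exec c.toProgram M t (c.run S M) := by
  have key : ∀ (e : Expr), e.Tame → ∀ (S k : ℕ) (M : Mem), M 4 0 = S →
      (∀ a i, (M a i).natAbs ≤ 2 ^ k) →
      e.cost M ≤ (e.weight * (e.weight * (S + 1) + 2)) * (k + 1) := by
    intro e he S k M hS hM
    refine (cost_le hS hM e he).trans ?_
    rw [mul_assoc]
    gcongr
    nlinarith [Nat.zero_le (k * (e.weight * (S + 1)))]
  induction c with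
  | skip =>
    refine ⟨0, 1, fun S k M hS hM => ⟨by simpa [run] using hM, 1, by simp, Exec.skip M⟩⟩
  | write a i e =>
    obtain ⟨ha, hi, he⟩ := hc
    refine ⟨Polynomial.C e.weight * (Polynomial.X + 1),
      Polynomial.C i.weight * (Polynomial.C i.weight * (Polynomial.X + 1) + 2) +
      Polynomial.C e.weight * (Polynomial.C e.weight * (Polynomial.X + 1) + 2) + 1,
      fun S k M hS hM => ⟨?_, _, ?_, Exec.write M a i e⟩⟩
    · have := natAbs_val_le hS hM e he
      refine natAbs_store_le (fun b j => (hM b j).trans ?_) (by simpa using this) _ _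
      exact Nat.pow_le_pow_right (by norm_num) (by omega)
    · have h1 := key i hi S k M hS hM
      have h2 := key e he S k M hS hM
      simp only [Polynomial.eval_add, Polynomial.eval_mul, Polynomial.eval_C, Polynomial.eval_X,
        Polynomial.eval_one, Polynomial.eval_ofNat]
      rw [add_mul, add_mul]
      omega
  | seq c d ihc ihd =>
    obtain ⟨G, Q, h⟩ := ihc hc.1
    obtain ⟨G', Q', h'⟩ := ihd hc.2
    -- The second command starts on numbers of `k + G` bits, and `k + G + 1 ≤ (G + 1) * (k + 1)`.
    refine ⟨G + G', Q + Q' * (G + 1), fun S k M hS hM => ?_⟩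
    obtain ⟨h1, t, ht, hE⟩ := h S k M hS hM
    have hS' : c.run S M 4 0 = S := by rw [run_frame S c hc.1.size_notMem, hS]
    obtain ⟨h2, t', ht', hE'⟩ := h' S _ _ hS' h1
    refine ⟨by simpa [run, add_assoc] using h2, t + t', ?_, Exec.seq hE hE'⟩
    simp only [Polynomial.eval_add, Polynomial.eval_mul, Polynomial.eval_one]
    have : Q'.eval S * (k + G.eval S + 1) ≤ Q'.eval S * ((G.eval S + 1) * (k + 1)) := by
      gcongr
      nlinarith [Nat.zero_le (G.eval S * k)]
    rw [add_mul, mul_assoc (Q'.eval S)]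
    omega
  | ite e c d ihc ihd =>
    obtain ⟨G, Q, h⟩ := ihc hc.2.1
    obtain ⟨G', Q', h'⟩ := ihd hc.2.2
    refine ⟨G + G', Q + Q' +
      (Polynomial.C e.weight * (Polynomial.C e.weight * (Polynomial.X + 1) + 2) + 1),
      fun S k M hS hM => ?_⟩
    have hk := key e hc.1 S k M hS hM
    simp only [Polynomial.eval_add, Polynomial.eval_mul, Polynomial.eval_C, Polynomial.eval_X,
        Polynomial.eval_one, Polynomial.eval_ofNat]
    by_cases hp : 0 < e.val M
    · obtain ⟨h1, t, ht, hE⟩ := h S k M hS hM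
      refine ⟨fun a i => ?_, e.cost M + 1 + t, ?_, ?_⟩
      · simp only [run, hp, if_true]
        exact (h1 a i).trans (Nat.pow_le_pow_right (by norm_num) (by omega))
      · rw [add_mul, add_mul, add_mul]; omega
      · simp only [run, hp, if_true]
        exact Exec.branch_pos hp hE
    · obtain ⟨h1, t, ht, hE⟩ := h' S k M hS hM
      refine ⟨fun a i => ?_, e.cost M + 1 + t, ?_, ?_⟩
      · simp only [run, hp, if_false]
        exact (h1 a i).trans (Nat.pow_le_pow_right (by norm_num) (by omega))
      · rw [add_mul, add_mul, add_mul]; omega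
      · simp only [run, hp, if_false]
        exact Exec.branch_nonpos (not_lt.1 hp) hE
  | rep a c ih =>
    obtain ⟨G, Q, h⟩ := ih hc.2.2
    let e : Expr := sizeVar - var a
    let f : Expr := var a + 1
    have he : e.Tame := ⟨trivial, trivial⟩
    have hf : f.Tame := ⟨trivial, trivial⟩
    let E : Polynomial ℕ := Polynomial.C e.weight * (Polynomial.C e.weight * (Polynomial.X + 1) + 2)
    let F : Polynomial ℕ := Polynomial.C f.weight * (Polynomial.C f.weight * (Polynomial.X + 1) + 2)
    -- The `S` rounds add at most `S * G` bits; the further `S` bits make room for the counter, as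
    -- `S ≤ 2 ^ S`.
    let K : Polynomial ℕ := Polynomial.X + Polynomial.X * G
    refine ⟨K, (Polynomial.X + 1) * ((E + Q + F + 10) * (K + 1)) + 10, fun S k M hS hM => ?_⟩
    have h4 : ∀ n, rounds a (c.run S) M n 4 = M 4 := by
      intro n
      induction n with
      | zero => rw [rounds, Mem.store_ne _ hc.1.symm]
      | succ n ih' =>
        rw [rounds, Mem.store_ne _ hc.1.symm, run_frame S c hc.2.2.size_notMem, ih']
    have hbd : ∀ n ≤ S, ∀ b i, (rounds a (c.run S) M n b i).natAbs ≤
        2 ^ (k + S + n * G.eval S) := by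
      intro n
      induction n with
      | zero =>
        intro _ b i
        exact natAbs_store_le (fun b j => (hM b j).trans
          (Nat.pow_le_pow_right (by norm_num) (by omega))) (by simp) _ _ _ _
      | succ n ihn =>
        intro hn b i
        have hS' : rounds a (c.run S) M n 4 0 = S := by rw [h4, hS]
        have := (h S _ _ hS' (ihn (by omega))).1
        refine natAbs_store_le (fun b j => (this b j).trans ?_) ?_ _ _ _ _
        · exact Nat.pow_le_pow_right (by norm_num) (by ring_nf; omega)
        · calc ((n : ℤ) + 1).natAbs = n + 1 := by omega
            _ ≤ S := hn
            _ ≤ 2 ^ S := Nat.lt_two_pow_self.le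
            _ ≤ _ := Nat.pow_le_pow_right (by norm_num) (by omega)
    have hKe : K.eval S = S + S * G.eval S := by simp [K]
    refine ⟨fun b i => ?_, ?_⟩
    · have := hbd S le_rfl b i
      rwa [add_assoc, ← hKe] at this
    have hB : ∀ n ≤ S, ∀ b i, (rounds a (c.run S) M n b i).natAbs ≤ 2 ^ (k + K.eval S) := by
      intro n hn b i
      refine (hbd n hn b i).trans (Nat.pow_le_pow_right (by norm_num) ?_)
      rw [hKe, add_assoc]
      gcongr
    have hE : E.eval S = e.weight * (e.weight * (S + 1) + 2) := by simp [E]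
    have hF : F.eval S = f.weight * (f.weight * (S + 1) + 2) := by simp [F]
    set u := k + K.eval S + 1 with hu
    -- Induction on the number `n` of rounds still to be run, matching the recursive shape of
    -- `Exec.loop_pos`.
    have hloop : ∀ n ≤ S, ∃ t ≤ (n + 1) * ((E.eval S + Q.eval S + F.eval S + 10) * u),
        Exec (.loop e (.seq c.toProgram (.write a 0 f))) (rounds a (c.run S) M (S - n)) t
          (rounds a (c.run S) M S) := by
      intro n
      induction n with
      | zero =>
        intro _
        have hv : e.val (rounds a (c.run S) M S) ≤ 0 := by
          simp only [e, val_sub, val_sizeVar, val_var, rounds_counter, h4, hS]; omega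
        refine ⟨_, ?_, Exec.loop_nonpos hv⟩
        have := key e he S _ _ (by rw [h4, hS]) (hB S le_rfl)
        rw [← hE, ← hu] at this
        have hu1 : 1 ≤ u := by omega
        rw [Nat.sub_zero]
        nlinarith [Nat.zero_le (Q.eval S * u), Nat.zero_le (F.eval S * u)]
      | succ n ihn =>
        intro hn
        obtain ⟨t, ht, hEx⟩ := ihn (by omega)
        set N := rounds a (c.run S) M (S - (n + 1)) with hN
        have hN4 : N 4 0 = S := by rw [hN, h4, hS]
        have hNB := hB (S - (n + 1)) (by omega)
        rw [← hN] at hNB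
        have hNa : N a 0 = ((S - (n + 1) : ℕ) : ℤ) := rounds_counter _ _
        have hv : 0 < e.val N := by
          simp only [e, val_sub, val_sizeVar, val_var, hNa, hN4]; omega
        obtain ⟨hb, s, hs, hEs⟩ := h S _ N hN4 hNB
        have hca : c.run S N a = N a := run_frame S c hc.2.1 N
        have hnext : (c.run S N).store a 0 (f.val (c.run S N)) =
            rounds a (c.run S) M (S - n) := by
          have : S - n = (S - (n + 1)) + 1 := by omega
          rw [this, rounds, ← hN]
          simp only [f, val_add, val_var, val_one, hca, hNa]
        have hcost : (0 : Expr).cost (c.run S N) = 1 := rfl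
        refine ⟨e.cost N + 1 + (s + ((0 : Expr).cost (c.run S N) + f.cost (c.run S N) + 1)) + t, ?_,
          Exec.loop_pos hv (Exec.seq hEs ?_) hEx⟩
        · have h1 := key e he S _ _ hN4 hNB
          have h2 : f.cost (c.run S N) ≤ 2 * (k + K.eval S) + 15 := by
            have hb1 : bitLength (N a 0) ≤ k + K.eval S + 2 := bitLength_le (hNB _ _)
            have hb2 : bitLength (N a 0 + 1) ≤ k + K.eval S + 1 + 2 := by
              refine bitLength_le ((Int.natAbs_add_le _ _).trans ?_)
              have := hNB a 0
              have h1 : 1 ≤ 2 ^ (k + K.eval S) := Nat.one_le_two_pow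
              rw [pow_succ]
              simp only [Int.natAbs_one]
              omega
            have : f.cost (c.run S N) = (1 + bitLength (N a 0)) + bitLength (1 : ℤ) +
                bitLength (N a 0 + 1) := by
              rw [← hca]; rfl
            have h3 : bitLength (1 : ℤ) = 2 := rfl
            omega
          rw [← hE, ← hu] at h1
          rw [← hu] at hs
          rw [hcost]
          have hFw : 8 ≤ F.eval S := by
            have : f.weight = 5 := rfl
            rw [hF, this]; nlinarith
          have hu1 : 1 ≤ u := by omega
          nlinarith [Nat.mul_le_mul hFw hu1, Nat.mul_le_mul hFw (le_refl u)]
        · rw [← hnext]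
          exact Exec.write _ a 0 f
    obtain ⟨t, ht, hEx⟩ := hloop S le_rfl
    rw [Nat.sub_self] at hEx
    refine ⟨3 + t, ?_, Exec.seq (Exec.write M a 0 0) hEx⟩
    simp only [Polynomial.eval_add, Polynomial.eval_mul, Polynomial.eval_X,
        Polynomial.eval_one, Polynomial.eval_ofNat]
    have : u ≤ (K.eval S + 1) * (k + 1) := by nlinarith [Nat.zero_le (K.eval S * k)]
    calc 3 + t ≤ 10 * (k + 1) +
          (S + 1) * ((E.eval S + Q.eval S + F.eval S + 10) * ((K.eval S + 1) * (k + 1))) := by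
          refine add_le_add (by omega) (ht.trans ?_)
          gcongr
      _ = _ := by ring

end Cmd

end RAM

/-! ## Shortest paths by rounds of relaxation -/

namespace UTVPI

/-- `E` arises from `D` by relaxing each arc `R t h ℓ` (from `t` to `h`, of length `ℓ`) that
satisfies `A`, in some order. -/
structure Relaxed (R A : ℤ → ℤ → ℤ → Prop) (D E : ℤ → ℤ) : Prop where
  le : ∀ u, E u ≤ D u
  arc : ∀ t h ℓ, A t h ℓ → E h ≤ D t + ℓ
  attained : ∀ u, E u = D u ∨ ∃ t ℓ, R t u ℓ ∧ E t + ℓ ≤ E u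

/-- The distances `D` are stable, and each is an initial one or attained through an arc. -/
structure Settled (R : ℤ → ℤ → ℤ → Prop) (D₀ D : ℤ → ℤ) : Prop where
  arc : ∀ t h ℓ, R t h ℓ → D h ≤ D t + ℓ
  attained : ∀ u, D u = D₀ u ∨ ∃ t ℓ, R t u ℓ ∧ D u = D t + ℓ

/-- The number of elements of `V` with a smaller value of `G`. -/
def rank (V : Finset ℤ) (G : ℤ → ℤ) (u : ℤ) : ℕ := (V.filter fun v => G v < G u).card

theorem rank_lt_rank {V : Finset ℤ} {G : ℤ → ℤ} {t u : ℤ} (ht : t ∈ V) (h : G t < G u) :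
    rank V G t < rank V G u := by
  refine Finset.card_lt_card (Finset.ssubset_iff_of_subset ?_ |>.2 ⟨t, ?_, ?_⟩)
  · intro v hv
    simp only [Finset.mem_filter] at hv ⊢
    exact ⟨hv.1, hv.2.trans h⟩
  · simp [ht, h]
  · simp

theorem rank_lt_card {V : Finset ℤ} {G : ℤ → ℤ} {u : ℤ} (hu : u ∈ V) :
    rank V G u < V.card :=
  Finset.card_lt_card (Finset.filter_ssubset.2 ⟨u, hu, lt_irrefl _⟩)

/-- If the lengths are positive after a change of potential, then as many rounds of relaxation as
there are nodes give stable distances. -/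
theorem settled_iterate {V : Finset ℤ} {R : ℤ → ℤ → ℤ → Prop}
    (hV : ∀ t h ℓ, R t h ℓ → t ∈ V ∧ h ∈ V) {q : ℤ → ℤ}
    (hq : ∀ t h ℓ, R t h ℓ → q h < q t + ℓ) {P : (ℤ → ℤ) → ℤ → ℤ}
    (hP : ∀ D, Relaxed R R D (P D)) (D₀ : ℤ → ℤ) {n : ℕ} (hn : V.card ≤ n) :
    Settled R D₀ (P^[n] D₀) := by
  set s : ℕ → ℤ → ℤ := fun i => P^[i] D₀ with hs
  have hstep : ∀ i, Relaxed R R (s i) (s (i + 1)) := fun i => by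
    simp only [hs, Function.iterate_succ_apply']; exact hP _
  have hanti : ∀ u, Antitone fun i => s i u := fun u =>
    antitone_nat_of_succ_le fun i => (hstep i).le u
  -- Only `≤` persists during the rounds, since the tail of the attaining arc may drop later.
  -- Stability turns it into an equality at the end.
  have hJ : ∀ i u, s i u = D₀ u ∨ ∃ t ℓ, R t u ℓ ∧ s i t + ℓ ≤ s i u := by
    intro i
    induction i with
    | zero => exact fun u => Or.inl rfl
    | succ i ih =>
      intro u
      rcases (hstep i).attained u with h | h
      · rw [h]
        rcases ih u with h' | ⟨t, ℓ, hR, h'⟩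
        · exact Or.inl h'
        · exact Or.inr ⟨t, ℓ, hR, by have := (hstep i).le t; linarith⟩
      · exact Or.inr h
  obtain ⟨b, hb⟩ : ∃ b, ∀ u ∈ V, b ≤ D₀ u - q u := by
    obtain ⟨b, hb⟩ := (V.image fun u => D₀ u - q u).bddBelow
    exact ⟨b, fun u hu => hb (Finset.mem_coe.2 (Finset.mem_image_of_mem _ hu))⟩
  -- At a minimum of `s i - q`, an attaining arc would start at a still smaller value; so the
  -- minimum is an initial value.
  have hlow : ∀ i, ∀ u ∈ V, b ≤ s i u - q u := by
    intro i u hu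
    obtain ⟨v, hv, hmin⟩ := V.exists_min_image (fun u => s i u - q u) ⟨u, hu⟩
    refine le_trans ?_ (hmin u hu)
    rcases hJ i v with h | ⟨t, ℓ, hR, h⟩
    · rw [h]; exact hb v hv
    · have h1 := hmin t (hV _ _ _ hR).1
      have h2 := hq _ _ _ hR
      linarith
  -- A round with the least total height above the lower bound is a limit: no later round can lower
  -- an entry any more.
  obtain ⟨i₀, hi₀⟩ : ∃ i₀, ∀ i, ∑ u ∈ V, (s i₀ u - q u - b).toNat ≤
      ∑ u ∈ V, (s i u - q u - b).toNat := by
    obtain ⟨i, hi⟩ := WellFounded.has_min (measure fun i : ℕ =>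
      ∑ u ∈ V, (s i u - q u - b).toNat).wf Set.univ ⟨0, trivial⟩
    exact ⟨i, fun j => not_lt.1 (hi.2 j trivial)⟩
  set G := s i₀ with hG
  have hlim : ∀ i, ∀ u ∈ V, G u ≤ s i u := by
    intro i u hu
    rcases le_total i i₀ with h | h
    · exact hanti u h
    · by_contra hlt
      refine absurd (hi₀ i) (not_le.2 (Finset.sum_lt_sum (fun v hv => ?_) ⟨u, hu, ?_⟩))
      · have : s i v ≤ G v := hanti v h
        omega
      · have := hlow i u hu
        omega
  have hGarc : ∀ t h ℓ, R t h ℓ → G h ≤ G t + ℓ := fun t h ℓ hR =>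
    (hlim (i₀ + 1) h (hV _ _ _ hR).2).trans ((hstep i₀).arc t h ℓ hR)
  -- An arc attaining the limit at `u` starts at a node with smaller `G - q`, hence of smaller rank,
  -- whose distance is final one round earlier.
  have hrank : ∀ i, ∀ u ∈ V, rank V (fun u => G u - q u) u ≤ i → s i u = G u := by
    intro i
    induction i with
    | zero =>
      intro u hu hr
      rcases hJ i₀ u with h | ⟨t, ℓ, hR, h⟩
      · exact h.symm
      · have h1 : G t - q t < G u - q u := by have := hq _ _ _ hR; linarith
        have := rank_lt_rank (hV _ _ _ hR).1 (G := fun u => G u - q u) h1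
        omega
    | succ i ih =>
      intro u hu hr
      refine le_antisymm ?_ (hlim _ u hu)
      rcases hJ i₀ u with h | ⟨t, ℓ, hR, h⟩
      · rw [hG, h]; exact hanti u (Nat.zero_le _)
      · have h1 : G t - q t < G u - q u := by have := hq _ _ _ hR; linarith
        have := rank_lt_rank (hV _ _ _ hR).1 (G := fun u => G u - q u) h1
        have h2 := (hstep i).arc _ _ _ hR
        rw [ih t (hV _ _ _ hR).1 (by omega)] at h2
        exact h2.trans h
  have hfin : ∀ u ∈ V, s n u = G u := fun u hu =>
    hrank n u hu ((rank_lt_card hu).le.trans hn)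
  have harc : ∀ t h ℓ, R t h ℓ → s n h ≤ s n t + ℓ := fun t h ℓ hR => by
    rw [hfin t (hV _ _ _ hR).1, hfin h (hV _ _ _ hR).2]; exact hGarc _ _ _ hR
  exact ⟨harc, fun u => (hJ n u).imp_right fun ⟨t, ℓ, hR, h⟩ =>
    ⟨t, ℓ, hR, le_antisymm (harc _ _ _ hR) h⟩⟩

/-- If initial distances are multiples of `S` and lengths are `1` modulo `S`, then stable
distances modulo `S` count the arcs of a shortest path. -/
theorem Settled.emod_lt {V : Finset ℤ} {R : ℤ → ℤ → ℤ → Prop}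
    (hV : ∀ t h ℓ, R t h ℓ → t ∈ V ∧ h ∈ V) {q : ℤ → ℤ}
    (hq : ∀ t h ℓ, R t h ℓ → q h < q t + ℓ) {S : ℕ} (hS : V.card < S)
    (hR : ∀ t h ℓ, R t h ℓ → ∃ a, ℓ = S * a + 1) {D₀ D : ℤ → ℤ}
    (hD₀ : ∀ u ∈ V, (S : ℤ) ∣ D₀ u) (h : Settled R D₀ D) {u : ℤ} (hu : u ∈ V) :
    D u % S + 1 < S := by
  -- `D - q` strictly increases along attaining arcs, so the rank of `u` bounds the number of arcs
  -- on its path.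
  have key : ∀ r, ∀ u ∈ V, rank V (fun u => D u - q u) u = r →
      ∃ (a : ℤ) (i : ℕ), i ≤ r ∧ D u = S * a + i := by
    intro r
    induction r using Nat.strong_induction_on with
    | _ r ih =>
      intro u hu hr
      rcases h.attained u with h0 | ⟨t, ℓ, hRt, ht⟩
      · obtain ⟨a, ha⟩ := hD₀ u hu
        exact ⟨a, 0, Nat.zero_le _, by simp [h0, ha]⟩
      · have h1 : D t - q t < D u - q u := by have := hq _ _ _ hRt; linarith
        have h2 := rank_lt_rank (hV _ _ _ hRt).1 (G := fun u => D u - q u) h1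
        obtain ⟨a, i, hi, hD⟩ := ih _ (hr ▸ h2) t (hV _ _ _ hRt).1 rfl
        obtain ⟨c, rfl⟩ := hR _ _ _ hRt
        exact ⟨a + c, i + 1, by omega, by rw [ht, hD]; push_cast; ring⟩
  obtain ⟨a, i, hi, hD⟩ := key _ u hu rfl
  have := rank_lt_card (G := fun u => D u - q u) hu
  rw [hD, Int.mul_add_emod_self_left, Int.emod_eq_of_lt] <;> omega

/-- The remainder has room for one more arc, so the `+ 1` causes no carry into the quotient. -/
theorem ediv_le_of_le {S x y s : ℤ} (hx : x % S + 1 < S) (hS : 0 < S)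
    (h : y ≤ x + (S * s + 1)) : y / S ≤ x / S + s := by
  have h1 := Int.mul_ediv_add_emod x S
  have : y / S < x / S + s + 1 := Int.ediv_lt_of_lt_mul hS (by nlinarith)
  omega

theorem ediv_eq_of_eq {S x y s : ℤ} (hx : x % S + 1 < S) (hS : 0 < S)
    (h : y = x + (S * s + 1)) : y / S = x / S + s := by
  refine le_antisymm (ediv_le_of_le hx hS h.le) ?_
  have h1 := Int.mul_ediv_add_emod x S
  have h2 := Int.emod_nonneg x hS.ne'
  exact Int.le_ediv_of_mul_le hS (by nlinarith)

/-- The composition of the maps `f 0, …, f (n - 1)`. -/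
def sweep {α : Type*} (f : ℕ → α → α) : ℕ → α → α
  | 0, x => x
  | k + 1, x => f k (sweep f k x)

/-- The relaxation of an arc. -/
def relax (D : ℤ → ℤ) (t h ℓ : ℤ) : ℤ → ℤ :=
  if D t + ℓ < D h then Function.update D h (D t + ℓ) else D

/-- Relaxing only lowers entries. This keeps the upper bounds of `arc`, and it keeps `attained` at
unchanged heads because there the tail is read from the new distances. -/
theorem Relaxed.relax {R A : ℤ → ℤ → ℤ → Prop} {D E : ℤ → ℤ} (hE : Relaxed R A D E)
    {t h ℓ : ℤ} (hR : R t h ℓ) :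
    Relaxed R (fun t' h' ℓ' => A t' h' ℓ' ∨ t' = t ∧ h' = h ∧ ℓ' = ℓ) D (relax E t h ℓ) := by
  have hle : ∀ u, UTVPI.relax E t h ℓ u ≤ E u := by
    intro u
    unfold UTVPI.relax
    split
    · by_cases hu : u = h
      · subst hu; rw [Function.update_self]; omega
      · rw [Function.update_of_ne hu]
    · exact le_rfl
  have hh : UTVPI.relax E t h ℓ h ≤ E t + ℓ := by
    unfold UTVPI.relax
    split
    · rw [Function.update_self]
    · omega
  refine ⟨fun u => (hle u).trans (hE.le u), ?_, fun u => ?_⟩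
  · rintro t' h' ℓ' (hA | ⟨rfl, rfl, rfl⟩)
    · exact (hle _).trans (hE.arc _ _ _ hA)
    · have := hE.le t'; linarith
  · by_cases hu : UTVPI.relax E t h ℓ u = E u
    · rw [hu]
      refine (hE.attained u).imp_right fun ⟨t', ℓ', hR', h'⟩ => ⟨t', ℓ', hR', ?_⟩
      have := hle t'; linarith
    · right
      have hlt : E t + ℓ < E h := by
        by_contra hlt
        exact hu (by simp [UTVPI.relax, hlt])
      have huh : u = h := by
        by_contra huh
        exact hu (by simp [UTVPI.relax, hlt, huh])
      subst huh
      refine ⟨t, ℓ, hR, ?_⟩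
      have h1 := hle t
      have h2 : UTVPI.relax E t u ℓ u = E t + ℓ := by simp [UTVPI.relax, hlt]
      linarith

/-! ## Residual networks -/

/-- The length of arc `k` in the residual network. -/
def arcLength (S : ℕ) (T H C p : ℤ → ℤ) (k : ℤ) : ℤ := S * (p (T k) - p (H k) - C k) + 1

/-- The residual network of a flow `F`: all arcs, and the reversals of those that carry flow. -/
def Residual (S : ℕ) (T H C F p : ℤ → ℤ) (t h ℓ : ℤ) : Prop :=
  ∃ k : ℕ, k < S ∧ ((t = T k ∧ h = H k ∧ ℓ = arcLength S T H C p k) ∨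
    (0 < F k ∧ t = H k ∧ h = T k ∧ ℓ = 1))

/-- The relaxation of arc `k` and its reversal. -/
def relaxArc (S : ℕ) (T H C F p : ℤ → ℤ) (k : ℕ) (D : ℤ → ℤ) : ℤ → ℤ :=
  let E := relax D (T k) (H k) (arcLength S T H C p k)
  if 0 < F k then relax E (H k) (T k) 1 else E

/-- A round of relaxation. -/
def relaxAll (S : ℕ) (T H C F p : ℤ → ℤ) (D : ℤ → ℤ) : ℤ → ℤ :=
  sweep (relaxArc S T H C F p) S D

theorem Relaxed.mono {R A B : ℤ → ℤ → ℤ → Prop} {D E : ℤ → ℤ} (h : Relaxed R A D E)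
    (hB : ∀ t h ℓ, B t h ℓ → A t h ℓ) : Relaxed R B D E :=
  ⟨h.le, fun _ _ _ hb => h.arc _ _ _ (hB _ _ _ hb), h.attained⟩

theorem relaxed_relaxAll (S : ℕ) (T H C F p D : ℤ → ℤ) :
    Relaxed (Residual S T H C F p) (Residual S T H C F p) D (relaxAll S T H C F p D) := by
  have key : ∀ n ≤ S, Relaxed (Residual S T H C F p)
      (fun t h ℓ => ∃ k : ℕ, k < n ∧ ((t = T k ∧ h = H k ∧ ℓ = arcLength S T H C p k) ∨
        (0 < F k ∧ t = H k ∧ h = T k ∧ ℓ = 1))) D (sweep (relaxArc S T H C F p) n D) := by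
    intro n
    induction n with
    | zero => exact fun _ => ⟨fun _ => le_rfl, fun _ _ _ ⟨k, hk, _⟩ => by omega, fun _ => Or.inl rfl⟩
    | succ n ih =>
      intro hn
      have h1 := (ih (by omega)).relax (t := T n) (h := H n) (ℓ := arcLength S T H C p n)
        ⟨n, hn, Or.inl ⟨rfl, rfl, rfl⟩⟩
      simp only [sweep, relaxArc]
      split
      case isTrue hF =>
        refine (h1.relax (t := H n) (h := T n) (ℓ := 1)
          ⟨n, hn, Or.inr ⟨hF, rfl, rfl, rfl⟩⟩).mono ?_
        rintro t h ℓ ⟨k, hk, hk'⟩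
        rcases Nat.lt_succ_iff_lt_or_eq.1 hk with hk | rfl
        · exact Or.inl (Or.inl ⟨k, hk, hk'⟩)
        · rcases hk' with h | h
          · exact Or.inl (Or.inr h)
          · exact Or.inr h.2
      case isFalse hF =>
        refine h1.mono ?_
        rintro t h ℓ ⟨k, hk, hk'⟩
        rcases Nat.lt_succ_iff_lt_or_eq.1 hk with hk | rfl
        · exact Or.inl ⟨k, hk, hk'⟩
        · rcases hk' with h | h
          · exact Or.inr h
          · exact absurd h.1 hF
  exact key S le_rfl

/-- The nodes: `j + 1` stands for the variable `x j`, `-(j + 1)` for `- x j`, and `0` for `0`. -/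
noncomputable def nodes (n : ℕ) : Finset ℤ := Finset.Icc (-n) n

theorem mem_nodes {n : ℕ} {u : ℤ} : u ∈ nodes n ↔ -(n : ℤ) ≤ u ∧ u ≤ n := Finset.mem_Icc

theorem neg_mem_nodes {n : ℕ} {u : ℤ} (h : u ∈ nodes n) : -u ∈ nodes n := by
  rw [mem_nodes] at *; omega

theorem card_nodes (n : ℕ) : (nodes n).card = 2 * n + 1 := by
  rw [nodes, Int.card_Icc]; omega

/-- The arcs `k < S` join nodes, and there are few nodes. -/
structure Net (S n : ℕ) (T H : ℤ → ℤ) : Prop where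
  size : 2 * n + 1 < S
  tail : ∀ k : ℕ, k < S → T k ∈ nodes n
  head : ∀ k : ℕ, k < S → H k ∈ nodes n

/-- The potential `p` satisfies the constraints `C k ≤ p (T k) - p (H k)`. -/
def Potential (S : ℕ) (T H C p : ℤ → ℤ) : Prop := ∀ k : ℕ, k < S → C k ≤ p (T k) - p (H k)

/-- The flow `F` is nonnegative and only on arcs that are tight for `p`. -/
def Complementary (S : ℕ) (T H C F p : ℤ → ℤ) : Prop :=
  ∀ k : ℕ, k < S → 0 ≤ F k ∧ (0 < F k → p (T k) - p (H k) = C k)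

theorem Residual.mem_nodes {S n : ℕ} {T H C F p : ℤ → ℤ} (hN : Net S n T H) (t h ℓ : ℤ)
    (hR : Residual S T H C F p t h ℓ) : t ∈ nodes n ∧ h ∈ nodes n := by
  obtain ⟨k, hk, ⟨rfl, rfl, -⟩ | ⟨-, rfl, rfl, -⟩⟩ := hR
  exacts [⟨hN.tail k hk, hN.head k hk⟩, ⟨hN.head k hk, hN.tail k hk⟩]

theorem Residual.emod_eq {S : ℕ} {T H C F p : ℤ → ℤ} (t h ℓ : ℤ)
    (hR : Residual S T H C F p t h ℓ) : ∃ a, ℓ = S * a + 1 := by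
  obtain ⟨k, hk, ⟨-, -, rfl⟩ | ⟨-, -, -, rfl⟩⟩ := hR
  exacts [⟨_, rfl⟩, ⟨0, by simp⟩]

/-- The `+ 1` in each length makes even tight arcs strictly positive, so the constant `0` can serve
as the strict potential `q` of `settled_iterate`. -/
theorem Residual.pos {S : ℕ} {T H C F p : ℤ → ℤ} (hp : Potential S T H C p) (t h ℓ : ℤ)
    (hR : Residual S T H C F p t h ℓ) : 0 < ℓ := by
  obtain ⟨k, hk, ⟨-, -, rfl⟩ | ⟨-, -, -, rfl⟩⟩ := hR
  · have := hp k hk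
    have : (0 : ℤ) ≤ S * (p (T k) - p (H k) - C k) := mul_nonneg (by omega) (by omega)
    unfold arcLength; omega
  · exact one_pos

/-- Without flow, the distances from a zero potential give a potential, if there is one. -/
theorem potential_ediv {S n : ℕ} {T H C : ℤ → ℤ} (hN : Net S n T H) {z : ℤ → ℤ}
    (hz : Potential S T H C z) {F p D₀ : ℤ → ℤ} (hF : ∀ k, F k = 0) (hp : ∀ u, p u = 0)
    (hD₀ : ∀ u ∈ nodes n, D₀ u = 0) :
    Potential S T H C fun u => (relaxAll S T H C F p)^[S] D₀ u / S := by
  -- With `p = 0` the lengths are `1 - S * C k` and may be negative; the multiple `S * z` of a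
  -- solution is the strict potential that rules out bad cycles.
  have hq : ∀ t h ℓ, Residual S T H C F p t h ℓ → (S : ℤ) * z h < S * z t + ℓ := by
    rintro t h ℓ ⟨k, hk, ⟨rfl, rfl, rfl⟩ | ⟨h, -⟩⟩
    · have h1 := hz k hk
      have : (0 : ℤ) ≤ S * (z (T k) - z (H k) - C k) := mul_nonneg (by omega) (by omega)
      simp only [arcLength, hp]
      linarith
    · rw [hF] at h; omega
  have hV := Residual.mem_nodes (C := C) (F := F) (p := p) hN
  have hS : (nodes n).card < S := by rw [card_nodes]; exact hN.size
  have hset := settled_iterate hV (q := fun u => S * z u) hq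
    (relaxed_relaxAll S T H C F p) D₀ hS.le
  intro k hk
  have hm := hset.emod_lt hV (q := fun u => S * z u) hq hS Residual.emod_eq
    (fun u hu => by simp [hD₀ u hu]) (hN.tail k hk)
  have h1 := hset.arc _ _ _ ⟨k, hk, Or.inl ⟨rfl, rfl, rfl⟩⟩
  have h2 := ediv_le_of_le hm (by omega) h1
  simp only [hp] at h2
  simp only
  linarith

/-- The properties of the distances `D` from the node `s`, with initial bound `S * B`. -/
structure Distances (S n : ℕ) (T H C F p : ℤ → ℤ) (s B : ℤ) (D : ℤ → ℤ) : Prop where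
  settled : ∀ t h ℓ, Residual S T H C F p t h ℓ → D h ≤ D t + ℓ
  attained : ∀ u ∈ nodes n, u ≠ s → D u = S * B ∨
    ∃ t ℓ, Residual S T H C F p t u ℓ ∧ D u = D t + ℓ
  source : D s = 0
  nonneg : ∀ u ∈ nodes n, 0 ≤ D u
  le : ∀ u ∈ nodes n, D u ≤ S * B
  emod_lt : ∀ u ∈ nodes n, D u % S + 1 < S

/-- The initial value `S * B` acts like an extra arc of that length from `s` to every other node.
All lengths being positive, no entry becomes negative and `s` stays at zero. -/
theorem distances_iterate {S n : ℕ} {T H C F p : ℤ → ℤ} (hN : Net S n T H)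
    (hp : Potential S T H C p) {s B : ℤ} (hs : s ∈ nodes n) (hB : 0 ≤ B)
    {D₀ : ℤ → ℤ} (hD₀ : ∀ u ∈ nodes n, D₀ u = if u = s then 0 else S * B) :
    Distances S n T H C F p s B ((relaxAll S T H C F p)^[S] D₀) := by
  have hq : ∀ t h ℓ, Residual S T H C F p t h ℓ → (fun _ => 0 : ℤ → ℤ) h < 0 + ℓ := by
    intro t h ℓ hR
    have := Residual.pos hp _ _ _ hR
    simpa using this
  have hV := Residual.mem_nodes (C := C) (F := F) (p := p) hN
  have hS : (nodes n).card < S := by rw [card_nodes]; exact hN.size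
  have hset := settled_iterate hV (q := fun _ => 0) hq (relaxed_relaxAll S T H C F p) D₀ hS.le
  have hSB : (0 : ℤ) ≤ S * B := mul_nonneg (by omega) hB
  have hle : ∀ i u, (relaxAll S T H C F p)^[i] D₀ u ≤ D₀ u := by
    intro i
    induction i with
    | zero => exact fun _ => le_rfl
    | succ i ih =>
      intro u
      rw [Function.iterate_succ_apply']
      exact ((relaxed_relaxAll S T H C F p _).le u).trans (ih u)
  have hnn : ∀ u ∈ nodes n, 0 ≤ (relaxAll S T H C F p)^[S] D₀ u := by
    intro u hu
    obtain ⟨v, hv, hmin⟩ := (nodes n).exists_min_image ((relaxAll S T H C F p)^[S] D₀) ⟨u, hu⟩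
    refine le_trans ?_ (hmin u hu)
    rcases hset.attained v with h | ⟨t, ℓ, hR, h⟩
    · rw [h, hD₀ v hv]; split <;> omega
    · have h1 := hmin t (hV _ _ _ hR).1
      have h2 := Residual.pos hp _ _ _ hR
      omega
  refine ⟨hset.arc, ?_, ?_, hnn, ?_, ?_⟩
  · intro u hu hus
    have := hset.attained u
    rwa [hD₀ u hu, if_neg hus] at this
  · have h1 := hle S s
    rw [hD₀ s hs, if_pos rfl] at h1
    exact le_antisymm h1 (hnn s hs)
  · intro u hu
    refine (hle S u).trans ?_
    rw [hD₀ u hu]; split <;> omega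
  · intro u hu
    refine hset.emod_lt hV hq hS Residual.emod_eq (fun u hu => ?_) hu
    rw [hD₀ u hu]
    split
    exacts [dvd_zero _, dvd_mul_right _ _]

namespace Distances

variable {S n : ℕ} {T H C F p : ℤ → ℤ} {s B : ℤ} {D : ℤ → ℤ}

theorem ediv_head_le (hD : Distances S n T H C F p s B D) (hN : Net S n T H) {k : ℕ}
    (hk : k < S) : D (H k) / S ≤ D (T k) / S + (p (T k) - p (H k) - C k) :=
  ediv_le_of_le (hD.emod_lt _ (hN.tail k hk)) (by omega)
    (hD.settled _ _ _ ⟨k, hk, Or.inl ⟨rfl, rfl, rfl⟩⟩)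

theorem ediv_tail_le (hD : Distances S n T H C F p s B D) (hN : Net S n T H) {k : ℕ}
    (hk : k < S) (hF : 0 < F k) : D (T k) / S ≤ D (H k) / S := by
  have := ediv_le_of_le (s := 0) (hD.emod_lt _ (hN.head k hk)) (by omega)
    ((hD.settled _ _ _ ⟨k, hk, Or.inr ⟨hF, rfl, rfl, rfl⟩⟩).trans (by simp))
  simpa using this

/-- Adding the distances to a potential gives a potential. -/
theorem potential_add (hD : Distances S n T H C F p s B D) (hN : Net S n T H) {p' : ℤ → ℤ}
    (hp' : ∀ u ∈ nodes n, p' u = p u + D u / S) : Potential S T H C p' := by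
  intro k hk
  have := hD.ediv_head_le hN hk
  rw [hp' _ (hN.tail k hk), hp' _ (hN.head k hk)]
  linarith

/-- An arc with flow has reduced cost zero and a reversal of length `1`. The quotients at its ends
bound each other in both directions, hence agree, and the arc stays tight. -/
theorem complementary_add (hD : Distances S n T H C F p s B D) (hN : Net S n T H) {p' : ℤ → ℤ}
    (hp' : ∀ u ∈ nodes n, p' u = p u + D u / S) (hF : Complementary S T H C F p) :
    Complementary S T H C F p' := by
  refine fun k hk => ⟨(hF k hk).1, fun h => ?_⟩
  have h1 := hD.ediv_head_le hN hk
  have h2 := hD.ediv_tail_le hN hk h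
  have h3 := (hF k hk).2 h
  rw [hp' _ (hN.tail k hk), hp' _ (hN.head k hk)]
  linarith

end Distances

end UTVPI

namespace UTVPI

/-! ## Flows and duality -/

/-- The net flow out of the node `u`. -/
def divergence (S : ℕ) (T H F : ℤ → ℤ) (u : ℤ) : ℤ :=
  ∑ k ∈ Finset.range S, F k * ((if u = T k then 1 else 0) - (if u = H k then 1 else 0))

theorem divergence_update {S : ℕ} (T H F : ℤ → ℤ) {k : ℕ} (hk : k < S) (a u : ℤ) :
    divergence S T H (Function.update F k (F k + a)) u =
      divergence S T H F u + a * ((if u = T k then 1 else 0) - (if u = H k then 1 else 0)) := by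
  have : ∀ i : ℕ, Function.update F k (F k + a) (i : ℤ) = F i + if i = k then a else 0 := by
    intro i
    by_cases h : i = k
    · subst h; simp
    · rw [Function.update_of_ne (by exact_mod_cast h)]; simp [h]
  simp only [divergence, this, add_mul, Finset.sum_add_distrib, ite_mul, zero_mul]
  rw [Finset.sum_ite_eq' (Finset.range S) k, if_pos (Finset.mem_range.2 hk)]

theorem divergence_two_mul (S : ℕ) (T H F : ℤ → ℤ) (u : ℤ) :
    divergence S T H (fun k => 2 * F k) u = 2 * divergence S T H F u := by
  simp only [divergence, Finset.mul_sum, mul_assoc]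

theorem divergence_congr {S : ℕ} {T H F F' : ℤ → ℤ} (h : ∀ k : ℕ, k < S → F' k = F k) (u : ℤ) :
    divergence S T H F' u = divergence S T H F u :=
  Finset.sum_congr rfl fun k hk => by rw [h k (Finset.mem_range.1 hk)]

theorem sum_divergence_mul {S n : ℕ} {T H : ℤ → ℤ} (hN : Net S n T H) (F p : ℤ → ℤ) :
    ∑ u ∈ nodes n, divergence S T H F u * p u =
      ∑ k ∈ Finset.range S, F k * (p (T k) - p (H k)) := by
  simp only [divergence, Finset.sum_mul]
  rw [Finset.sum_comm]
  refine Finset.sum_congr rfl fun k hk => ?_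
  have hk := Finset.mem_range.1 hk
  simp only [mul_assoc, sub_mul, ← Finset.mul_sum, Finset.sum_sub_distrib, ite_mul, one_mul,
    zero_mul, Finset.sum_ite_eq', hN.tail k hk, hN.head k hk, if_true]

/-- A potential that is complementary to a flow is optimal for the divergence of the flow. -/
theorem weak_duality {S n : ℕ} {T H C F p z : ℤ → ℤ} (hN : Net S n T H)
    (hF : Complementary S T H C F p) (hz : Potential S T H C z) :
    ∑ u ∈ nodes n, divergence S T H F u * p u ≤ ∑ u ∈ nodes n, divergence S T H F u * z u := by
  rw [sum_divergence_mul hN, sum_divergence_mul hN]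
  refine Finset.sum_le_sum fun k hk => ?_
  have hk := Finset.mem_range.1 hk
  obtain ⟨h0, h1⟩ := hF k hk
  rcases h0.eq_or_lt with h | h
  · rw [← h]; simp
  · rw [h1 h]
    exact mul_le_mul_of_nonneg_left (hz k hk) h0

/-- The odd extension of a function on the positive integers. -/
def oddExt (a : ℤ → ℤ) (u : ℤ) : ℤ := if 0 < u then a u else if u < 0 then -a (-u) else 0

theorem oddExt_neg (a : ℤ → ℤ) (u : ℤ) : oddExt a (-u) = -oddExt a u := by
  unfold oddExt
  rcases lt_trichotomy u 0 with h | rfl | h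
  · simp [h, h.not_gt]
  · simp
  · simp [h, h.not_gt]

theorem oddExt_of_pos (a : ℤ → ℤ) {u : ℤ} (h : 0 < u) : oddExt a u = a u := if_pos h

/-- With supply `a j` at `j + 1` and demand `a j` at `-(j + 1)`, the pairing in `weak_duality`
becomes the objective of the relaxation. -/
theorem sum_oddExt_mul (a p : ℤ → ℤ) (n : ℕ) : ∑ u ∈ nodes n, oddExt a u * p u =
    ∑ j ∈ Finset.range n, a (j + 1) * (p (j + 1) - p (-(j + 1))) := by
  induction n with
  | zero => simp [nodes, oddExt]
  | succ n ih =>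
    have : nodes (n + 1) = insert ((n : ℤ) + 1) (insert (-((n : ℤ) + 1)) (nodes n)) := by
      ext u
      simp only [Finset.mem_insert, mem_nodes]
      push_cast
      omega
    rw [this, Finset.sum_insert, Finset.sum_insert, ih, Finset.sum_range_succ, oddExt_neg,
      oddExt_of_pos _ (by omega)]
    · ring
    · rw [mem_nodes]; omega
    · rw [Finset.mem_insert, mem_nodes]; omega

/-! ## Tracing a shortest path -/

/-- Push a unit of flow along arc `k` if it ends a shortest path to the current node. -/
def traceForward (S : ℕ) (T H C p D : ℤ → ℤ) (k : ℕ) (x : (ℤ → ℤ) × ℤ) : (ℤ → ℤ) × ℤ :=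
  if H k = x.2 ∧ D (T k) + arcLength S T H C p k ≤ D (H k) then
    (Function.update x.1 k (x.1 k + 1), T k) else x

/-- Push a unit of flow back along arc `k` if its reversal ends a shortest path to the current
node. -/
def traceBackward (T H D : ℤ → ℤ) (k : ℕ) (x : (ℤ → ℤ) × ℤ) : (ℤ → ℤ) × ℤ :=
  if T k = x.2 ∧ 0 < x.1 k ∧ D (H k) + 1 ≤ D (T k) then
    (Function.update x.1 k (x.1 k + -1), H k) else x

/-- A step of tracing a shortest path, with arc `k`. -/
def traceArc (S : ℕ) (T H C p D : ℤ → ℤ) (k : ℕ) (x : (ℤ → ℤ) × ℤ) : (ℤ → ℤ) × ℤ :=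
  traceBackward T H D k (traceForward S T H C p D k x)

/-- Arc `k` or its reversal ends a shortest path to `v`. -/
def Enabled (S : ℕ) (T H C p D F : ℤ → ℤ) (k : ℕ) (v : ℤ) : Prop :=
  (H k = v ∧ D (T k) + arcLength S T H C p k ≤ D (H k)) ∨
    (T k = v ∧ 0 < F k ∧ D (H k) + 1 ≤ D (T k))

/-- The invariant of tracing: `x.1` is the flow and `x.2` the current node. -/
structure Tracing (S n : ℕ) (T H C p D : ℤ → ℤ) (s : ℤ) (p' w : ℤ → ℤ) (x : (ℤ → ℤ) × ℤ) :
    Prop where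
  mem : x.2 ∈ nodes n
  compl : Complementary S T H C x.1 p'
  div : ∀ u, divergence S T H x.1 u = w u + if u = x.2 then 1 else 0
  enabled : ∀ u ∈ nodes n, D u ≤ D x.2 → u ≠ s → ∃ k < S, Enabled S T H C p D x.1 k u

section Trace

variable {S n : ℕ} {T H C F p : ℤ → ℤ} {s B : ℤ} {D p' w : ℤ → ℤ}

theorem arcLength_pos (hp : Potential S T H C p) {k : ℕ} (hk : k < S) :
    0 < arcLength S T H C p k :=
  Residual.pos (F := 0) hp _ _ _ ⟨k, hk, Or.inl ⟨rfl, rfl, rfl⟩⟩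

/-- The arc used satisfies the distance inequality with equality, so it is tight for the new
potential and may carry flow. Its positive length brings the current node strictly closer to `s`. -/
theorem Tracing.forward (hN : Net S n T H) (hp : Potential S T H C p)
    (hD : Distances S n T H C F p s B D) (hp' : ∀ u ∈ nodes n, p' u = p u + D u / S)
    {x : (ℤ → ℤ) × ℤ} (hx : Tracing S n T H C p D s p' w x) {k : ℕ} (hk : k < S) :
    Tracing S n T H C p D s p' w (traceForward S T H C p D k x) ∧
      (D (traceForward S T H C p D k x).2 < D x.2 ∨ (traceForward S T H C p D k x = x ∧
        ¬ (H k = x.2 ∧ D (T k) + arcLength S T H C p k ≤ D (H k)))) := by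
  unfold traceForward
  split
  case isFalse h => exact ⟨hx, Or.inr ⟨rfl, h⟩⟩
  case isTrue h =>
    obtain ⟨hv, hle⟩ := h
    have hlt : D (T k) < D x.2 := by have := arcLength_pos hp hk; rw [← hv]; omega
    refine ⟨⟨hN.tail k hk, ?_, ?_, ?_⟩, Or.inl hlt⟩
    · intro i hi
      by_cases hik : i = k
      · subst hik
        simp only [Function.update_self]
        refine ⟨by have := (hx.compl i hi).1; omega, fun _ => ?_⟩
        have heq := ediv_eq_of_eq (hD.emod_lt _ (hN.tail i hi)) (by omega)
          (le_antisymm (hD.settled _ _ _ ⟨i, hi, Or.inl ⟨rfl, rfl, rfl⟩⟩) hle)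
        rw [hp' _ (hN.tail i hi), hp' _ (hN.head i hi), heq]
        ring
      · simp only [Function.update_of_ne (show (i : ℤ) ≠ k by exact_mod_cast hik)]
        exact hx.compl i hi
    · intro u
      rw [divergence_update T H x.1 hk, hx.div, hv]
      ring
    · intro u hu hDu hus
      obtain ⟨i, hi, h⟩ := hx.enabled u hu (hDu.trans hlt.le) hus
      refine ⟨i, hi, h.imp_right fun ⟨h1, h2, h3⟩ => ⟨h1, ?_, h3⟩⟩
      by_cases hik : i = k
      · subst hik
        simp only [Function.update_self]; omega
      · simpa only [Function.update_of_ne (show (i : ℤ) ≠ k by exact_mod_cast hik)]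

/-- Cancelling flow on arc `k` can only disable `k` as an arc into the node just left. Nodes still
to be visited are strictly closer to `s`, so their arcs remain enabled. -/
theorem Tracing.backward (hN : Net S n T H)
    {x : (ℤ → ℤ) × ℤ} (hx : Tracing S n T H C p D s p' w x) {k : ℕ} (hk : k < S) :
    Tracing S n T H C p D s p' w (traceBackward T H D k x) ∧
      (D (traceBackward T H D k x).2 < D x.2 ∨ (traceBackward T H D k x = x ∧
        ¬ (T k = x.2 ∧ 0 < x.1 k ∧ D (H k) + 1 ≤ D (T k)))) := by
  unfold traceBackward
  split
  case isFalse h => exact ⟨hx, Or.inr ⟨rfl, h⟩⟩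
  case isTrue h =>
    obtain ⟨hv, hpos, hle⟩ := h
    have hlt : D (H k) < D x.2 := by rw [← hv]; omega
    refine ⟨⟨hN.head k hk, ?_, ?_, ?_⟩, Or.inl hlt⟩
    · intro i hi
      by_cases hik : i = k
      · subst hik
        simp only [Function.update_self]
        exact ⟨by omega, fun _ => (hx.compl i hi).2 hpos⟩
      · simp only [Function.update_of_ne (show (i : ℤ) ≠ k by exact_mod_cast hik)]
        exact hx.compl i hi
    · intro u
      rw [divergence_update T H x.1 hk, hx.div, hv]
      ring
    · intro u hu hDu hus
      obtain ⟨i, hi, h⟩ := hx.enabled u hu (hDu.trans hlt.le) hus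
      refine ⟨i, hi, h.imp_right fun ⟨h1, h2, h3⟩ => ⟨h1, ?_, h3⟩⟩
      have hik : i ≠ k := by
        rintro rfl
        rw [← h1, hv] at hDu
        exact absurd hlt (not_lt.2 hDu)
      simpa only [Function.update_of_ne (show (i : ℤ) ≠ k by exact_mod_cast hik)]

theorem Tracing.arc (hN : Net S n T H) (hp : Potential S T H C p)
    (hD : Distances S n T H C F p s B D) (hp' : ∀ u ∈ nodes n, p' u = p u + D u / S)
    {x : (ℤ → ℤ) × ℤ} (hx : Tracing S n T H C p D s p' w x) {k : ℕ} (hk : k < S) :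
    Tracing S n T H C p D s p' w (traceArc S T H C p D k x) ∧
      (D (traceArc S T H C p D k x).2 < D x.2 ∨ (traceArc S T H C p D k x = x ∧
        ¬ Enabled S T H C p D x.1 k x.2)) := by
  obtain ⟨h1, h2⟩ := hx.forward hN hp hD hp' hk
  obtain ⟨h3, h4⟩ := h1.backward hN hk
  refine ⟨h3, ?_⟩
  unfold traceArc
  rcases h2 with h2 | ⟨h2, h2'⟩
  · left
    rcases h4 with h4 | ⟨h4, -⟩
    · exact h4.trans h2
    · rw [h4]; exact h2
  · rw [h2] at h4 ⊢
    refine h4.imp_right fun h => ⟨h.1, fun hE => hE.elim h2' h.2⟩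

/-- A sweep away from `s` makes progress: had the state never changed, the enabled arc promised by
the invariant would have been used when its turn came. -/
theorem Tracing.sweep (hN : Net S n T H) (hp : Potential S T H C p)
    (hD : Distances S n T H C F p s B D) (hp' : ∀ u ∈ nodes n, p' u = p u + D u / S)
    {x : (ℤ → ℤ) × ℤ} (hx : Tracing S n T H C p D s p' w x) :
    Tracing S n T H C p D s p' w (sweep (traceArc S T H C p D) S x) ∧
      D (UTVPI.sweep (traceArc S T H C p D) S x).2 ≤ D x.2 ∧ (x.2 ≠ s →
      D (UTVPI.sweep (traceArc S T H C p D) S x).2 < D x.2) := by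
  have key : ∀ m ≤ S, Tracing S n T H C p D s p' w (UTVPI.sweep (traceArc S T H C p D) m x) ∧
      (D (UTVPI.sweep (traceArc S T H C p D) m x).2 < D x.2 ∨
        (UTVPI.sweep (traceArc S T H C p D) m x = x ∧
          ∀ k < m, ¬ Enabled S T H C p D x.1 k x.2)) := by
    intro m
    induction m with
    | zero => exact fun _ => ⟨hx, Or.inr ⟨rfl, fun k hk => by omega⟩⟩
    | succ m ih =>
      intro hm
      obtain ⟨h1, h2⟩ := ih (by omega)
      obtain ⟨h3, h4⟩ := h1.arc hN hp hD hp' hm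
      refine ⟨h3, ?_⟩
      simp only [UTVPI.sweep]
      rcases h2 with h2 | ⟨h2, h2'⟩
      · left
        rcases h4 with h4 | ⟨h4, -⟩
        · exact h4.trans h2
        · rw [h4]; exact h2
      · rw [h2] at h4 ⊢
        refine h4.imp_right fun h => ⟨h.1, fun k hk => ?_⟩
        rcases Nat.lt_succ_iff_lt_or_eq.1 hk with hk | rfl
        exacts [h2' k hk, h.2]
  obtain ⟨h1, h2⟩ := key S le_rfl
  refine ⟨h1, ?_, fun hs => ?_⟩
  · rcases h2 with h2 | ⟨h2, -⟩
    · exact h2.le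
    · rw [h2]
  · refine h2.resolve_right fun ⟨_, h⟩ => ?_
    obtain ⟨k, hk, hE⟩ := hx.enabled _ hx.mem le_rfl hs
    exact h k hk hE

theorem Tracing.eq_source (hN : Net S n T H) (hp : Potential S T H C p)
    (hD : Distances S n T H C F p s B D)
    {x : (ℤ → ℤ) × ℤ} (hx : Tracing S n T H C p D s p' w x) (h0 : D x.2 ≤ 0) : x.2 = s := by
  by_contra hs
  obtain ⟨k, hk, ⟨h1, h2⟩ | ⟨h1, -, h2⟩⟩ := hx.enabled _ hx.mem le_rfl hs
  · have := hD.nonneg _ (hN.tail k hk)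
    have := arcLength_pos hp hk
    rw [h1] at h2; omega
  · have := hD.nonneg _ (hN.head k hk)
    rw [h1] at h2; omega

/-- Each sweep lowers the rank of the current node until `s` is reached. There are only `2 * n + 1 <
S` ranks, and `s`, the one node at distance zero that the invariant allows, is never left. -/
theorem Tracing.iterate (hN : Net S n T H) (hp : Potential S T H C p)
    (hD : Distances S n T H C F p s B D) (hp' : ∀ u ∈ nodes n, p' u = p u + D u / S)
    {x : (ℤ → ℤ) × ℤ} (hx : Tracing S n T H C p D s p' w x) :
    Tracing S n T H C p D s p' w ((UTVPI.sweep (traceArc S T H C p D) S)^[S] x) ∧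
      ((UTVPI.sweep (traceArc S T H C p D) S)^[S] x).2 = s := by
  have key : ∀ i, Tracing S n T H C p D s p' w ((UTVPI.sweep (traceArc S T H C p D) S)^[i] x) ∧
      (((UTVPI.sweep (traceArc S T H C p D) S)^[i] x).2 = s ∨
      rank (nodes n) D ((UTVPI.sweep (traceArc S T H C p D) S)^[i] x).2 + i ≤ 2 * n + 1) := by
    intro i
    induction i with
    | zero =>
      refine ⟨hx, Or.inr ?_⟩
      have := rank_lt_card (G := D) hx.mem
      rw [card_nodes] at this
      exact this.le
    | succ i ih =>
      obtain ⟨h1, h2⟩ := ih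
      simp only [Function.iterate_succ_apply']
      obtain ⟨h3, h4, h5⟩ := h1.sweep hN hp hD hp'
      refine ⟨h3, ?_⟩
      by_cases hs : ((UTVPI.sweep (traceArc S T H C p D) S)^[i] x).2 = s
      · left
        refine h3.eq_source hN hp hD (h4.trans ?_)
        rw [hs, hD.source]
      · right
        have := rank_lt_rank h3.mem (h5 hs)
        have := h2.resolve_left hs
        omega
  obtain ⟨h1, h2⟩ := key S
  have := hN.size
  exact ⟨h1, h2.resolve_right (by omega)⟩

/-- Augmenting the flow along a shortest path from `s` to `-s`, and adding the distances to the
potential, keeps them complementary. -/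
theorem augment_spec (hN : Net S n T H) (hp : Potential S T H C p)
    (hF : Complementary S T H C F p) (hs : s ∈ nodes n) {k₀ : ℕ}
    (hk₀ : k₀ < S) (hT : T k₀ = s) (hH : H k₀ = -s) (hC : C k₀ = 0)
    (hD : Distances S n T H C F p s (p s - p (-s) + 1) D)
    (hp' : ∀ u ∈ nodes n, p' u = p u + D u / S) {F' : ℤ → ℤ} {v : ℤ}
    (hF' : (UTVPI.sweep (traceArc S T H C p D) S)^[S] (F, -s) = (F', v)) :
    Potential S T H C p' ∧ Complementary S T H C F' p' ∧
      ∀ u, divergence S T H F' u =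
        divergence S T H F u + (if u = s then 1 else 0) - (if u = -s then 1 else 0) := by
  have hsize := hN.size
  -- The flow is viewed as having one unit of excess at the current node; tracing carries this unit
  -- from `-s` to `s`.
  have hx : Tracing S n T H C p D s p'
      (fun u => divergence S T H F u - if u = -s then 1 else 0) (F, -s) := by
    refine ⟨neg_mem_nodes hs, hD.complementary_add hN hp' hF, fun u => by simp, ?_⟩
    intro u hu hDu hus
    -- The arc of `0 ≤ x j` joins `s` to `-s` with length `S * (p s - p (-s)) + 1`, which the `+ 1`
    -- in the bound `B` puts below `S * B`. So nodes no farther than `-s` are not at the cap, and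
    -- their distances are attained by arcs.
    have h1 := hD.settled _ _ _ ⟨k₀, hk₀, Or.inl ⟨rfl, rfl, rfl⟩⟩
    rw [hH, hT, hD.source, arcLength, hT, hH, hC] at h1
    rcases hD.attained u hu hus with h | ⟨t, ℓ, ⟨k, hk, ⟨rfl, rfl, rfl⟩ | ⟨hf, rfl, rfl, rfl⟩⟩, h⟩
    · exfalso
      simp only at hDu
      have : (S : ℤ) * (p s - p (-s) + 1) = S * (p s - p (-s) - 0) + S := by ring
      omega
    · exact ⟨k, hk, Or.inl ⟨rfl, h.ge⟩⟩
    · exact ⟨k, hk, Or.inr ⟨rfl, hf, h.ge⟩⟩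
  obtain ⟨h1, h2⟩ := hx.iterate hN hp hD hp'
  rw [hF'] at h1 h2
  refine ⟨hD.potential_add hN hp', h1.compl, fun u => ?_⟩
  simp only at h2
  rw [h1.div, h2]
  ring

end Trace

/-! ## Rounding -/

/-- The arcs are closed under the symmetry `(t, h) ↦ (-h, -t)`. -/
def SymmetricNet (S : ℕ) (T H C : ℤ → ℤ) : Prop :=
  ∀ k : ℕ, k < S → ∃ k' : ℕ, k' < S ∧ T k' = -H k ∧ H k' = -T k ∧ C k' = C k

section Rounding

variable {S n : ℕ} {T H C F X : ℤ → ℤ} {s : ℤ} {D : ℤ → ℤ}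

/-- An induction principle for the nodes that are reached along tight arcs. -/
theorem Distances.reach_induction (hN : Net S n T H) (hX : Potential S T H C X)
    (hF : ∀ k : ℕ, k < S → F k = 0)
    (hD : Distances S n T H C F X s 1 D) {Q : ℤ → Prop} (hs : Q s)
    (harc : ∀ k : ℕ, k < S → D (T k) < S → X (T k) - X (H k) = C k → Q (T k) → Q (H k))
    {u : ℤ} (hu : u ∈ nodes n) (hDu : D u < S) : Q u := by
  have key : ∀ (r : ℕ), ∀ u ∈ nodes n, D u < S → D u = r → Q u := by
    intro r
    induction r using Nat.strong_induction_on with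
    | _ r ih =>
      intro u hu hDu hr
      by_cases hus : u = s
      · rwa [hus]
      · rcases hD.attained u hu hus with h | ⟨t, ℓ, ⟨k, hk, ⟨rfl, rfl, rfl⟩ | ⟨hf, -⟩⟩, h⟩
        · omega
        · have h0 := hD.nonneg _ (hN.tail k hk)
          have h1 := arcLength_pos hX hk
          have hc := hX k hk
          -- An arc with slack is longer than `S`, too long to end at a reached node.
          have h2 : X (T k) - X (H k) = C k := by
            by_contra hne
            have h3 : (S : ℤ) * 1 ≤ S * (X (T k) - X (H k) - C k) := by
              gcongr; omega
            unfold arcLength at h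
            omega
          refine harc k hk (by omega) h2 (ih (D (T k)).toNat ?_ _ (hN.tail k hk) (by omega) ?_)
          all_goals omega
        · rw [hF k hk] at hf; omega
  exact key (D u).toNat u hu hDu (by have := hD.nonneg u hu; omega)

/-- With `B = 1` the quotient by `S` is the indicator of the nodes that are not reached, the form in
which rounding uses the distances. -/
theorem Distances.ediv_eq (hN : Net S n T H) (hD : Distances S n T H C F X s 1 D)
    {u : ℤ} (hu : u ∈ nodes n) : (D u < S ∧ D u / S = 0) ∨ (D u = S ∧ D u / S = 1) := by
  have h1 := hD.nonneg u hu
  have h2 := hD.le u hu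
  have := hN.size
  rcases h2.eq_or_lt with h | h
  · right
    rw [mul_one] at h
    exact ⟨h, by rw [h]; exact Int.ediv_self (by omega)⟩
  · left
    rw [mul_one] at h
    exact ⟨h, Int.ediv_eq_zero_of_lt h1 h⟩

/-- If the solution `z` lies below `X / 2` at `s`, then `-s` is not reached from `s`. -/
theorem Distances.neg_not_reached (hN : Net S n T H) (hX : Potential S T H (fun k => 2 * C k) X)
    (hF : ∀ k : ℕ, k < S → F k = 0)
    (hD : Distances S n T H (fun k => 2 * C k) F X s 1 D) (hs : s ∈ nodes n) {z : ℤ → ℤ}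
    (hz : Potential S T H C z) (hzneg : z (-s) = -z s) (hXneg : X (-s) = -X s)
    (hzs : 2 * z s < X s) : (S : ℤ) ≤ D (-s) := by
  by_contra hlt
  -- Along a tight arc `X` drops by exactly `2 * C k` and `2 * z` by at least that much, so the
  -- strict inequality is passed on.
  have := hD.reach_induction hN hX hF (Q := fun u => 2 * z u < X u) hzs
    (fun k hk _ h1 h2 => by have := hz k hk; omega)
    (neg_mem_nodes hs) (not_le.1 hlt)
  rw [hzneg, hXneg] at this
  omega

/-- Rounding the nodes reached from `s` down and their negatives up. -/
theorem round_spec (hN : Net S n T H) (hsym : SymmetricNet S T H C)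
    (hX : Potential S T H (fun k => 2 * C k) X) (hXneg : ∀ u ∈ nodes n, X (-u) = -X u)
    (hF : ∀ k : ℕ, k < S → F k = 0)
    (hD : Distances S n T H (fun k => 2 * C k) F X s 1 D) (hs : s ∈ nodes n)
    (hodd : Odd (X s)) (hDs : (S : ℤ) ≤ D (-s)) {X' : ℤ → ℤ}
    (hX' : ∀ u ∈ nodes n, X' u = X u + (D u / S - D (-u) / S)) :
    Potential S T H (fun k => 2 * C k) X' ∧ (∀ u ∈ nodes n, X' (-u) = -X' u) ∧ Even (X' s) ∧
      ∀ u ∈ nodes n, X' u = X u ∨ (Odd (X u) ∧ (X' u = X u + 1 ∨ X' u = X u - 1)) := by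
  have hsize := hN.size
  -- Tight arcs change `X` by an even amount.
  have hod : ∀ u ∈ nodes n, D u < S → Odd (X u) := by
    intro u hu hDu
    refine hD.reach_induction hN hX hF (Q := fun u => Odd (X u)) hodd ?_ hu hDu
    intro k hk _ h1 h2
    rw [show X (H k) = X (T k) - 2 * C k by omega]
    exact h2.sub_even (even_two_mul _)
  -- The mirror arc from `-H k` to `-T k` has the same slack, because `X` is odd.
  have hmirror : ∀ k : ℕ, k < S →
      D (-T k) / S ≤ D (-H k) / S + (X (T k) - X (H k) - 2 * C k) := by
    intro k hk
    obtain ⟨k', hk', h1, h2, h3⟩ := hsym k hk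
    have := hD.ediv_head_le hN hk'
    rw [h1, h2, h3, hXneg _ (hN.head k hk), hXneg _ (hN.tail k hk)] at this
    linarith
  -- If `u` and `-u` were both reached, the mirror image of the path to `u` would prolong the path
  -- to `-u` up to `-s`.
  have hdis : ∀ u ∈ nodes n, D u < S → D (-u) < S → False := by
    intro u hu hDu
    refine hD.reach_induction hN hX hF (Q := fun u => D (-u) < S → False) (by omega) ?_ hu hDu
    intro k hk _ h1 h2 h3
    apply h2
    have h4 := hmirror k hk
    rcases hD.ediv_eq hN (neg_mem_nodes (hN.tail k hk)) with h | h <;>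
    rcases hD.ediv_eq hN (neg_mem_nodes (hN.head k hk)) with h' | h' <;>
      omega
  refine ⟨?_, ?_, ?_, ?_⟩
  · intro k hk
    have hc := hX k hk
    have h1 := hmirror k hk
    have h2 := hD.ediv_head_le hN hk
    have hT := hN.tail k hk
    have hH := hN.head k hk
    rw [hX' _ hT, hX' _ hH]
    simp only at hc h2 ⊢
    -- Each end moves by at most one, so slack at least `2` suffices. Slack `0` is handled by
    -- reachability along the arc and its mirror. Slack `1` could fail only if the tail falls and
    -- the head rises, but then both values are odd and the slack is even.
    by_cases hpar : X (T k) - X (H k) - 2 * C k = 1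
    · have hTH : ¬ (Odd (X (T k)) ∧ Odd (X (H k))) := by
        rintro ⟨⟨a, ha⟩, ⟨b, hb⟩⟩; omega
      have hno : ¬ (D (T k) < S ∧ D (-H k) < S) := by
        rintro ⟨h3, h4⟩
        refine hTH ⟨hod _ hT h3, ?_⟩
        have := hod _ (neg_mem_nodes hH) h4
        rwa [hXneg _ hH, odd_neg] at this
      rcases hD.ediv_eq hN hT with a | a <;> rcases hD.ediv_eq hN hH with b | b <;>
      rcases hD.ediv_eq hN (neg_mem_nodes hT) with c | c <;>
      rcases hD.ediv_eq hN (neg_mem_nodes hH) with d | d <;> omega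
    · rcases hD.ediv_eq hN hT with a | a <;> rcases hD.ediv_eq hN hH with b | b <;>
      rcases hD.ediv_eq hN (neg_mem_nodes hT) with c | c <;>
      rcases hD.ediv_eq hN (neg_mem_nodes hH) with d | d <;> omega
  · intro u hu
    rw [hX' _ hu, hX' _ (neg_mem_nodes hu), hXneg u hu, neg_neg]
    ring
  · rw [hX' s hs, hD.source]
    rcases hD.ediv_eq hN (neg_mem_nodes hs) with h | h
    · omega
    · rw [h.2, Int.zero_ediv]
      exact hodd.add_odd (by decide)
  · intro u hu
    rw [hX' u hu]
    rcases hD.ediv_eq hN hu with a | a <;> rcases hD.ediv_eq hN (neg_mem_nodes hu) with b | b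
    · exact (hdis u hu a.1 b.1).elim
    · exact Or.inr ⟨hod u hu a.1, Or.inr (by omega)⟩
    · have := hod _ (neg_mem_nodes hu) b.1
      rw [hXneg u hu, odd_neg] at this
      exact Or.inr ⟨this, Or.inl (by omega)⟩
    · left; omega

end Rounding

end UTVPI

namespace RAM

open UTVPI (sweep)

/-! ## Reasoning about loops -/

theorem rounds_frame (S : ℕ) {a b : ℕ} {c : Cmd} (hba : b ≠ a) (hb : b ∉ c.writes) (M : Mem)
    (n : ℕ) : rounds a (c.run S) M n b = M b := by
  induction n with
  | zero => exact M.store_ne hba _ _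
  | succ k ih => exact (Mem.store_ne _ hba _ _).trans ((Cmd.run_frame S c hb _).trans ih)

theorem Cmd.run_skip (S : ℕ) (M : Mem) : Cmd.skip.run S M = M := rfl

theorem Cmd.run_write (S : ℕ) (a : ℕ) (i e : Expr) (M : Mem) :
    (Cmd.write a i e).run S M = M.store a (i.val M) (e.val M) := rfl

theorem Cmd.run_seq (S : ℕ) (c d : Cmd) (M : Mem) :
    (Cmd.seq c d).run S M = d.run S (c.run S M) := rfl

theorem Cmd.run_ite (S : ℕ) (e : Expr) (c d : Cmd) (M : Mem) :
    (Cmd.ite e c d).run S M = if 0 < e.val M then c.run S M else d.run S M := rfl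

theorem Cmd.run_frame_of_subset (S : ℕ) (c : Cmd) (l : List ℕ) (hl : c.writes ⊆ l) (M : Mem)
    (b : ℕ) (hb : b ∉ l) : c.run S M b = M b :=
  Cmd.run_frame S c (fun h => hb (hl h)) M

theorem notMem_of_subset {l l' : List ℕ} {b : ℕ} (hb : b ∉ l') (h : l ⊆ l') : b ∉ l :=
  fun hl => hb (h hl)

theorem Cmd.run_ite_apply (S : ℕ) (e : Expr) (c d : Cmd) (M : Mem) (b : ℕ) :
    (Cmd.ite e c d).run S M b = if 0 < e.val M then c.run S M b else d.run S M b := by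
  rw [Cmd.run_ite]
  split <;> rfl

/-- The invariant rule for loops. -/
theorem Cmd.run_rep_induction {S : ℕ} {a : ℕ} {c : Cmd} {M : Mem} {I : ℕ → Mem → Prop}
    (h0 : I 0 (M.store a 0 0))
    (hstep : ∀ k : ℕ, k < S → ∀ N : Mem, (∀ b, b ∉ a :: c.writes → N b = M b) →
      N a 0 = k → I k N → I (k + 1) ((c.run S N).store a 0 ((k : ℤ) + 1))) :
    I S ((Cmd.rep a c).run S M) := by
  suffices ∀ n ≤ S, I n (rounds a (c.run S) M n) from this S le_rfl
  intro n
  induction n with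
  | zero => exact fun _ => h0
  | succ k ih =>
    intro hk
    refine hstep k hk _ (fun b hb => ?_) (Cmd.rounds_counter M k) (ih (by omega))
    simp only [List.mem_cons, not_or] at hb
    exact rounds_frame S hb.1 hb.2 M k

/-- A loop computes the composition of the effects of its body. -/
theorem Cmd.run_rep_sweep {α : Type*} (π : Mem → α) {S : ℕ} {a : ℕ} {c : Cmd} {M : Mem}
    {f : ℕ → α → α} (hπ : ∀ N v, π (Mem.store N a 0 v) = π N)
    (hstep : ∀ k : ℕ, k < S → ∀ N : Mem, (∀ b, b ∉ a :: c.writes → N b = M b) →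
      N a 0 = k → π (c.run S N) = f k (π N)) :
    π ((Cmd.rep a c).run S M) = sweep f S (π M) := by
  refine Cmd.run_rep_induction (I := fun k N => π N = sweep f k (π M)) (hπ _ _) ?_
  intro k hk N hN hNa hI
  rw [hπ, hstep k hk N hN hNa, hI, sweep]

theorem sweep_const {α : Type*} (g : α → α) (n : ℕ) (x : α) :
    sweep (fun _ => g) n x = g^[n] x := by
  induction n with
  | zero => rfl
  | succ n ih => rw [Function.iterate_succ_apply', sweep, ih]

/-- Each round touches one entry, and no entry is touched twice, so the in-place loop is a pointwise
map. The offset `c` is `n` for loops over nodes and `0` for loops over arcs. -/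
theorem sweep_update (φ : ℤ → ℤ → ℤ) (c : ℤ) (m : ℕ) (g : ℤ → ℤ) (u : ℤ) :
    sweep (fun k g => Function.update g ((k : ℤ) - c) (φ ((k : ℤ) - c) (g ((k : ℤ) - c)))) m g u =
      if -c ≤ u ∧ u < m - c then φ u (g u) else g u := by
  induction m generalizing u with
  | zero => rw [if_neg (by push_cast; omega)]; rfl
  | succ m ih =>
    simp only [sweep]
    by_cases hu : u = (m : ℤ) - c
    · subst hu
      rw [Function.update_self, ih, if_neg (by omega), if_pos (by push_cast; omega)]
    · rw [Function.update_of_ne hu, ih]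
      refine if_congr ?_ rfl rfl
      push_cast
      omega

/-- A loop that replaces each entry `g u` of array `d`, for `-c ≤ u < S - c`, by `φ u (g u)`. -/
theorem Cmd.run_rep_map {S : ℕ} {a d : ℕ} {b : Cmd} {M : Mem} (hda : d ≠ a) (c : ℤ)
    (φ : ℤ → ℤ → ℤ)
    (hstep : ∀ k : ℕ, k < S → ∀ N : Mem, (∀ x, x ∉ a :: b.writes → N x = M x) →
      N a 0 = k → b.run S N d =
        Function.update (N d) ((k : ℤ) - c) (φ ((k : ℤ) - c) (N d ((k : ℤ) - c)))) (u : ℤ) :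
    (Cmd.rep a b).run S M d u = if -c ≤ u ∧ u < S - c then φ u (M d u) else M d u := by
  have := Cmd.run_rep_sweep (fun N => N d)
    (f := fun k g => Function.update g ((k : ℤ) - c) (φ ((k : ℤ) - c) (g ((k : ℤ) - c))))
    (fun N v => Mem.store_ne N hda 0 v) hstep
  rw [this, sweep_update]

end RAM

/-! ## The program -/

namespace UTVPI

open RAM RAM.Cmd

notation "aIn" => (0 : ℕ)
notation "aOut" => (2 : ℕ)
notation "aOutLen" => (3 : ℕ)
notation "aSize" => (4 : ℕ)
notation "aN" => (7 : ℕ)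
notation "aM" => (8 : ℕ)
notation "aPtr" => (9 : ℕ)
notation "aTail" => (10 : ℕ)
notation "aHead" => (11 : ℕ)
notation "aCost" => (12 : ℕ)
notation "aFlow" => (13 : ℕ)
notation "aPot" => (14 : ℕ)
notation "aDist" => (15 : ℕ)
notation "aWeight" => (17 : ℕ)
notation "aSrc" => (18 : ℕ)
notation "aBound" => (19 : ℕ)
notation "aCur" => (20 : ℕ)
notation "aLit" => (21 : ℕ)
notation "aPrev" => (22 : ℕ)
notation "aAcc" => (24 : ℕ)
notation "aMul" => (25 : ℕ)
notation "aBits" => (26 : ℕ)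
notation "aPow" => (27 : ℕ)
notation "aFlag" => (28 : ℕ)
notation "cBit" => (30 : ℕ)
notation "cVar" => (31 : ℕ)
notation "cRound" => (32 : ℕ)
notation "cArc" => (33 : ℕ)
notation "cMap" => (34 : ℕ)

notation "rd" => Expr.read

infixr:60 ";;" => Cmd.seq

/-- The tail of the current arc. -/
def tailE : Expr := rd aTail (var cArc)

/-- The head of the current arc. -/
def headE : Expr := rd aHead (var cArc)

/-- The length of the current arc. -/
def lengthE : Expr := scale (rd aPot tailE - rd aPot headE - rd aCost (var cArc)) + 1

/-- The current node in a loop over all nodes. -/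
def nodeE : Expr := var cMap - var aN

/-- Relax an arc. -/
def relaxToCmd (t h l : Expr) : Cmd :=
  .ite (rd aDist h - (rd aDist t + l)) (.write aDist h (rd aDist t + l)) .skip

/-- Relax the current arc and its reversal. -/
def relaxCmd : Cmd :=
  relaxToCmd tailE headE lengthE ;;
  .ite (rd aFlow (var cArc)) (relaxToCmd headE tailE 1) .skip

/-- Compute the distances from the source. -/
def distCmd : Cmd :=
  .rep cMap (.write aDist nodeE (scale (var aBound))) ;;
  .write aDist (var aSrc) 0 ;;
  .rep cRound (.rep cArc relaxCmd)

/-- Run `c` if two expressions are equal. -/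
def ifEq (e f : Expr) (c : Cmd) : Cmd := .ite (e - f) .skip (.ite (f - e) .skip c)

/-- A step of tracing a shortest path along the current arc. -/
def traceForwardCmd : Cmd :=
  ifEq headE (var aCur) (.ite (rd aDist tailE + lengthE - rd aDist headE) .skip
    (.write aFlow (var cArc) (rd aFlow (var cArc) + 1) ;; .write aCur 0 tailE))

/-- A step of tracing a shortest path along the reversal of the current arc. -/
def traceBackwardCmd : Cmd :=
  ifEq tailE (var aCur) (.ite (rd aFlow (var cArc))
    (.ite (rd aDist headE + 1 - rd aDist tailE) .skip
      (.write aFlow (var cArc) (rd aFlow (var cArc) - 1) ;; .write aCur 0 headE)) .skip)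

/-- Augment the flow along a shortest path to the negative of the source. -/
def traceCmd : Cmd :=
  .write aCur 0 (0 - var aSrc) ;; .rep cRound (.rep cArc (traceForwardCmd ;; traceBackwardCmd))

/-- Add the distances to the potential. -/
def addDistCmd : Cmd :=
  .rep cMap (.write aPot nodeE (rd aPot nodeE + rd aDist nodeE / sizeVar))

/-- Increase the weight of the current variable by one. -/
def augmentCmd : Cmd :=
  .write aSrc 0 (var cVar + 1) ;;
  .write aBound 0 (rd aPot (var aSrc) - rd aPot (0 - var aSrc) + 1) ;;
  distCmd ;; traceCmd ;; addDistCmd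

theorem run_relaxToCmd (S : ℕ) (M : Mem) (t h l : Expr) :
    (relaxToCmd t h l).run S M aDist = relax (M aDist) (t.val M) (h.val M) (l.val M) := by
  simp only [relaxToCmd, run_ite_apply, run_write, run_skip, val_sub, val_add, val_read, sub_pos, relax]
  split_ifs
  · exact Mem.store_self _ _ _ _
  · rfl

theorem run_relaxCmd {S k : ℕ} {M : Mem} (hS : M aSize 0 = S) (hk : M cArc 0 = k) :
    relaxCmd.run S M aDist =
      relaxArc S (M aTail) (M aHead) (M aCost) (M aFlow) (M aPot) k (M aDist) := by
  have hf := run_frame_of_subset S (relaxToCmd tailE headE lengthE) [aDist] (by decide) M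
  have h1 := run_relaxToCmd S M tailE headE lengthE
  rw [relaxCmd, run_seq, run_ite_apply, run_skip, run_relaxToCmd]
  generalize (relaxToCmd tailE headE lengthE).run S M = N at *
  simp [hf, h1, hS, hk, headE, tailE, lengthE, relaxArc, arcLength]

theorem run_distCmd {S n : ℕ} {M : Mem} (hS : M aSize 0 = S) (hn : M aN 0 = n)
    (hsize : 2 * n + 1 < S) : ∃ D₀ : ℤ → ℤ,
    (∀ u ∈ nodes n, D₀ u = if u = M aSrc 0 then 0 else S * M aBound 0) ∧
    distCmd.run S M aDist =
      (relaxAll S (M aTail) (M aHead) (M aCost) (M aFlow) (M aPot))^[S] D₀ := by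
  set M₁ := (Cmd.rep cMap (.write aDist nodeE (scale (var aBound)))).run S M with hM₁
  have h1 : ∀ u, M₁ aDist u = if -(n : ℤ) ≤ u ∧ u < S - n then S * M aBound 0 else M aDist u := by
    refine run_rep_map (by decide) n (fun _ _ => S * M aBound 0) ?_
    intro k hk N hN hNk
    simp [run, nodeE, hNk, hN aN (by decide), hN aSize (by decide), hN aBound (by decide), hn, hS]
  have hf : ∀ b, b ∉ [cMap, aDist] → M₁ b = M b := fun b hb => run_frame S _ hb M
  set M₂ := M₁.store aDist (M aSrc 0) 0 with hM₂
  have hf2 : ∀ b, b ∉ [cMap, aDist] → M₂ b = M b := fun b hb => by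
    rw [hM₂, Mem.store_ne _ (by simp at hb; exact hb.2), hf b hb]
  refine ⟨M₂ aDist, fun u hu => ?_, ?_⟩
  · rw [hM₂, Mem.store_self, mem_nodes] at *
    by_cases h : u = M aSrc 0
    · rw [h]; simp
    · rw [Function.update_of_ne h, h1, if_pos (by omega), if_neg h]
  · have : distCmd.run S M = (Cmd.rep cRound (.rep cArc relaxCmd)).run S M₂ := by
      rw [distCmd, run_seq, run_seq, run_write, ← hM₁, val_var, val_zero, hf aSrc (by decide)]
    rw [this, run_rep_sweep (fun N => N aDist)
      (f := fun _ => relaxAll S (M aTail) (M aHead) (M aCost) (M aFlow) (M aPot))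
      (fun N v => Mem.store_ne N (by decide) 0 v), sweep_const]
    intro _ _ N hN _
    refine run_rep_sweep (fun N => N aDist) (fun N v => Mem.store_ne N (by decide) 0 v) ?_
    intro k _ N' hN' hk
    have hf3 : ∀ b, b ∉ [cRound, cArc, aDist, cMap] → N' b = M b := fun b hb => by
      rw [hN' b (notMem_of_subset hb (by decide)),
        hN b (notMem_of_subset hb (by decide)),
        hf2 b (notMem_of_subset hb (by decide))]
    rw [run_relaxCmd (k := k) (by rw [hf3 _ (by decide), hS]) hk]
    simp [hf3]

theorem run_traceForwardCmd {S k : ℕ} {M : Mem} (hS : M aSize 0 = S) (hk : M cArc 0 = k) :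
    ((traceForwardCmd.run S M aFlow, traceForwardCmd.run S M aCur 0) : (ℤ → ℤ) × ℤ) =
      traceForward S (M aTail) (M aHead) (M aCost) (M aPot) (M aDist) k (M aFlow, M aCur 0) := by
  have key : traceForwardCmd.run S M = if M aHead k = M aCur 0 ∧ M aDist (M aTail k) +
      arcLength S (M aTail) (M aHead) (M aCost) (M aPot) k ≤ M aDist (M aHead k) then
      (M.store aFlow k (M aFlow k + 1)).store aCur 0 (M aTail k) else M := by
    have hl : lengthE.val M = arcLength S (M aTail) (M aHead) (M aCost) (M aPot) k := by
      simp [lengthE, tailE, headE, arcLength, hS, hk]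
    simp only [traceForwardCmd, ifEq, run_ite, run_skip, run_seq, run_write,
      tailE, headE, val_add, val_sub, val_read, val_var, val_one, hl, hk, sub_pos, val_zero]
    split_ifs
    all_goals first | rfl | omega | simp [Mem.store_apply, hk]
  rw [key, traceForward]
  split
  · simp [Mem.store_apply]
  · rfl

theorem run_traceBackwardCmd {S k : ℕ} {M : Mem} (hk : M cArc 0 = k) :
    ((traceBackwardCmd.run S M aFlow, traceBackwardCmd.run S M aCur 0) : (ℤ → ℤ) × ℤ) =
      traceBackward (M aTail) (M aHead) (M aDist) k (M aFlow, M aCur 0) := by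
  have key : traceBackwardCmd.run S M = if M aTail k = M aCur 0 ∧ 0 < M aFlow k ∧
      M aDist (M aHead k) + 1 ≤ M aDist (M aTail k) then
      (M.store aFlow k (M aFlow k + -1)).store aCur 0 (M aHead k) else M := by
    simp only [traceBackwardCmd, ifEq, run_ite, run_skip, run_seq, run_write,
      tailE, headE, val_add, val_sub, val_read, val_var, val_one, hk, sub_pos, val_zero]
    split_ifs
    all_goals first | rfl | omega | simp [Mem.store_apply, hk, sub_eq_add_neg]
  rw [key, traceBackward]
  split
  · simp [Mem.store_apply]
  · rfl

theorem run_traceCmd {S : ℕ} {M : Mem} (hS : M aSize 0 = S) :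
    ((traceCmd.run S M aFlow, traceCmd.run S M aCur 0) : (ℤ → ℤ) × ℤ) =
      (sweep (traceArc S (M aTail) (M aHead) (M aCost) (M aPot) (M aDist)) S)^[S]
        (M aFlow, -M aSrc 0) := by
  set M₁ := M.store aCur 0 (-M aSrc 0) with hM₁
  have h1 : (M aFlow, -M aSrc 0) = (M₁ aFlow, M₁ aCur 0) := by simp [hM₁, Mem.store_apply]
  have h2 : traceCmd.run S M =
      (Cmd.rep cRound (.rep cArc (traceForwardCmd ;; traceBackwardCmd))).run S M₁ := by
    rw [traceCmd, run_seq, run_write]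
    simp [hM₁]
  rw [h1, h2, run_rep_sweep (fun N => ((N aFlow, N aCur 0) : (ℤ → ℤ) × ℤ))
    (f := fun _ => sweep (traceArc S (M aTail) (M aHead) (M aCost) (M aPot) (M aDist)) S)
    (fun N v => by simp [Mem.store_apply]), sweep_const]
  intro _ _ N hN _
  refine run_rep_sweep (fun N => ((N aFlow, N aCur 0) : (ℤ → ℤ) × ℤ))
    (fun N v => by simp [Mem.store_apply]) ?_
  intro k _ N' hN' hk
  have hf : ∀ b, b ∉ [cRound, cArc, aFlow, aCur] → N' b = M b := fun b hb => by
    rw [hN' b (notMem_of_subset hb (by decide)),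
      hN b (notMem_of_subset hb (by decide)), hM₁,
      Mem.store_ne _ (by rintro rfl; exact hb (by decide))]
  have hf' := run_frame_of_subset S traceForwardCmd [aFlow, aCur] (by decide) N'
  simp only [run_seq]
  rw [run_traceBackwardCmd (k := k) (by rw [hf' _ (by decide), hk]),
    run_traceForwardCmd (k := k) (by rw [hf _ (by decide), hS]) hk, traceArc]
  simp [hf', hf]

theorem run_addDistCmd {S n : ℕ} {M : Mem} (hS : M aSize 0 = S) (hn : M aN 0 = n)
    (hsize : 2 * n + 1 < S) {u : ℤ} (hu : u ∈ nodes n) :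
    addDistCmd.run S M aPot u = M aPot u + M aDist u / S := by
  rw [addDistCmd, run_rep_map (by decide) n (fun u x => x + M aDist u / S), if_pos]
  · rw [mem_nodes] at hu; omega
  · intro k hk N hN hNk
    simp [run_write, nodeE, hNk, hN aN (by decide), hN aSize (by decide), hN aDist (by decide),
      hn, hS]

theorem run_augmentCmd {S n j : ℕ} {M : Mem} (hS : M aSize 0 = S) (hn : M aN 0 = n)
    (hj : M cVar 0 = j) (hjn : j < n) (hN : Net S n (M aTail) (M aHead))
    (hp : Potential S (M aTail) (M aHead) (M aCost) (M aPot))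
    (hF : Complementary S (M aTail) (M aHead) (M aCost) (M aFlow) (M aPot))
    {k₀ : ℕ} (hk₀ : k₀ < S) (hT : M aTail k₀ = j + 1) (hH : M aHead k₀ = -(j + 1))
    (hC : M aCost k₀ = 0) :
    Potential S (M aTail) (M aHead) (M aCost) (augmentCmd.run S M aPot) ∧
    Complementary S (M aTail) (M aHead) (M aCost) (augmentCmd.run S M aFlow)
      (augmentCmd.run S M aPot) ∧
    ∀ u, divergence S (M aTail) (M aHead) (augmentCmd.run S M aFlow) u =
      divergence S (M aTail) (M aHead) (M aFlow) u + (if u = j + 1 then 1 else 0) -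
        (if u = -((j : ℤ) + 1) then 1 else 0) := by
  set M₁ := M.store aSrc 0 ((j : ℤ) + 1) with hM₁
  set M₂ := M₁.store aBound 0 (M aPot (j + 1) - M aPot (-(j + 1)) + 1) with hM₂
  have hf₂ : ∀ b, b ∉ [aSrc, aBound] → M₂ b = M b := fun b hb => by
    simp only [List.mem_cons, List.not_mem_nil, not_or] at hb
    rw [hM₂, Mem.store_ne _ hb.2.1, hM₁, Mem.store_ne _ hb.1]
  have hsrc : M₂ aSrc 0 = j + 1 := by simp [hM₂, hM₁, Mem.store_apply]
  have hbd : M₂ aBound 0 = M aPot (j + 1) - M aPot (-(j + 1)) + 1 := by simp [hM₂]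
  set M₃ := distCmd.run S M₂ with hM₃
  have hf₃ := run_frame_of_subset S distCmd [cMap, aDist, cRound, cArc] (by decide) M₂
  rw [← hM₃] at hf₃
  set M₄ := traceCmd.run S M₃ with hM₄
  have hf₄ := run_frame_of_subset S traceCmd [aCur, cRound, cArc, aFlow] (by decide) M₃
  rw [← hM₄] at hf₄
  have hrun : augmentCmd.run S M = addDistCmd.run S M₄ := by
    simp only [augmentCmd, run_seq]
    rw [hM₄, hM₃, hM₂]
    simp [run_write, hM₁, hj, Mem.store_apply]
  have hflow : augmentCmd.run S M aFlow = M₄ aFlow := by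
    rw [hrun]; exact run_frame S _ (by decide) _
  have hsN : ((j : ℤ) + 1) ∈ nodes n := by rw [mem_nodes]; omega
  obtain ⟨D₀, hD₀, hD⟩ := run_distCmd (S := S) (n := n) (M := M₂)
    (by rw [hf₂ _ (by decide), hS]) (by rw [hf₂ _ (by decide), hn]) hN.size
  simp only [hsrc, hbd, hf₂ aTail (by decide), hf₂ aHead (by decide), hf₂ aCost (by decide),
    hf₂ aFlow (by decide), hf₂ aPot (by decide), ← hM₃] at hD₀ hD
  have hb0 : 0 ≤ M aPot (j + 1) - M aPot (-(j + 1)) + 1 := by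
    have := hp k₀ hk₀
    rw [hT, hH, hC] at this
    omega
  have hDist := distances_iterate (F := M aFlow) hN hp hsN hb0 hD₀
  rw [← hD] at hDist
  have htr := run_traceCmd (S := S) (M := M₃)
    (by rw [hf₃ _ (by decide), hf₂ _ (by decide), hS])
  simp only [← hM₄, hf₃ aTail (by decide), hf₃ aHead (by decide), hf₃ aCost (by decide),
    hf₃ aFlow (by decide), hf₃ aPot (by decide), hf₃ aSrc (by decide), hsrc,
    hf₂ aTail (by decide), hf₂ aHead (by decide), hf₂ aCost (by decide),
    hf₂ aFlow (by decide), hf₂ aPot (by decide)] at htr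
  rw [hflow]
  refine augment_spec hN hp hF hsN hk₀ hT hH hC hDist ?_ htr.symm
  intro u hu
  rw [hrun, run_addDistCmd (n := n) (by rw [hf₄ _ (by decide), hf₃ _ (by decide),
    hf₂ _ (by decide), hS]) (by rw [hf₄ _ (by decide), hf₃ _ (by decide), hf₂ _ (by decide), hn])
    hN.size hu, hf₄ aPot (by decide), hf₄ aDist (by decide), hf₃ aPot (by decide),
    hf₂ aPot (by decide)]

end UTVPI

/-! ### Solving the relaxation by scaling over the bits of the weights -/

namespace UTVPI

open RAM RAM.Cmd

/-- The integer quotient by two, doubled, subtracted from the expression: `1` if it is odd. -/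
def oddE (e : Expr) : Expr := e - (e / 2 + e / 2)

theorem val_oddE_pos {M : Mem} {e : Expr} : 0 < (oddE e).val M ↔ Odd (e.val M) := by
  simp only [oddE, val_sub, val_add, val_div, val_two, Int.odd_iff]
  omega

/-- Compute a first potential. -/
def initPotCmd : Cmd :=
  .write aSrc 0 0 ;; .write aBound 0 0 ;; distCmd ;; addDistCmd

/-- Compute `2 ^ S`. -/
def powCmd : Cmd :=
  .write aPow 0 1 ;; .rep cMap (.write aPow 0 (var aPow + var aPow))

/-- Double the flow. -/
def doubleFlowCmd : Cmd :=
  .rep cMap (.write aFlow (var cMap) (rd aFlow (var cMap) + rd aFlow (var cMap)))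

/-- Increase the weights by the current bits. -/
def addBitsCmd : Cmd :=
  .rep cVar (.ite (oddE (rd aWeight (var cVar + 1) / var aPow)) augmentCmd .skip)

/-- Solve the linear relaxation, for the bits of the weights from the top. -/
def solveCmd : Cmd :=
  powCmd ;; .rep cBit (.write aPow 0 (var aPow / 2) ;; doubleFlowCmd ;; addBitsCmd)

theorem Potential.congr {S n : ℕ} {T H C p p' : ℤ → ℤ} (hN : Net S n T H)
    (hp : Potential S T H C p) (h : ∀ u ∈ nodes n, p' u = p u) : Potential S T H C p' := by
  intro k hk
  rw [h _ (hN.tail k hk), h _ (hN.head k hk)]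
  exact hp k hk

/-- Setting source and bound to zero starts every node at distance zero, as from a virtual source
joined to all nodes. -/
theorem run_initPotCmd {S n : ℕ} {M : Mem} (hS : M aSize 0 = S) (hn : M aN 0 = n)
    (hN : Net S n (M aTail) (M aHead)) (hF : ∀ k, M aFlow k = 0) (hp : ∀ u, M aPot u = 0)
    {z : ℤ → ℤ} (hz : Potential S (M aTail) (M aHead) (M aCost) z) :
    Potential S (M aTail) (M aHead) (M aCost) (initPotCmd.run S M aPot) := by
  set M₂ := (M.store aSrc 0 0).store aBound 0 0 with hM₂
  have hf₂ : ∀ b, b ∉ [aSrc, aBound] → M₂ b = M b := fun b hb => by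
    simp only [List.mem_cons, List.not_mem_nil, not_or] at hb
    rw [hM₂, Mem.store_ne _ hb.2.1, Mem.store_ne _ hb.1]
  have hbd : M₂ aBound 0 = 0 := by simp [hM₂]
  have hf₃ := run_frame_of_subset S distCmd [cMap, aDist, cRound, cArc] (by decide) M₂
  have hrun : initPotCmd.run S M = addDistCmd.run S (distCmd.run S M₂) := rfl
  obtain ⟨D₀, hD₀, hD⟩ := run_distCmd (S := S) (n := n) (M := M₂)
    (by rw [hf₂ _ (by decide), hS]) (by rw [hf₂ _ (by decide), hn]) hN.size
  simp only [hf₂ aTail (by decide), hf₂ aHead (by decide), hf₂ aCost (by decide),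
    hf₂ aFlow (by decide), hf₂ aPot (by decide), hbd, mul_zero, ite_self] at hD₀ hD
  refine (potential_ediv hN hz (F := M aFlow) (p := M aPot) hF hp hD₀).congr hN fun u hu => ?_
  rw [hrun, run_addDistCmd (n := n) (by rw [hf₃ _ (by decide), hf₂ _ (by decide), hS])
    (by rw [hf₃ _ (by decide), hf₂ _ (by decide), hn]) hN.size hu, hf₃ aPot (by decide),
    hf₂ aPot (by decide), hp, hD, zero_add]

theorem run_powCmd (S : ℕ) (M : Mem) : powCmd.run S M aPow 0 = 2 ^ S := by
  rw [powCmd, run_seq]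
  refine run_rep_induction (I := fun k N => N aPow 0 = 2 ^ k) (by simp [run_write, Mem.store_apply]) ?_
  intro k hk N hN hNk hI
  simp only [run_write, Mem.store_apply, val_add, val_var, val_zero, hI]
  simp [pow_succ, mul_two]

theorem run_doubleFlowCmd (S : ℕ) (M : Mem) {k : ℕ} (hk : k < S) :
    doubleFlowCmd.run S M aFlow k = 2 * M aFlow k := by
  rw [doubleFlowCmd, run_rep_map (by decide) 0 (fun _ x => 2 * x), if_pos (by omega)]
  intro k hk N hN hNk
  simp [run_write, hNk, two_mul]

theorem oddExt_congr {a b : ℤ → ℤ} (h : ∀ u, 0 < u → a u = b u) (u : ℤ) :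
    oddExt a u = oddExt b u := by
  unfold oddExt
  split_ifs with h1 h2
  · exact h u h1
  · rw [h (-u) (by omega)]
  · rfl

theorem oddExt_add_single (a : ℤ → ℤ) {s : ℤ} (hs : 0 < s) (u : ℤ) :
    oddExt (fun u => a u + if u = s then 1 else 0) u =
      oddExt a u + (if u = s then 1 else 0) - (if u = -s then 1 else 0) := by
  simp only [oddExt]
  split_ifs <;> omega

/-- The flow `F` and the potential `p` are optimal for the weights `a`. -/
structure Solves (S : ℕ) (T H C F p a : ℤ → ℤ) : Prop where
  potential : Potential S T H C p
  compl : Complementary S T H C F p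
  div : ∀ u, divergence S T H F u = oddExt a u

/-- The arc of the constraint `0 ≤ x j`, for each `j`. -/
def HasNonnegArcs (S n : ℕ) (T H C : ℤ → ℤ) : Prop :=
  ∀ j : ℕ, j < n → ∃ k : ℕ, k < S ∧ T k = j + 1 ∧ H k = -(j + 1) ∧ C k = 0

/-- On entry the pair solves the weights with their last bit cleared; one augmentation restores that
bit for each odd weight. In the loop invariant the bits of the variables treated so far are
restored. -/
theorem run_addBitsCmd {S n : ℕ} {M : Mem} (hS : M aSize 0 = S) (hn : M aN 0 = n)
    (hN : Net S n (M aTail) (M aHead))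
    (harc : HasNonnegArcs S n (M aTail) (M aHead) (M aCost))
    (hW : ∀ u, (n : ℤ) < u → M aWeight u = 0)
    (hsol : Solves S (M aTail) (M aHead) (M aCost) (M aFlow) (M aPot)
      fun u => 2 * (M aWeight u / M aPow 0 / 2)) :
    Solves S (M aTail) (M aHead) (M aCost) (addBitsCmd.run S M aFlow) (addBitsCmd.run S M aPot)
      fun u => M aWeight u / M aPow 0 := by
  set b : ℤ → ℤ := fun u => M aWeight u / M aPow 0 with hb
  have key : Solves S (M aTail) (M aHead) (M aCost) (addBitsCmd.run S M aFlow)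
      (addBitsCmd.run S M aPot) fun u => if u ≤ (S : ℤ) then b u else 2 * (b u / 2) := by
    refine run_rep_induction (I := fun j N => Solves S (M aTail) (M aHead) (M aCost) (N aFlow)
      (N aPot) fun u => if u ≤ (j : ℤ) then b u else 2 * (b u / 2)) ?_ ?_
    · simp only [Mem.store_apply]
      refine ⟨hsol.potential, hsol.compl, fun u => (hsol.div u).trans (oddExt_congr ?_ u)⟩
      intro u hu
      rw [if_neg (by push_cast; omega)]
    · intro j hj N hNf hNj hI
      have hNf' : ∀ x ∉ [aSrc, aBound, aDist, aCur, aFlow, aPot, cMap, cRound, cArc, cVar],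
          N x = M x := fun x hx => hNf x (notMem_of_subset hx (by decide))
      simp only [Mem.store_apply, show ¬ (aFlow = cVar) by decide, show ¬ (aPot = cVar) by decide,
        if_false]
      have hval : (rd aWeight (var cVar + 1) / var aPow).val N = b (j + 1) := by
        simp [hNj, hNf' aWeight (by decide), hNf' aPow (by decide), hb]
      rw [run_ite]
      by_cases hodd : Odd (b (j + 1))
      · rw [if_pos (val_oddE_pos.2 (by rwa [hval]))]
        -- The loop runs past `n`, where the weights vanish and are never odd.
        have hjn : j < n := by
          by_contra hjn
          have : b (j + 1) = 0 := by simp only [hb]; rw [hW _ (by omega), Int.zero_ediv]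
          rw [this] at hodd
          exact absurd hodd (by decide)
        obtain ⟨k₀, hk₀, hT, hH, hC⟩ := harc j hjn
        have haug := run_augmentCmd (S := S) (n := n) (j := j) (M := N)
          (by rw [hNf' _ (by decide), hS]) (by rw [hNf' _ (by decide), hn]) hNj hjn
          (by rw [hNf' aTail (by decide), hNf' aHead (by decide)]; exact hN)
          (by rw [hNf' aTail (by decide), hNf' aHead (by decide), hNf' aCost (by decide)]
              exact hI.potential)
          (by rw [hNf' aTail (by decide), hNf' aHead (by decide), hNf' aCost (by decide)]
              exact hI.compl) hk₀
          (by rw [hNf' aTail (by decide), hT]) (by rw [hNf' aHead (by decide), hH])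
          (by rw [hNf' aCost (by decide), hC])
        simp only [hNf' aTail (by decide), hNf' aHead (by decide), hNf' aCost (by decide)] at haug
        refine ⟨haug.1, haug.2.1, fun u => ?_⟩
        rw [haug.2.2, hI.div, ← oddExt_add_single _ (by omega)]
        refine oddExt_congr (fun u hu => ?_) u
        obtain ⟨c, hc⟩ := hodd
        by_cases h1 : u = j + 1
        · subst h1
          rw [if_neg (by omega), if_pos rfl, if_pos (by push_cast; omega)]
          omega
        · rw [if_neg h1, add_zero]
          refine if_congr ?_ rfl rfl
          push_cast; omega
      · rw [if_neg (by rw [val_oddE_pos, hval]; exact hodd), run_skip]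
        refine ⟨hI.potential, hI.compl, fun u => (hI.div u).trans (oddExt_congr (fun u hu => ?_) u)⟩
        rw [Int.not_odd_iff_even] at hodd
        obtain ⟨c, hc⟩ := hodd
        by_cases h1 : u = j + 1
        · subst h1
          rw [if_neg (by omega), if_pos (by push_cast; omega)]
          omega
        · refine if_congr ?_ rfl rfl
          push_cast; omega
  refine ⟨key.potential, key.compl, fun u => (key.div u).trans (oddExt_congr (fun u hu => ?_) u)⟩
  split_ifs with h
  · rfl
  · have := hN.size
    simp only [hb]
    rw [hW u (by omega)]
    simp

/-- After `t` rounds the weights solved are the true ones without their last `S - t` bits, starting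
from zero because they are below `2 ^ S`. Doubling the flow doubles these weights and keeps flow on
tight arcs, so only the next bit has to be added. -/
theorem run_solveCmd {S n : ℕ} {M : Mem} (hS : M aSize 0 = S) (hn : M aN 0 = n)
    (hN : Net S n (M aTail) (M aHead))
    (harc : HasNonnegArcs S n (M aTail) (M aHead) (M aCost))
    (hF : ∀ k, M aFlow k = 0)
    (hW : ∀ u, (n : ℤ) < u → M aWeight u = 0) (hW0 : ∀ u, 0 ≤ M aWeight u)
    (hW2 : ∀ u, M aWeight u < 2 ^ S)
    (hp : Potential S (M aTail) (M aHead) (M aCost) (M aPot)) :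
    Solves S (M aTail) (M aHead) (M aCost) (solveCmd.run S M aFlow) (solveCmd.run S M aPot)
      (M aWeight) := by
  rw [solveCmd, run_seq]
  have hf := run_frame_of_subset S powCmd [aPow, cMap] (by decide) M
  have hpow := run_powCmd S M
  generalize powCmd.run S M = M₁ at *
  have := run_rep_induction (S := S) (a := cBit)
    (c := .write aPow 0 (var aPow / 2) ;; doubleFlowCmd ;; addBitsCmd) (M := M₁)
    (I := fun t N => t ≤ S → N aPow 0 = 2 ^ (S - t) ∧ Solves S (M aTail) (M aHead) (M aCost)
      (N aFlow) (N aPot) fun u => M aWeight u / 2 ^ (S - t)) ?_ ?_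
  · simpa using (this le_rfl).2
  · intro _
    simp only [Mem.store_apply]
    refine ⟨by simpa using hpow, ?_⟩
    simp only [show ¬ (aFlow = cBit) by decide, show ¬ (aPot = cBit) by decide, if_false,
      hf aFlow (by decide), hf aPot (by decide)]
    refine ⟨hp, fun k _ => by simp [hF], fun u => ?_⟩
    have h1 : divergence S (M aTail) (M aHead) (M aFlow) u = 0 := by simp [divergence, hF]
    rw [h1, oddExt_congr (b := fun _ => 0) (fun u _ => ?_)]
    · simp [oddExt]
    · simpa using Int.ediv_eq_zero_of_lt (hW0 u) (hW2 u)
  · intro t ht N hNf _ hI _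
    obtain ⟨hI1, hI2⟩ := hI (by omega)
    have hNf' : ∀ x ∉ [aPow, aSrc, aBound, aDist, aCur, aFlow, aPot, cMap, cRound, cArc, cVar,
        cBit], N x = M x := fun x hx => by
      rw [hNf x (notMem_of_subset hx (by decide)), hf x (notMem_of_subset hx (by decide))]
    have hpw : (2 : ℤ) ^ (S - t) = 2 * 2 ^ (S - (t + 1)) := by
      rw [← pow_succ']; congr 1; omega
    set N₁ := N.store aPow 0 (N aPow 0 / 2) with hN₁
    have hN₁f : ∀ b, b ∉ [aPow] → N₁ b = N b := fun b hb => by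
      rw [hN₁, Mem.store_ne _ (by simpa using hb)]
    set N₂ := doubleFlowCmd.run S N₁ with hN₂
    have hN₂f := run_frame_of_subset S doubleFlowCmd [aFlow, cMap] (by decide) N₁
    rw [← hN₂] at hN₂f
    have hN₂' : ∀ x ∉ [aPow, aSrc, aBound, aDist, aCur, aFlow, aPot, cMap, cRound, cArc, cVar,
        cBit], N₂ x = M x := fun x hx => by
      rw [hN₂f x (notMem_of_subset hx (by decide)), hN₁f x (notMem_of_subset hx (by decide)),
        hNf' x hx]
    have hrun : run S (.write aPow 0 (var aPow / 2) ;; doubleFlowCmd ;; addBitsCmd) N =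
        addBitsCmd.run S N₂ := rfl
    have hpow₂ : N₂ aPow 0 = 2 ^ (S - (t + 1)) := by
      rw [hN₂f _ (by decide), hN₁, Mem.store_self, Function.update_self, hI1, hpw]
      simp
    have hflow₂ : ∀ k : ℕ, k < S → N₂ aFlow k = 2 * N aFlow k := fun k hk => by
      rw [hN₂, run_doubleFlowCmd S N₁ hk, hN₁f _ (by decide)]
    have hpot₂ : N₂ aPot = N aPot := by rw [hN₂f _ (by decide), hN₁f _ (by decide)]
    have hbits := run_addBitsCmd (S := S) (n := n) (M := N₂) (by rw [hN₂' _ (by decide), hS])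
      (by rw [hN₂' _ (by decide), hn])
      (by rw [hN₂' aTail (by decide), hN₂' aHead (by decide)]; exact hN)
      (by rw [hN₂' aTail (by decide), hN₂' aHead (by decide), hN₂' aCost (by decide)]; exact harc)
      (by rw [hN₂' aWeight (by decide)]; exact hW)
      (by
        rw [hN₂' aTail (by decide), hN₂' aHead (by decide), hN₂' aCost (by decide),
          hN₂' aWeight (by decide), hpow₂, hpot₂]
        refine ⟨hI2.potential, fun k hk => ?_, fun u => ?_⟩
        · rw [hflow₂ k hk]
          have := hI2.compl k hk
          exact ⟨by omega, fun h => this.2 (by omega)⟩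
        · rw [divergence_congr (F := fun k => 2 * N aFlow k) hflow₂, divergence_two_mul, hI2.div]
          have : ∀ u, M aWeight u / 2 ^ (S - (t + 1)) / 2 = M aWeight u / 2 ^ (S - t) := by
            intro u
            rw [Int.ediv_ediv_of_nonneg (by positivity), hpw, mul_comm]
          simp only [this]
          unfold oddExt
          split_ifs <;> ring)
    simp only [Mem.store_apply, hrun]
    refine ⟨?_, ?_⟩
    · have := run_frame_of_subset S addBitsCmd [aSrc, aBound, aDist, aCur, aFlow, aPot, cMap,
        cRound, cArc, cVar] (by decide) N₂ aPow (by decide)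
      simpa [this] using hpow₂
    · simpa [hN₂' aTail (by decide), hN₂' aHead (by decide), hN₂' aCost (by decide),
        hN₂' aWeight (by decide), hpow₂] using hbits

end UTVPI

theorem RAM.output_eq (M : RAM.Mem) :
    RAM.output M = (List.range (M 3 0).toNat).map fun i : ℕ => M 2 i := by
  simp only [RAM.output, List.bind_eq_flatMap, List.map_flatMap, List.pure_def, List.map_cons,
    List.map_nil]
  exact List.map_eq_flatMap.symm

/-! ### Symmetrization, rounding and output -/

namespace UTVPI

open RAM RAM.Cmd

/-- Replace the potential by its odd part, doubled, double the costs, and clear the flow. -/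
def symmetrizeCmd : Cmd :=
  .rep cMap (.write aDist nodeE (rd aPot nodeE)) ;;
  .rep cMap (.write aPot nodeE (rd aDist nodeE - rd aDist (0 - nodeE))) ;;
  .rep cArc (.write aCost (var cArc) (rd aCost (var cArc) + rd aCost (var cArc)) ;;
    .write aFlow (var cArc) 0)

/-- Compute the distances from a variable or its negative that does not reach its own negative. -/
def reachCmd : Cmd :=
  .write aSrc 0 (var cVar + 1) ;; .write aBound 0 1 ;; distCmd ;;
  .ite (sizeVar - rd aDist (0 - var aSrc)) (.write aSrc 0 (0 - var aSrc) ;; distCmd) .skip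

/-- Round the nodes that are reached down, and their negatives up. -/
def shiftCmd : Cmd :=
  .rep cMap (.write aPot nodeE (rd aPot nodeE +
    (rd aDist nodeE / sizeVar - rd aDist (0 - nodeE) / sizeVar)))

/-- Make all potentials even. -/
def roundCmd : Cmd :=
  .rep cVar (.ite (var aN - var cVar)
    (.ite (oddE (rd aPot (var cVar + 1))) (reachCmd ;; shiftCmd) .skip) .skip)

/-- The copy in `aDist` is needed because each new value uses the old potential at the opposite
node. -/
theorem run_symmetrizeCmd {S n : ℕ} {M : Mem} (hn : M aN 0 = n) (hsize : 2 * n + 1 < S)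
    (hC : ∀ u, ¬ (0 ≤ u ∧ u < (S : ℤ)) → M aCost u = 0) :
    (∀ u ∈ nodes n, symmetrizeCmd.run S M aPot u = M aPot u - M aPot (-u)) ∧
    (symmetrizeCmd.run S M aCost = fun k => 2 * M aCost k) ∧
    (∀ k : ℕ, k < S → symmetrizeCmd.run S M aFlow k = 0) := by
  rw [symmetrizeCmd, run_seq, run_seq]
  set M₁ := (Cmd.rep cMap (.write aDist nodeE (rd aPot nodeE))).run S M with hM₁
  have hf₁ := run_frame_of_subset S (Cmd.rep cMap (.write aDist nodeE (rd aPot nodeE)))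
    [cMap, aDist] (by decide) M
  rw [← hM₁] at hf₁
  have hD : ∀ u ∈ nodes n, M₁ aDist u = M aPot u := by
    intro u hu
    rw [hM₁, run_rep_map (by decide) n (fun u _ => M aPot u), if_pos]
    · rw [mem_nodes] at hu; omega
    · intro k hk N hN hNk
      simp [run_write, nodeE, hNk, hN aN (by decide), hN aPot (by decide), hn]
  set M₂ := (Cmd.rep cMap (.write aPot nodeE (rd aDist nodeE - rd aDist (0 - nodeE)))).run S M₁
    with hM₂
  have hf₂ := run_frame_of_subset S
    (Cmd.rep cMap (.write aPot nodeE (rd aDist nodeE - rd aDist (0 - nodeE))))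
    [cMap, aPot] (by decide) M₁
  rw [← hM₂] at hf₂
  have hP : ∀ u ∈ nodes n, M₂ aPot u = M aPot u - M aPot (-u) := by
    intro u hu
    rw [hM₂, run_rep_map (by decide) n (fun u _ => M₁ aDist u - M₁ aDist (-u)), if_pos,
      hD u hu, hD _ (neg_mem_nodes hu)]
    · rw [mem_nodes] at hu; omega
    · intro k hk N hN hNk
      simp [run_write, nodeE, hNk, hN aN (by decide), hN aDist (by decide), hf₁ aN (by decide), hn]
  refine ⟨fun u hu => ?_, funext fun u => ?_, fun k hk => ?_⟩
  · rw [run_frame S _ (by decide), hP u hu]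
  · rw [run_rep_map (by decide) 0 (fun _ x => 2 * x), hf₂ aCost (by decide),
      hf₁ aCost (by decide)]
    · split_ifs with h
      · rfl
      · rw [hC u (by simpa using h), mul_zero]
    · intro k hk N hN hNk
      simp [run_seq, run_write, hNk, two_mul, Mem.store_apply]
  · rw [run_rep_map (by decide) 0 (fun _ _ => 0), if_pos (by omega)]
    intro k hk N hN hNk
    simp [run_seq, run_write, hNk, Mem.store_apply]

theorem run_shiftCmd {S n : ℕ} {M : Mem} (hS : M aSize 0 = S) (hn : M aN 0 = n)
    (hsize : 2 * n + 1 < S) {u : ℤ} (hu : u ∈ nodes n) :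
    shiftCmd.run S M aPot u = M aPot u + (M aDist u / S - M aDist (-u) / S) := by
  rw [shiftCmd, run_rep_map (by decide) n (fun u x => x + (M aDist u / S - M aDist (-u) / S)),
    if_pos]
  · rw [mem_nodes] at hu; omega
  · intro k hk N hN hNk
    simp [run_write, nodeE, hNk, hN aN (by decide), hN aSize (by decide), hN aDist (by decide),
      hn, hS]

theorem run_distCmd_distances {S n : ℕ} {M : Mem} {T H C F p : ℤ → ℤ} (hS : M aSize 0 = S)
    (hn : M aN 0 = n) (hT : M aTail = T) (hH : M aHead = H) (hC : M aCost = C)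
    (hF : M aFlow = F) (hpM : M aPot = p) (hN : Net S n T H) (hp : Potential S T H C p)
    {s B : ℤ} (hsrc : M aSrc 0 = s) (hB : M aBound 0 = B) (hB0 : 0 ≤ B) (hs : s ∈ nodes n) :
    Distances S n T H C F p s B (distCmd.run S M aDist) := by
  obtain ⟨D₀, hD₀, hD⟩ := run_distCmd hS hn hN.size
  subst hT hH hC hF hpM hsrc hB
  rw [hD]
  exact distances_iterate hN hp hs hB0 hD₀

/-- The odd number `X (j + 1)` differs from `2 * z (j + 1)`, so `2 * z < X` holds at `j + 1` or at
its negative, and that node does not reach its own negative. If the first search fails, the second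
must succeed. -/
theorem run_reachCmd {S n j : ℕ} {M : Mem} {C z : ℤ → ℤ} (hS : M aSize 0 = S) (hn : M aN 0 = n)
    (hj : M cVar 0 = j) (hjn : j < n) (hN : Net S n (M aTail) (M aHead))
    (hC : M aCost = fun k => 2 * C k) (hF : ∀ k : ℕ, k < S → M aFlow k = 0)
    (hp : Potential S (M aTail) (M aHead) (fun k => 2 * C k) (M aPot))
    (hneg : ∀ u ∈ nodes n, M aPot (-u) = -M aPot u)
    (hz : Potential S (M aTail) (M aHead) C z) (hzneg : ∀ u, z (-u) = -z u)
    (hodd : Odd (M aPot (j + 1))) :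
    ∃ s : ℤ, (s = j + 1 ∨ s = -(j + 1)) ∧
      Distances S n (M aTail) (M aHead) (fun k => 2 * C k) (M aFlow) (M aPot) s 1
        (reachCmd.run S M aDist) ∧ (S : ℤ) ≤ reachCmd.run S M aDist (-s) := by
  set M₂ := (M.store aSrc 0 ((j : ℤ) + 1)).store aBound 0 1 with hM₂
  have hf₂ : ∀ b, b ∉ [aSrc, aBound] → M₂ b = M b := fun b hb => by
    simp only [List.mem_cons, List.not_mem_nil, not_or] at hb
    rw [hM₂, Mem.store_ne _ hb.2.1, Mem.store_ne _ hb.1]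
  have hsrc : M₂ aSrc 0 = j + 1 := by simp [hM₂, Mem.store_apply]
  have hbd : M₂ aBound 0 = 1 := by simp [hM₂]
  have hsN : ((j : ℤ) + 1) ∈ nodes n := by rw [mem_nodes]; omega
  have hdist := run_distCmd_distances (S := S) (n := n) (M := M₂) (by rw [hf₂ _ (by decide), hS])
    (by rw [hf₂ _ (by decide), hn]) (hf₂ aTail (by decide)) (hf₂ aHead (by decide))
    ((hf₂ aCost (by decide)).trans hC) (hf₂ aFlow (by decide)) (hf₂ aPot (by decide)) hN hp hsrc hbd
    zero_le_one hsN
  set M₃ := distCmd.run S M₂ with hM₃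
  have hf₃ := run_frame_of_subset S distCmd [cMap, aDist, cRound, cArc] (by decide) M₂
  rw [← hM₃] at hf₃
  have hrun : reachCmd.run S M = if M₃ aDist (-(j + 1)) < S then
      distCmd.run S (M₃.store aSrc 0 (-(j + 1))) else M₃ := by
    rw [reachCmd, run_seq, run_seq, run_seq, run_write, run_write, run_ite, run_seq, run_write]
    simp only [val_add, val_var, val_one, val_zero, hj, ← hM₂, ← hM₃, val_sub, val_sizeVar,
      val_read, hf₃ aSrc (by decide), hsrc, hf₃ aSize (by decide), hf₂ aSize (by decide), hS,
      zero_sub, sub_pos, run_skip]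
  by_cases hlt : M₃ aDist (-(j + 1)) < S
  · rw [hrun, if_pos hlt]
    refine ⟨-(j + 1), Or.inr rfl, ?_⟩
    set M₄ := M₃.store aSrc 0 (-((j : ℤ) + 1)) with hM₄
    have hf₄ : ∀ b, b ∉ [cMap, aDist, cRound, cArc, aSrc, aBound] → M₄ b = M b := fun b hb => by
      rw [hM₄, Mem.store_ne _ (by rintro rfl; exact hb (by decide)),
        hf₃ b (notMem_of_subset hb (by decide)), hf₂ b (notMem_of_subset hb (by decide))]
    have hdist' := run_distCmd_distances (S := S) (n := n) (M := M₄)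
      (by rw [hf₄ _ (by decide), hS])
      (by rw [hf₄ _ (by decide), hn]) (hf₄ aTail (by decide)) (hf₄ aHead (by decide))
      ((hf₄ aCost (by decide)).trans hC) (hf₄ aFlow (by decide)) (hf₄ aPot (by decide)) hN hp
      (s := -(j + 1)) (B := 1) (by simp [hM₄])
      (by rw [hM₄, Mem.store_ne _ (by decide), hf₃ _ (by decide), hbd])
      zero_le_one (neg_mem_nodes hsN)
    refine ⟨hdist', hdist'.neg_not_reached hN hp hF (neg_mem_nodes hsN) hz (hzneg _)
      (hneg _ (neg_mem_nodes hsN)) ?_⟩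
    rw [hzneg, hneg _ hsN]
    by_contra hge
    refine absurd (hdist.neg_not_reached hN hp hF hsN hz (hzneg _) (hneg _ hsN) ?_) (not_le.2 hlt)
    obtain ⟨c, hc⟩ := hodd
    omega
  · rw [hrun, if_neg hlt]
    exact ⟨j + 1, Or.inl rfl, hdist, not_lt.1 hlt⟩

/-- `X` is a potential for the doubled costs, odd as a function, obtained from `X₀` by rounding
some odd values. -/
structure Rounded (S n : ℕ) (T H C X₀ X : ℤ → ℤ) : Prop where
  potential : Potential S T H (fun k => 2 * C k) X
  neg : ∀ u ∈ nodes n, X (-u) = -X u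
  near : ∀ u ∈ nodes n, X u = X₀ u ∨
    (Odd (X₀ u) ∧ Even (X u) ∧ (X u = X₀ u + 1 ∨ X u = X₀ u - 1))

/-- Only odd values move, and they become even. So no value moves twice, values already even stay
so, and the total change from the initial potential is at most one. -/
theorem run_roundCmd {S n : ℕ} {M : Mem} {C z : ℤ → ℤ} (hS : M aSize 0 = S) (hn : M aN 0 = n)
    (hN : Net S n (M aTail) (M aHead)) (hsym : SymmetricNet S (M aTail) (M aHead) C)
    (hC : M aCost = fun k => 2 * C k) (hF : ∀ k : ℕ, k < S → M aFlow k = 0)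
    (hp : Potential S (M aTail) (M aHead) (fun k => 2 * C k) (M aPot))
    (hneg : ∀ u ∈ nodes n, M aPot (-u) = -M aPot u)
    (hz : Potential S (M aTail) (M aHead) C z) (hzneg : ∀ u, z (-u) = -z u) :
    Rounded S n (M aTail) (M aHead) C (M aPot) (roundCmd.run S M aPot) ∧
      ∀ j : ℕ, j < n → Even (roundCmd.run S M aPot (j + 1)) := by
  have key : Rounded S n (M aTail) (M aHead) C (M aPot) (roundCmd.run S M aPot) ∧
      ∀ j : ℕ, j < n → j < S → Even (roundCmd.run S M aPot (j + 1)) := by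
    refine run_rep_induction (I := fun i N => Rounded S n (M aTail) (M aHead) C (M aPot) (N aPot) ∧
      ∀ j : ℕ, j < n → j < i → Even (N aPot (j + 1))) ?_ ?_
    · simp only [Mem.store_apply]
      exact ⟨⟨hp, hneg, fun u _ => Or.inl rfl⟩, fun j _ h => absurd h (Nat.not_lt_zero j)⟩
    · intro i hi N hNf hNi ⟨hR, hev⟩
      have hNf' : ∀ x ∉ [aSrc, aBound, aDist, aPot, cMap, cRound, cArc, cVar],
          N x = M x := fun x hx => hNf x (notMem_of_subset hx (by decide))
      simp only [Mem.store_apply, show ¬ (aPot = cVar) by decide, if_false]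
      have same : (i < n → Even (N aPot (i + 1))) →
          Rounded S n (M aTail) (M aHead) C (M aPot) (N aPot) ∧
          ∀ j : ℕ, j < n → j < i + 1 → Even (N aPot (j + 1)) := by
        refine fun he => ⟨hR, fun j hj hji => ?_⟩
        rcases Nat.lt_succ_iff_lt_or_eq.1 hji with h | rfl
        exacts [hev j hj h, he hj]
      rw [run_ite]
      by_cases hin : i < n
      swap
      · rw [if_neg (by simp [hNi, hNf' aN (by decide), hn]; omega), run_skip]
        exact same fun h => absurd h hin
      rw [if_pos (by simp [hNi, hNf' aN (by decide), hn]; omega), run_ite]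
      have hval : (rd aPot (var cVar + 1)).val N = N aPot (i + 1) := by simp [hNi]
      by_cases hodd : Odd (N aPot (i + 1))
      swap
      · rw [if_neg (by rwa [val_oddE_pos, hval]), run_skip]
        exact same fun _ => Int.not_odd_iff_even.1 hodd
      rw [if_pos (by rwa [val_oddE_pos, hval]), run_seq]
      obtain ⟨s, hs, hD, hDs⟩ := run_reachCmd (S := S) (n := n) (j := i) (M := N) (C := C) (z := z)
        (by rw [hNf' _ (by decide), hS]) (by rw [hNf' _ (by decide), hn]) hNi hin
        (by rw [hNf' aTail (by decide), hNf' aHead (by decide)]; exact hN)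
        (by rw [hNf' aCost (by decide), hC]) (by rw [hNf' aFlow (by decide)]; exact hF)
        (by rw [hNf' aTail (by decide), hNf' aHead (by decide)]; exact hR.potential) hR.neg
        (by rw [hNf' aTail (by decide), hNf' aHead (by decide)]; exact hz) hzneg hodd
      rw [hNf' aTail (by decide), hNf' aHead (by decide), hNf' aFlow (by decide)] at hD
      have hf := run_frame_of_subset S reachCmd [aSrc, aBound, aDist, cMap, cRound, cArc]
        (by decide) N
      generalize reachCmd.run S N = N₁ at *
      have hiN : ((i : ℤ) + 1) ∈ nodes n := by rw [mem_nodes]; omega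
      have hsN : s ∈ nodes n := by
        rcases hs with rfl | rfl
        exacts [hiN, neg_mem_nodes hiN]
      have hodds : Odd (N aPot s) := by
        rcases hs with rfl | rfl
        · exact hodd
        · rw [hR.neg _ hiN]; exact hodd.neg
      obtain ⟨h1, h2, h3, h4⟩ := round_spec (X' := shiftCmd.run S N₁ aPot) hN hsym hR.potential
        hR.neg hF hD hsN hodds hDs fun u hu => by
          rw [run_shiftCmd (n := n) (by rw [hf _ (by decide), hNf' _ (by decide), hS])
            (by rw [hf _ (by decide), hNf' _ (by decide), hn]) hN.size hu, hf aPot (by decide)]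
      refine ⟨⟨h1, h2, fun u hu => ?_⟩, fun j hj hji => ?_⟩
      · rcases h4 u hu with h | ⟨ho, h⟩
        · rw [h]; exact hR.near u hu
        · rcases hR.near u hu with h' | ⟨-, he, -⟩
          · right
            rw [← h']
            refine ⟨ho, ?_, h⟩
            rcases h with h | h <;> rw [h]
            exacts [ho.add_odd odd_one, ho.sub_odd odd_one]
          · exact absurd ho (Int.not_odd_iff_even.2 he)
      · rcases Nat.lt_succ_iff_lt_or_eq.1 hji with h | rfl
        · rcases h4 (j + 1) (by rw [mem_nodes]; omega) with h' | ⟨ho, -⟩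
          · rw [h']; exact hev j hj h
          · exact absurd ho (Int.not_odd_iff_even.2 (hev j hj h))
        · rcases hs with rfl | rfl
          · exact h3
          · rw [h2 _ hiN] at h3
            exact even_neg.1 h3
  have hsize := hN.size
  exact ⟨key.1, fun j hj => key.2 j hj (by omega)⟩

/-- Halve the potentials, check the constraints, and output. -/
def outputCmd : Cmd :=
  .rep cMap (.ite nodeE (.write aOut nodeE (rd aPot nodeE / 2))
    (.write aOut nodeE (0 - rd aPot (0 - nodeE) / 2))) ;;
  .write aOut 0 0 ;; .write aFlag 0 1 ;;
  .rep cArc (.ite (rd aCost (var cArc) - ((rd aOut tailE - rd aOut headE) +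
    (rd aOut tailE - rd aOut headE))) (.write aFlag 0 0) .skip) ;;
  .write aOut 0 (var aFlag) ;; .write aOutLen 0 1 ;;
  .ite (var aFlag) (.write aOutLen 0 (var aN + 1)) .skip

/-- Nothing is assumed of the potential, so this also covers infeasible instances, where the earlier
phases give no guarantee: checking all arcs decides the answer. -/
theorem run_outputCmd {S n : ℕ} {M : Mem} {C : ℤ → ℤ} (hn : M aN 0 = n)
    (hN : Net S n (M aTail) (M aHead)) (hC : M aCost = fun k => 2 * C k) :
    (Potential S (M aTail) (M aHead) C (oddExt fun u => M aPot u / 2) ∧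
      output (outputCmd.run S M) = 1 :: List.ofFn fun j : Fin n => M aPot ((j : ℤ) + 1) / 2) ∨
    (¬ Potential S (M aTail) (M aHead) C (oddExt fun u => M aPot u / 2) ∧
      output (outputCmd.run S M) = [0]) := by
  have hsize := hN.size
  rw [outputCmd, run_seq, run_seq, run_seq, run_seq]
  generalize hc₁ : Cmd.rep cMap (.ite nodeE (.write aOut nodeE (rd aPot nodeE / 2))
    (.write aOut nodeE (0 - rd aPot (0 - nodeE) / 2))) = c₁
  have hf₁ := run_frame_of_subset S c₁ [cMap, aOut] (by subst hc₁; decide) M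
  -- Negative nodes are filled from the positive ones, because rounding division by two is not an
  -- odd function.
  have hout₁ : ∀ u ∈ nodes n, u ≠ 0 → c₁.run S M aOut u = oddExt (fun u => M aPot u / 2) u := by
    intro u hu hu0
    rw [← hc₁, run_rep_map (by decide) n
      (fun u _ => if 0 < u then M aPot u / 2 else - (M aPot (-u) / 2)), if_pos]
    · unfold oddExt
      split_ifs <;> first | rfl | omega
    · rw [mem_nodes] at hu; omega
    · intro k hk N hN hNk
      have hv : nodeE.val N = (k : ℤ) - n := by simp [nodeE, hNk, hN aN (by decide), hn]
      rw [run_ite, hv]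
      split_ifs with h <;> simp [run_write, hv, hN aPot (by decide)]
  generalize c₁.run S M = M₁ at *
  set M₂ := (Cmd.write aFlag 0 1).run S ((Cmd.write aOut 0 0).run S M₁) with hM₂
  have hf₂ : ∀ b, b ∉ [cMap, aOut, aFlag] → M₂ b = M b := fun b hb => by
    rw [hM₂, run_frame_of_subset S _ [aFlag] (by decide) _ _ (notMem_of_subset hb (by decide)),
      run_frame_of_subset S _ [aOut] (by decide) _ _ (notMem_of_subset hb (by decide)),
      hf₁ _ (notMem_of_subset hb (by decide))]
  have hout₂ : ∀ u ∈ nodes n, M₂ aOut u = oddExt (fun u => M aPot u / 2) u := by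
    intro u hu
    have : M₂ aOut = Function.update (M₁ aOut) 0 0 := by
      simp [hM₂, run_write, Mem.store_apply]
    rw [this]
    by_cases hu0 : u = 0
    · subst hu0; simp [oddExt]
    · rw [Function.update_of_ne hu0, hout₁ u hu hu0]
  have hflag₂ : M₂ aFlag 0 = 1 := by simp [hM₂, run_write]
  generalize hc₃ : Cmd.rep cArc (.ite (rd aCost (var cArc) - ((rd aOut tailE - rd aOut headE) +
    (rd aOut tailE - rd aOut headE))) (.write aFlag 0 0) .skip) = c₃
  have hf₃ := run_frame_of_subset S c₃ [cArc, aFlag] (by subst hc₃; decide) M₂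
  set x := oddExt fun u => M aPot u / 2 with hx
  have hflag₃ : (c₃.run S M₂ aFlag 0 = 1 ∧ ∀ k : ℕ, k < S →
      C k ≤ x (M aTail k) - x (M aHead k)) ∨
      (c₃.run S M₂ aFlag 0 = 0 ∧ ∃ k : ℕ, k < S ∧ ¬ C k ≤ x (M aTail k) - x (M aHead k)) := by
    have := run_rep_induction (S := S) (a := cArc) (c := .ite (rd aCost (var cArc) -
      ((rd aOut tailE - rd aOut headE) + (rd aOut tailE - rd aOut headE))) (.write aFlag 0 0) .skip)
      (M := M₂) (I := fun i N => i ≤ S →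
        (N aFlag 0 = 1 ∧ ∀ k : ℕ, k < i → C k ≤ x (M aTail k) - x (M aHead k)) ∨
        (N aFlag 0 = 0 ∧ ∃ k : ℕ, k < i ∧ ¬ C k ≤ x (M aTail k) - x (M aHead k))) ?_ ?_
    · rw [← hc₃]; exact this le_rfl
    · exact fun _ => Or.inl ⟨by simpa [Mem.store_apply] using hflag₂,
        fun k hk => absurd hk (Nat.not_lt_zero k)⟩
    · intro i hi N hNf hNi hI _
      have hval : (rd aCost (var cArc) - ((rd aOut tailE - rd aOut headE) +
          (rd aOut tailE - rd aOut headE))).val N =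
          2 * C i - 2 * (x (M aTail i) - x (M aHead i)) := by
        simp only [val_sub, val_add, val_read, val_var, tailE, headE, hNi,
          hNf aCost (by decide), hNf aOut (by decide), hNf aTail (by decide),
          hNf aHead (by decide), hf₂ aCost (by decide), hf₂ aTail (by decide),
          hf₂ aHead (by decide), hC, hout₂ _ (hN.tail i hi), hout₂ _ (hN.head i hi)]
        ring
      simp only [Mem.store_apply, show ¬ (aFlag = cArc) by decide, if_false]
      rw [run_ite, hval]
      by_cases hok : C i ≤ x (M aTail i) - x (M aHead i)
      · rw [if_neg (by omega), run_skip]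
        refine (hI (by omega)).imp (fun h => ⟨h.1, fun k hk => ?_⟩)
          fun ⟨h, k, hk, hk'⟩ => ⟨h, k, by omega, hk'⟩
        rcases Nat.lt_succ_iff_lt_or_eq.1 hk with h' | rfl
        exacts [h.2 k h', hok]
      · rw [if_pos (by omega)]
        exact Or.inr ⟨by simp [run_write], i, by omega, hok⟩
  generalize c₃.run S M₂ = M₃ at *
  -- Variable `j` lies in cell `j + 1`, so cell `0` is free for the flag that heads the output.
  have hlast : ∀ f : ℤ, M₃ aFlag 0 = f →
      output (run S (.write aOut 0 (var aFlag) ;; .write aOutLen 0 1 ;;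
        .ite (var aFlag) (.write aOutLen 0 (var aN + 1)) .skip) M₃) =
      (List.range (if 0 < f then (n : ℤ) + 1 else 1).toNat).map fun i : ℕ =>
        Function.update (M₃ aOut) 0 f i := by
    intro f hf
    rw [output_eq, run_seq, run_seq, run_ite, run_write, run_write]
    simp only [val_var, Mem.store_apply]
    have hn₃ : M₃ aN 0 = n := by rw [hf₃ aN (by decide), hf₂ aN (by decide), hn]
    by_cases h : 0 < f
    · simp [h, run_write, Mem.store_apply, hf, hn₃]
    · simp [h, run_skip, Mem.store_apply, hf]
  rcases hflag₃ with ⟨h1, h2⟩ | ⟨h1, k, hk, h2⟩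
  · refine Or.inl ⟨h2, ?_⟩
    rw [hlast 1 h1, if_pos one_pos, show ((n : ℤ) + 1).toNat = n + 1 by omega]
    rw [List.range_succ_eq_map, List.map_cons, List.map_map]
    congr 1
    refine List.ext_getElem (by simp) fun i hi hi' => ?_
    have hin : i < n := by simpa using hi
    simp only [List.getElem_map, List.getElem_range, Function.comp, List.getElem_ofFn]
    rw [Function.update_of_ne (by push_cast; omega), hf₃ aOut (by decide),
      hout₂ _ (by rw [mem_nodes]; push_cast; omega), hx, oddExt_of_pos _ (by push_cast; omega)]
    push_cast
    rfl
  · refine Or.inr ⟨fun h => h2 (h k hk), ?_⟩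
    rw [hlast 0 h1]
    simp

end UTVPI

namespace UTVPI

open RAM RAM.Cmd

/-! ## Reading the instance -/

/-- The two literals of a row after reading `q` entries, the last one first. -/
def literals (a : ℕ → ℤ) : ℕ → ℤ × ℤ
  | 0 => (0, 0)
  | q + 1 => if 0 < a q then ((q : ℤ) + 1, (literals a q).1)
      else if a q < 0 then (-((q : ℤ) + 1), (literals a q).1) else literals a q

theorem literals_mem (a : ℕ → ℤ) (q : ℕ) :
    (literals a q).1 ∈ nodes q ∧ (literals a q).2 ∈ nodes q := by
  induction q with
  | zero => simp [literals, mem_nodes]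
  | succ q ih =>
    simp only [mem_nodes] at ih ⊢
    simp only [literals]
    push_cast
    split_ifs
    · dsimp only; omega
    · dsimp only; omega
    · omega

/-- Only the last two nonzero entries are remembered. The counts show that a literal pushed out is
still `0`, the node of value zero, so no term of the row is lost. -/
theorem sum_eq_literals {a : ℕ → ℤ} {n : ℕ} (ha : ∀ j < n, a j = -1 ∨ a j = 0 ∨ a j = 1)
    (x : ℤ → ℤ) : ∀ q ≤ n,
    (((Finset.range q).filter fun j => a j ≠ 0).card ≤ 2 →
      ∑ j ∈ Finset.range q, a j * x (j + 1) =
        oddExt x (literals a q).1 + oddExt x (literals a q).2) ∧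
    (((Finset.range q).filter fun j => a j ≠ 0).card ≤ 1 → (literals a q).2 = 0) ∧
    (((Finset.range q).filter fun j => a j ≠ 0).card = 0 → (literals a q).1 = 0) := by
  intro q
  induction q with
  | zero => simp [literals, oddExt]
  | succ q ih =>
    intro hq
    obtain ⟨h1, h2, h3⟩ := ih (by omega)
    have hcard : ((Finset.range (q + 1)).filter fun j => a j ≠ 0).card =
        ((Finset.range q).filter fun j => a j ≠ 0).card + if a q ≠ 0 then 1 else 0 := by
      rw [Finset.range_add_one, Finset.filter_insert]
      split_ifs
      · rw [Finset.card_insert_of_notMem (by simp)]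
      · rfl
    rw [hcard, Finset.sum_range_succ]
    clear hcard
    generalize ((Finset.range q).filter fun j => a j ≠ 0).card = c at *
    have hz : oddExt x 0 = 0 := by simp [oddExt]
    have hp : oddExt x ((q : ℤ) + 1) = x (q + 1) := oddExt_of_pos _ (by omega)
    simp only [literals]
    rcases ha q hq with h | h | h
    · simp only [h, ne_eq, neg_eq_zero, one_ne_zero, not_false_eq_true, if_true,
        show ¬ (0 : ℤ) < -1 by decide, if_false, show (-1 : ℤ) < 0 by decide]
      refine ⟨fun hc => ?_, fun hc => h3 (by omega), fun hc => by omega⟩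
      rw [h1 (by omega), h2 (by omega), oddExt_neg, hz, hp]
      ring
    · simp only [h, ne_eq, not_true_eq_false, if_false, lt_irrefl, add_zero, zero_mul]
      exact ⟨h1, h2, h3⟩
    · simp only [h, ne_eq, one_ne_zero, not_false_eq_true, if_true, show (0 : ℤ) < 1 by decide]
      refine ⟨fun hc => ?_, fun hc => h3 (by omega), fun hc => by omega⟩
      rw [h1 (by omega), h2 (by omega), hz, hp]
      ring

/-- The array `f` holds the encoding of `I`. -/
structure Encodes (I : UTVPIProblem) (f : ℤ → ℤ) : Prop where
  rows : f 0 = I.m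
  cols : f 1 = I.n
  matrix : ∀ (i : Fin I.m) (j : Fin I.n), f (2 + (i : ℤ) * I.n + j) = I.A i j
  rhs : ∀ i : Fin I.m, f (2 + (I.m : ℤ) * I.n + i) = I.b i
  num : ∀ j : Fin I.n, f (2 + (I.m : ℤ) * I.n + I.m + j) = (I.w j).num
  den : ∀ j : Fin I.n, f (2 + (I.m : ℤ) * I.n + I.m + I.n + j) = (I.w j).den

/-- Read the numbers of rows and columns. -/
def headerCmd : Cmd :=
  .write aM 0 (rd aIn 0) ;; .write aN 0 (rd aIn 1) ;; .write aPtr 0 2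

/-- Make an expression the last literal. -/
def pushCmd (e : Expr) : Cmd := .write aPrev 0 (var aLit) ;; .write aLit 0 e

/-- Read an entry of the matrix. -/
def entryCmd : Cmd :=
  .ite (rd aIn (var aPtr)) (pushCmd (var cMap + 1))
    (.ite (0 - rd aIn (var aPtr)) (pushCmd (0 - (var cMap + 1))) .skip) ;;
  .write aPtr 0 (var aPtr + 1)

/-- Read a row of the matrix. -/
def rowCmd : Cmd :=
  .write aLit 0 0 ;; .write aPrev 0 0 ;; .rep cMap (.ite (var aN - var cMap) entryCmd .skip)

/-- Store the two arcs of a row. -/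
def storeRowCmd : Cmd :=
  .write aTail (var cVar + var cVar) (var aLit) ;;
  .write aHead (var cVar + var cVar) (0 - var aPrev) ;;
  .write aTail (var cVar + var cVar + 1) (var aPrev) ;;
  .write aHead (var cVar + var cVar + 1) (0 - var aLit)

/-- Read the matrix. -/
def matrixCmd : Cmd :=
  .rep cVar (.ite (var aM - var cVar) (rowCmd ;; storeRowCmd) .skip)

/-- Read the right-hand sides. -/
def rhsCmd : Cmd :=
  .rep cVar (.ite (var aM - var cVar)
    (.write aCost (var cVar + var cVar) (rd aIn (var aPtr + var cVar)) ;;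
     .write aCost (var cVar + var cVar + 1) (rd aIn (var aPtr + var cVar))) .skip)

/-- Store the arcs of the constraints `0 ≤ x j`. -/
def nonnegCmd : Cmd :=
  .rep cVar (.ite (var aN - var cVar)
    (.write aTail (var aM + var aM + var cVar) (var cVar + 1) ;;
     .write aHead (var aM + var aM + var cVar) (0 - (var cVar + 1))) .skip)

theorem run_entryCmd {S k : ℕ} {M : Mem} (hk : M cMap 0 = k) :
    ((entryCmd.run S M aLit 0, entryCmd.run S M aPrev 0) : ℤ × ℤ) =
      (if 0 < M aIn (M aPtr 0) then ((k : ℤ) + 1, M aLit 0)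
      else if M aIn (M aPtr 0) < 0 then (-((k : ℤ) + 1), M aLit 0)
      else (M aLit 0, M aPrev 0)) ∧ entryCmd.run S M aPtr 0 = M aPtr 0 + 1 := by
  rw [entryCmd, run_seq, run_ite, run_ite, pushCmd, pushCmd]
  simp only [val_read, val_var, val_sub, val_zero, zero_sub, Left.neg_pos_iff]
  split_ifs <;> simp [run_seq, run_write, run_skip, Mem.store_apply, hk]

theorem run_rowCmd {S n : ℕ} {M : Mem} (hn : M aN 0 = n) (hnS : n ≤ S) :
    ((rowCmd.run S M aLit 0, rowCmd.run S M aPrev 0) : ℤ × ℤ) =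
      literals (fun j => M aIn (M aPtr 0 + j)) n ∧ rowCmd.run S M aPtr 0 = M aPtr 0 + n := by
  rw [rowCmd, run_seq, run_seq]
  set M₁ := (Cmd.write aPrev 0 0).run S ((Cmd.write aLit 0 0).run S M) with hM₁
  have hf₁ : ∀ b, b ∉ [aLit, aPrev] → M₁ b = M b := fun b hb => by
    rw [hM₁, run_frame_of_subset S _ [aPrev] (by decide) _ _ (notMem_of_subset hb (by decide)),
      run_frame_of_subset S _ [aLit] (by decide) _ _ (notMem_of_subset hb (by decide))]
  -- Loops always run `S` rounds and idle once the guard fails; hence `min k n` in the invariant.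
  have := run_rep_induction (S := S) (a := cMap) (c := .ite (var aN - var cMap) entryCmd .skip)
    (M := M₁) (I := fun k N => ((N aLit 0, N aPrev 0) : ℤ × ℤ) =
      literals (fun j => M aIn (M aPtr 0 + j)) (min k n) ∧ N aPtr 0 = M aPtr 0 + (min k n : ℕ)) ?_ ?_
  · rwa [min_eq_right hnS] at this
  · simp [Mem.store_apply, literals, hf₁ aPtr (by decide)]
    simp [hM₁, run_write, Mem.store_apply]
  · intro k hk N hNf hNk ⟨hI1, hI2⟩
    simp only [Mem.store_apply, show ¬ (aLit = cMap) by decide, show ¬ (aPrev = cMap) by decide,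
      show ¬ (aPtr = cMap) by decide, if_false]
    rw [run_ite]
    have hnN : N aN 0 = n := by rw [hNf aN (by decide), hf₁ aN (by decide), hn]
    by_cases hkn : k < n
    · rw [if_pos (by simp [hNk, hnN]; omega)]
      rw [min_eq_left hkn.le] at hI1 hI2
      obtain ⟨h1, h2⟩ := run_entryCmd (S := S) hNk
      rw [min_eq_left (show k + 1 ≤ n by omega), h1, h2, hI2]
      refine ⟨?_, by push_cast; ring⟩
      have hl1 : N aLit 0 = (literals (fun j => M aIn (M aPtr 0 + j)) k).1 := by rw [← hI1]
      rw [hI1, hl1]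
      simp only [literals, hNf aIn (by decide), hf₁ aIn (by decide)]
    · rw [if_neg (by simp [hNk, hnN]; omega), run_skip]
      rw [min_eq_right (by omega)] at hI1 hI2 ⊢
      exact ⟨hI1, hI2⟩

/-- The arcs of the first `q` rows. -/
def RowArcs (f : ℤ → ℤ) (n q : ℕ) (T H : ℤ → ℤ) : Prop :=
  (∀ r : ℕ, r < q → ∃ u v, literals (fun j => f (2 + (r : ℤ) * n + j)) n = (u, v) ∧
    T (r + r) = u ∧ H (r + r) = -v ∧ T (r + r + 1) = v ∧ H (r + r + 1) = -u) ∧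
  ∀ k : ℤ, (k < 0 ∨ 2 * (q : ℤ) ≤ k) → T k = 0 ∧ H k = 0

theorem run_matrixCmd {S n m : ℕ} {M : Mem} (hn : M aN 0 = n) (hm : M aM 0 = m) (hnS : n ≤ S)
    (hmS : m ≤ S) (hptr : M aPtr 0 = 2) (hT : ∀ k, M aTail k = 0) (hH : ∀ k, M aHead k = 0) :
    RowArcs (M aIn) n m (matrixCmd.run S M aTail) (matrixCmd.run S M aHead) ∧
      matrixCmd.run S M aPtr 0 = 2 + (m : ℤ) * n := by
  have := run_rep_induction (S := S) (a := cVar)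
    (c := .ite (var aM - var cVar) (rowCmd ;; storeRowCmd) .skip)
    (M := M) (I := fun k N => RowArcs (M aIn) n (min k m) (N aTail) (N aHead) ∧
      N aPtr 0 = 2 + (min k m : ℕ) * (n : ℤ)) ?_ ?_
  · rwa [min_eq_right hmS] at this
  · simp [Mem.store_apply, hptr, RowArcs, hT, hH]
  · intro k hk N hNf hNk ⟨⟨hI1, hI2⟩, hI3⟩
    simp only [Mem.store_apply, show ¬ (aTail = cVar) by decide, show ¬ (aHead = cVar) by decide,
      show ¬ (aPtr = cVar) by decide, if_false]
    rw [run_ite]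
    have hnN : N aN 0 = n := by rw [hNf aN (by decide), hn]
    have hmN : N aM 0 = m := by rw [hNf aM (by decide), hm]
    by_cases hkm : k < m
    · rw [if_pos (by simp [hNk, hmN]; omega), run_seq]
      rw [min_eq_left hkm.le] at hI1 hI2 hI3
      rw [min_eq_left (show k + 1 ≤ m by omega)]
      obtain ⟨h1, h2⟩ := run_rowCmd hnN hnS
      have hf := run_frame_of_subset S rowCmd [aLit, aPrev, cMap, aPtr] (by decide) N
      generalize rowCmd.run S N = N₁ at *
      have hk₁ : N₁ cVar 0 = k := by rw [hf _ (by decide), hNk]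
      have hs : storeRowCmd.run S N₁ aTail = Function.update (Function.update (N aTail)
          ((k : ℤ) + k) (N₁ aLit 0)) (k + k + 1) (N₁ aPrev 0) ∧
          storeRowCmd.run S N₁ aHead = Function.update (Function.update (N aHead)
          ((k : ℤ) + k) (-N₁ aPrev 0)) (k + k + 1) (-N₁ aLit 0) ∧
          storeRowCmd.run S N₁ aPtr = N₁ aPtr := by
        simp [storeRowCmd, run_seq, run_write, Mem.store_apply, hk₁, hf aTail (by decide),
          hf aHead (by decide)]
      rw [hs.1, hs.2.1, hs.2.2, h2, hI3]
      refine ⟨⟨fun r hr => ?_, fun i hi => ?_⟩, by push_cast; ring⟩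
      · rcases Nat.lt_succ_iff_lt_or_eq.1 hr with hr | rfl
        · obtain ⟨u, v, hl, a1, a2, a3, a4⟩ := hI1 r hr
          refine ⟨u, v, hl, ?_⟩
          repeat rw [Function.update_of_ne (by omega)]
          exact ⟨a1, a2, a3, a4⟩
        · refine ⟨N₁ aLit 0, N₁ aPrev 0, ?_, ?_⟩
          · rw [h1, hI3, hNf aIn (by decide)]
          · simp [Function.update_of_ne]
      · push_cast at hi
        repeat rw [Function.update_of_ne (by omega)]
        exact hI2 i (by omega)
    · rw [if_neg (by simp [hNk, hmN]; omega), run_skip]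
      rw [min_eq_right (by omega)] at hI1 hI2 hI3 ⊢
      exact ⟨⟨hI1, hI2⟩, hI3⟩

theorem run_rhsCmd {S m : ℕ} {M : Mem} (hm : M aM 0 = m) (hmS : m ≤ S)
    (hC : ∀ k, M aCost k = 0) :
    (∀ r : ℕ, r < m → rhsCmd.run S M aCost (r + r) = M aIn (M aPtr 0 + r) ∧
      rhsCmd.run S M aCost (r + r + 1) = M aIn (M aPtr 0 + r)) ∧
    ∀ k : ℤ, (k < 0 ∨ 2 * (m : ℤ) ≤ k) → rhsCmd.run S M aCost k = 0 := by
  have := run_rep_induction (S := S) (a := cVar) (c := .ite (var aM - var cVar)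
    (.write aCost (var cVar + var cVar) (rd aIn (var aPtr + var cVar)) ;;
     .write aCost (var cVar + var cVar + 1) (rd aIn (var aPtr + var cVar))) .skip)
    (M := M) (I := fun k N => (∀ r : ℕ, r < min k m → N aCost (r + r) = M aIn (M aPtr 0 + r) ∧
      N aCost (r + r + 1) = M aIn (M aPtr 0 + r)) ∧
      ∀ i : ℤ, (i < 0 ∨ 2 * ((min k m : ℕ) : ℤ) ≤ i) → N aCost i = 0) ?_ ?_
  · rwa [min_eq_right hmS] at this
  · simp [Mem.store_apply, hC]
  · intro k hk N hNf hNk ⟨hI1, hI2⟩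
    simp only [Mem.store_apply, show ¬ (aCost = cVar) by decide, if_false]
    rw [run_ite]
    have hmN : N aM 0 = m := by rw [hNf aM (by decide), hm]
    by_cases hkm : k < m
    · rw [if_pos (by simp [hNk, hmN]; omega)]
      rw [min_eq_left hkm.le] at hI1 hI2
      rw [min_eq_left (show k + 1 ≤ m by omega)]
      have hs : run S (.write aCost (var cVar + var cVar) (rd aIn (var aPtr + var cVar)) ;;
          .write aCost (var cVar + var cVar + 1) (rd aIn (var aPtr + var cVar))) N aCost =
          Function.update (Function.update (N aCost) ((k : ℤ) + k) (M aIn (M aPtr 0 + k)))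
          (k + k + 1) (M aIn (M aPtr 0 + k)) := by
        simp [run_seq, run_write, Mem.store_apply, hNk, hNf aIn (by decide), hNf aPtr (by decide)]
      rw [hs]
      refine ⟨fun r hr => ?_, fun i hi => ?_⟩
      · rcases Nat.lt_succ_iff_lt_or_eq.1 hr with hr | rfl
        · repeat rw [Function.update_of_ne (by omega)]
          exact hI1 r hr
        · simp [Function.update_of_ne]
      · push_cast at hi
        repeat rw [Function.update_of_ne (by omega)]
        exact hI2 i (by omega)
    · rw [if_neg (by simp [hNk, hmN]; omega), run_skip]
      rw [min_eq_right (by omega)] at hI1 hI2 ⊢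
      exact ⟨hI1, hI2⟩

theorem run_nonnegCmd {S n m : ℕ} {M : Mem} (hn : M aN 0 = n) (hm : M aM 0 = m) (hnS : n ≤ S) :
    (∀ j : ℕ, j < n → nonnegCmd.run S M aTail (m + m + j) = j + 1 ∧
      nonnegCmd.run S M aHead (m + m + j) = -(j + 1)) ∧
    ∀ k : ℤ, (k < m + m ∨ (m : ℤ) + m + n ≤ k) → nonnegCmd.run S M aTail k = M aTail k ∧
      nonnegCmd.run S M aHead k = M aHead k := by
  have := run_rep_induction (S := S) (a := cVar) (c := .ite (var aN - var cVar)
    (.write aTail (var aM + var aM + var cVar) (var cVar + 1) ;;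
     .write aHead (var aM + var aM + var cVar) (0 - (var cVar + 1))) .skip)
    (M := M) (I := fun k N => (∀ j : ℕ, j < min k n → N aTail (m + m + j) = j + 1 ∧
      N aHead (m + m + j) = -(j + 1)) ∧
      ∀ i : ℤ, (i < m + m ∨ (m : ℤ) + m + (min k n : ℕ) ≤ i) → N aTail i = M aTail i ∧
      N aHead i = M aHead i) ?_ ?_
  · rwa [min_eq_right hnS] at this
  · simp [Mem.store_apply]
  · intro k hk N hNf hNk ⟨hI1, hI2⟩
    simp only [Mem.store_apply, show ¬ (aTail = cVar) by decide, show ¬ (aHead = cVar) by decide,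
      if_false]
    rw [run_ite]
    have hnN : N aN 0 = n := by rw [hNf aN (by decide), hn]
    have hmN : N aM 0 = m := by rw [hNf aM (by decide), hm]
    by_cases hkm : k < n
    · rw [if_pos (by simp [hNk, hnN]; omega)]
      rw [min_eq_left hkm.le] at hI1 hI2
      rw [min_eq_left (show k + 1 ≤ n by omega)]
      have hs : run S (.write aTail (var aM + var aM + var cVar) (var cVar + 1) ;;
          .write aHead (var aM + var aM + var cVar) (0 - (var cVar + 1))) N aTail =
          Function.update (N aTail) ((m : ℤ) + m + k) (k + 1) ∧
          run S (.write aTail (var aM + var aM + var cVar) (var cVar + 1) ;;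
          .write aHead (var aM + var aM + var cVar) (0 - (var cVar + 1))) N aHead =
          Function.update (N aHead) ((m : ℤ) + m + k) (-(k + 1)) := by
        constructor <;> simp [run_seq, run_write, Mem.store_apply, hNk, hmN]
      rw [hs.1, hs.2]
      refine ⟨fun r hr => ?_, fun i hi => ?_⟩
      · rcases Nat.lt_succ_iff_lt_or_eq.1 hr with hr | rfl
        · repeat rw [Function.update_of_ne (by omega)]
          exact hI1 r hr
        · simp
      · push_cast at hi
        repeat rw [Function.update_of_ne (by omega)]
        exact hI2 i (by omega)
    · rw [if_neg (by simp [hNk, hnN]; omega), run_skip]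
      rw [min_eq_right (by omega)] at hI1 hI2 ⊢
      exact ⟨hI1, hI2⟩

end UTVPI

/-! ### Integral weights -/

namespace UTVPI

open RAM RAM.Cmd

/-- Multiply the weight of variable `cBit` by the content of `aBits`. -/
def mulCmd : Cmd :=
  .write aAcc 0 0 ;; .write aMul 0 (rd aWeight (var cBit + 1)) ;;
  .rep cMap (.ite (oddE (var aBits)) (.write aAcc 0 (var aAcc + var aMul)) .skip ;;
    .write aMul 0 (var aMul + var aMul) ;; .write aBits 0 (var aBits / 2)) ;;
  .write aWeight (var cBit + 1) (var aAcc)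

/-- Read the factor `cVar` of the weight `cBit`. -/
def factorCmd : Cmd :=
  .write aBits 0 (rd aIn (var aPtr + var aM + var aN + var cVar)) ;;
  ifEq (var cVar) (var cBit) (.write aBits 0 (rd aIn (var aPtr + var aM + var cVar)))

/-- Compute the weights, multiplied by the product of their denominators. -/
def weightCmd : Cmd :=
  .rep cBit (.ite (var aN - var cBit) (.write aWeight (var cBit + 1) 1 ;;
    .rep cVar (.ite (var aN - var cVar) (factorCmd ;; mulCmd) .skip)) .skip)

/-- Multiplication by shifting and adding, since tame products are only with `S`. The sum of `aAcc`
and `aMul * aBits` is invariant, and `S` halvings exhaust `aBits`. -/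
theorem run_mulCmd {S j : ℕ} {M : Mem} (hj : M cBit 0 = j) (h0 : 0 ≤ M aBits 0)
    (h2 : M aBits 0 < 2 ^ S) : mulCmd.run S M aWeight =
      Function.update (M aWeight) (j + 1) (M aWeight (j + 1) * M aBits 0) := by
  rw [mulCmd, run_seq, run_seq, run_seq]
  set M₁ := (Cmd.write aMul 0 (rd aWeight (var cBit + 1))).run S ((Cmd.write aAcc 0 0).run S M)
    with hM₁
  have hf₁ : ∀ b, b ∉ [aAcc, aMul] → M₁ b = M b := fun b hb => by
    rw [hM₁, run_frame_of_subset S _ [aMul] (by decide) _ _ (notMem_of_subset hb (by decide)),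
      run_frame_of_subset S _ [aAcc] (by decide) _ _ (notMem_of_subset hb (by decide))]
  have hacc : M₁ aAcc 0 = 0 := by simp [hM₁, run_write, Mem.store_apply]
  have hmul : M₁ aMul 0 = M aWeight (j + 1) := by simp [hM₁, run_write, Mem.store_apply, hj]
  generalize hc : Cmd.rep cMap (.ite (oddE (var aBits)) (.write aAcc 0 (var aAcc + var aMul)) .skip ;;
    .write aMul 0 (var aMul + var aMul) ;; .write aBits 0 (var aBits / 2)) = c
  have hf₂ := run_frame_of_subset S c [cMap, aAcc, aMul, aBits] (by subst hc; decide) M₁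
  have key : c.run S M₁ aAcc 0 + c.run S M₁ aMul 0 * c.run S M₁ aBits 0 =
      M aWeight (j + 1) * M aBits 0 ∧ c.run S M₁ aBits 0 = M aBits 0 / 2 ^ S := by
    rw [← hc]
    refine run_rep_induction (I := fun t N => N aAcc 0 + N aMul 0 * N aBits 0 =
      M aWeight (j + 1) * M aBits 0 ∧ N aBits 0 = M aBits 0 / 2 ^ t) ?_ ?_
    · simp [Mem.store_apply, hacc, hmul, hf₁ aBits (by decide)]
    · intro t ht N hNf hNt ⟨hI1, hI2⟩
      rw [run_seq, run_seq, run_ite, run_write, run_write]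
      have hd : N aBits 0 / 2 = M aBits 0 / 2 ^ (t + 1) := by
        rw [hI2, Int.ediv_ediv_of_nonneg (by positivity), pow_succ]
      by_cases hodd : Odd (N aBits 0)
      · rw [if_pos (val_oddE_pos.2 (show Odd ((var aBits).val N) from hodd))]
        simp [run_write, Mem.store_apply]
        refine ⟨?_, hd⟩
        obtain ⟨c, hc⟩ := hodd
        rw [← hI1, hc, show (2 * c + 1) / 2 = c by omega]
        ring
      · rw [if_neg (by rw [val_oddE_pos]; exact hodd)]
        simp [run_skip, Mem.store_apply]
        refine ⟨?_, hd⟩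
        obtain ⟨c, hc⟩ := Int.not_odd_iff_even.1 hodd
        rw [← hI1, hc, show (c + c) / 2 = c by omega]
        ring
  rw [Int.ediv_eq_zero_of_lt h0 h2] at key
  rw [key.2, mul_zero, add_zero] at key
  rw [run_write, Mem.store_self]
  simp [hf₂ cBit (by decide), hf₁ cBit (by decide), hj, key.1, hf₂ aWeight (by decide),
    hf₁ aWeight (by decide)]

/-- The factor `i` of the weight `j`, as read from the input `f`. -/
def factor (f : ℤ → ℤ) (c m n : ℤ) (j i : ℕ) : ℤ :=
  if i = j then f (c + m + i) else f (c + m + n + i)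

theorem run_factorCmd {S i j : ℕ} {M : Mem} (hi : M cVar 0 = i) (hj : M cBit 0 = j) :
    factorCmd.run S M aBits 0 = factor (M aIn) (M aPtr 0) (M aM 0) (M aN 0) j i := by
  rw [factorCmd, run_seq, ifEq, run_ite, run_ite, run_write, run_write]
  unfold factor
  rcases lt_trichotomy i j with h | h | h
  · rw [if_neg (by simp [Mem.store_apply, hi, hj]; omega),
      if_pos (by simp [Mem.store_apply, hi, hj]; omega), if_neg (by omega)]
    simp [run_skip, hi]
  · rw [if_neg (by simp [Mem.store_apply, hi, hj]; omega),
      if_neg (by simp [Mem.store_apply, hi, hj]; omega), if_pos h]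
    simp [Mem.store_apply, hi]
  · rw [if_pos (by simp [Mem.store_apply, hi, hj]; omega), if_neg (by omega)]
    simp [run_skip, hi]

theorem run_weightCmd {S n : ℕ} {M : Mem} (hn : M aN 0 = n) (hnS : n ≤ S)
    (hW : ∀ u, M aWeight u = 0)
    (hfac : ∀ j i : ℕ, j < n → i < n → 0 ≤ factor (M aIn) (M aPtr 0) (M aM 0) n j i ∧
      factor (M aIn) (M aPtr 0) (M aM 0) n j i < 2 ^ S) :
    (∀ j : ℕ, j < n → weightCmd.run S M aWeight (j + 1) =
      ∏ i ∈ Finset.range n, factor (M aIn) (M aPtr 0) (M aM 0) n j i) ∧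
    ∀ u : ℤ, (u ≤ 0 ∨ (n : ℤ) < u) → weightCmd.run S M aWeight u = 0 := by
  have := run_rep_induction (S := S) (a := cBit)
    (c := .ite (var aN - var cBit) (.write aWeight (var cBit + 1) 1 ;;
      .rep cVar (.ite (var aN - var cVar) (factorCmd ;; mulCmd) .skip)) .skip)
    (M := M) (I := fun k N => (∀ j : ℕ, j < min k n → N aWeight (j + 1) =
        ∏ i ∈ Finset.range n, factor (M aIn) (M aPtr 0) (M aM 0) n j i) ∧
      ∀ u : ℤ, (u ≤ 0 ∨ ((min k n : ℕ) : ℤ) < u) → N aWeight u = 0) ?_ ?_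
  · rwa [min_eq_right hnS] at this
  · simp [Mem.store_apply, hW]
  · intro k hk N hNf hNk ⟨hI1, hI2⟩
    simp only [Mem.store_apply, show ¬ (aWeight = cBit) by decide, if_false]
    rw [run_ite]
    have hnN : N aN 0 = n := by rw [hNf aN (by decide), hn]
    by_cases hkn : k < n
    swap
    · rw [if_neg (by simp [hNk, hnN]; omega), run_skip]
      rw [min_eq_right (by omega)] at hI1 hI2 ⊢
      exact ⟨hI1, hI2⟩
    rw [if_pos (by simp [hNk, hnN]; omega), run_seq]
    rw [min_eq_left hkn.le] at hI1 hI2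
    rw [min_eq_left (show k + 1 ≤ n by omega)]
    have hN₁f := run_frame_of_subset S (.write aWeight (var cBit + 1) 1) [aWeight] (by decide) N
    have hN₁W : (Cmd.write aWeight (var cBit + 1) 1).run S N aWeight =
        Function.update (N aWeight) (k + 1) 1 := by simp [run_write, hNk]
    generalize (Cmd.write aWeight (var cBit + 1) 1).run S N = N₁ at *
    have hin := run_rep_induction (S := S) (a := cVar)
      (c := .ite (var aN - var cVar) (factorCmd ;; mulCmd) .skip)
      (M := N₁) (I := fun t L => L aWeight = Function.update (N aWeight) (k + 1)
        (∏ i ∈ Finset.range (min t n), factor (M aIn) (M aPtr 0) (M aM 0) n k i)) ?_ ?_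
    · rw [min_eq_right hnS] at hin
      rw [hin]
      refine ⟨fun j hj => ?_, fun u hu => ?_⟩
      · rcases Nat.lt_succ_iff_lt_or_eq.1 hj with hj | rfl
        · rw [Function.update_of_ne (by omega)]
          exact hI1 j hj
        · simp
      · push_cast at hu
        rw [Function.update_of_ne (by omega)]
        exact hI2 u (by omega)
    · simp [Mem.store_apply, hN₁W]
    · intro t ht L hLf hLt hI
      have hLf' : ∀ b ∉ [cVar, aBits, aAcc, aMul, cMap, aWeight, cBit], L b = M b := fun b hb => by
        rw [hLf b (notMem_of_subset hb (by decide)), hN₁f b (notMem_of_subset hb (by decide)),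
          hNf b (notMem_of_subset hb (by decide))]
      simp only [Mem.store_apply, show ¬ (aWeight = cVar) by decide, if_false]
      rw [run_ite]
      have hnL : L aN 0 = n := by rw [hLf' aN (by decide), hn]
      by_cases htn : t < n
      swap
      · rw [if_neg (by simp [hLt, hnL]; omega), run_skip]
        rw [min_eq_right (by omega)] at hI ⊢
        exact hI
      rw [if_pos (by simp [hLt, hnL]; omega), run_seq]
      rw [min_eq_left htn.le] at hI
      rw [min_eq_left (show t + 1 ≤ n by omega)]
      have hLk : L cBit 0 = k := by
        rw [hLf cBit (by decide), hN₁f cBit (by decide), hNk]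
      have hbits := run_factorCmd (S := S) hLt hLk
      have hFf := run_frame_of_subset S factorCmd [aBits] (by decide) L
      rw [hnL, hLf' aIn (by decide), hLf' aPtr (by decide), hLf' aM (by decide)] at hbits
      obtain ⟨hf0, hf2⟩ := hfac k t hkn htn
      rw [run_mulCmd (j := k) (by rw [hFf _ (by decide), hLk]) (by rw [hbits]; exact hf0)
        (by rw [hbits]; exact hf2), hFf aWeight (by decide), hbits, hI, Finset.prod_range_succ]
      simp

/-! ## The network of an instance -/

/-- The arcs represent the constraints of `I`. -/
structure Represents (I : UTVPIProblem) (S : ℕ) (T H C : ℤ → ℤ) : Prop where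
  net : Net S I.n T H
  symm : SymmetricNet S T H C
  nonneg : HasNonnegArcs S I.n T H C
  cost_eq_zero : ∀ u, ¬ (0 ≤ u ∧ u < (S : ℤ)) → C u = 0
  iff_feasible : ∀ x : ℤ → ℤ,
    Potential S T H C (oddExt x) ↔ I.Feasible fun j : Fin I.n => x ((j : ℤ) + 1)

/-- The two arcs of a row are mirror images and say the same on odd potentials. The arc of `0 ≤ x j`
is its own mirror image and reads `0 ≤ 2 * x j`. Indices beyond `2 * m + n` are harmless loops at
node `0` with cost zero. -/
theorem represents {I : UTVPIProblem} {S : ℕ} {f T H C T' H' : ℤ → ℤ} (hf : Encodes I f)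
    (hS : 2 * I.n + 1 < S) (hS' : 2 * I.m + I.n ≤ S) (hrow : RowArcs f I.n I.m T H)
    (hC : ∀ r : ℕ, r < I.m → C (r + r) = f (2 + (I.m : ℤ) * I.n + r) ∧
      C (r + r + 1) = f (2 + (I.m : ℤ) * I.n + r))
    (hC0 : ∀ k : ℤ, (k < 0 ∨ 2 * (I.m : ℤ) ≤ k) → C k = 0)
    (hnn : ∀ j : ℕ, j < I.n → T' (I.m + I.m + j) = j + 1 ∧ H' (I.m + I.m + j) = -(j + 1))
    (hTH : ∀ k : ℤ, (k < I.m + I.m ∨ (I.m : ℤ) + I.m + I.n ≤ k) → T' k = T k ∧ H' k = H k) :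
    Represents I S T' H' C := by
  obtain ⟨hr1, hr2⟩ := hrow
  have hcase : ∀ k : ℕ, (∃ r : ℕ, r < I.m ∧ ((k : ℤ) = r + r ∨ (k : ℤ) = r + r + 1)) ∨
      (∃ j : ℕ, j < I.n ∧ (k : ℤ) = I.m + I.m + j) ∨
      (T' k = 0 ∧ H' k = 0 ∧ C k = 0) := by
    intro k
    by_cases h1 : k < 2 * I.m
    · exact Or.inl ⟨k / 2, by omega, by omega⟩
    · by_cases h2 : k < 2 * I.m + I.n
      · exact Or.inr (Or.inl ⟨k - 2 * I.m, by omega, by omega⟩)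
      · refine Or.inr (Or.inr ?_)
        have h3 := hTH k (by omega)
        have h4 := hr2 k (by omega)
        exact ⟨h3.1.trans h4.1, h3.2.trans h4.2, hC0 k (by omega)⟩
  have hrowarc : ∀ r : ℕ, r < I.m → ∃ u v,
      literals (fun j => f (2 + (r : ℤ) * I.n + j)) I.n = (u, v) ∧
      T' (r + r) = u ∧ H' (r + r) = -v ∧ T' (r + r + 1) = v ∧ H' (r + r + 1) = -u := by
    intro r hr
    obtain ⟨u, v, h0, h1, h2, h3, h4⟩ := hr1 r hr
    have a1 := hTH (r + r) (by omega)
    have a2 := hTH (r + r + 1) (by omega)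
    exact ⟨u, v, h0, a1.1.trans h1, a1.2.trans h2, a2.1.trans h3, a2.2.trans h4⟩
  have hsum : ∀ (i : Fin I.m) (x : ℤ → ℤ) (u v : ℤ),
      literals (fun j => f (2 + ((i : ℕ) : ℤ) * I.n + j)) I.n = (u, v) →
      ∑ j, I.A i j * x ((j : ℤ) + 1) = oddExt x u + oddExt x v := by
    intro i x u v huv
    have hA : ∀ j : Fin I.n, f (2 + ((i : ℕ) : ℤ) * I.n + ((j : ℕ) : ℤ)) = I.A i j :=
      fun j => hf.matrix i j
    have hcard : ((Finset.range I.n).filter fun j : ℕ =>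
        f (2 + ((i : ℕ) : ℤ) * I.n + j) ≠ 0).card ≤ 2 := by
      refine le_trans ?_ (I.A_row i)
      refine (Finset.card_le_card (t := (Finset.univ.filter fun j => I.A i j ≠ 0).image
        fun j : Fin I.n => (j : ℕ)) ?_).trans Finset.card_image_le
      intro j hj
      simp only [Finset.mem_filter, Finset.mem_range] at hj
      simp only [Finset.mem_image, Finset.mem_filter, Finset.mem_univ, true_and]
      exact ⟨⟨j, hj.1⟩, by rw [← hA]; exact hj.2, rfl⟩
    have := (sum_eq_literals (a := fun j : ℕ => f (2 + ((i : ℕ) : ℤ) * I.n + j)) (n := I.n)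
      (fun j hj => by have := hA ⟨j, hj⟩; simp only at this ⊢; rw [this]; exact I.A_mem _ _)
      x I.n le_rfl).1 hcard
    rw [huv] at this
    rw [← this, Finset.sum_range]
    exact Finset.sum_congr rfl fun j _ => by rw [hA]
  have hmem : ∀ r : ℕ, r < I.m → ∀ u v,
      literals (fun j => f (2 + (r : ℤ) * I.n + j)) I.n = (u, v) →
      u ∈ nodes I.n ∧ v ∈ nodes I.n := by
    intro r _ u v huv
    have := literals_mem (fun j => f (2 + (r : ℤ) * I.n + j)) I.n
    rwa [huv] at this
  have hnode : ∀ k : ℕ, T' k ∈ nodes I.n ∧ H' k ∈ nodes I.n := by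
    intro k
    rcases hcase k with ⟨r, hr, h⟩ | ⟨j, hj, h⟩ | ⟨h1, h2, -⟩
    · obtain ⟨u, v, h0, h1, h2, h3, h4⟩ := hrowarc r hr
      obtain ⟨hu, hv⟩ := hmem r hr u v h0
      rcases h with h | h <;> rw [h]
      · rw [h1, h2]; exact ⟨hu, neg_mem_nodes hv⟩
      · rw [h3, h4]; exact ⟨hv, neg_mem_nodes hu⟩
    · rw [h, (hnn j hj).1, (hnn j hj).2, mem_nodes, mem_nodes]; omega
    · rw [h1, h2, mem_nodes]; omega
  refine ⟨⟨hS, fun k _ => (hnode k).1, fun k _ => (hnode k).2⟩, ?_, ?_, ?_, ?_⟩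
  · intro k hk
    rcases hcase k with ⟨r, hr, h⟩ | ⟨j, hj, h⟩ | ⟨h1, h2, h3⟩
    · obtain ⟨u, v, h0, h1, h2, h3, h4⟩ := hrowarc r hr
      rcases h with h | h
      · refine ⟨r + r + 1, by omega, ?_⟩
        rw [h]
        push_cast
        rw [h1, h2, h3, h4, (hC r hr).1, (hC r hr).2]
        simp
      · refine ⟨r + r, by omega, ?_⟩
        rw [h]
        push_cast
        rw [h1, h2, h3, h4, (hC r hr).1, (hC r hr).2]
        simp
    · exact ⟨k, hk, by rw [h, (hnn j hj).1, (hnn j hj).2, neg_neg], by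
        rw [h, (hnn j hj).1, (hnn j hj).2], rfl⟩
    · exact ⟨k, hk, by simp [h1, h2], by simp [h1, h2], rfl⟩
  · intro j hj
    refine ⟨I.m + I.m + j, by omega, ?_⟩
    push_cast
    exact ⟨(hnn j hj).1, (hnn j hj).2, hC0 _ (by omega)⟩
  · intro u hu
    exact hC0 u (by omega)
  · intro x
    constructor
    · intro hp
      refine ⟨fun i => ?_, fun j => ?_⟩
      · obtain ⟨u, v, h0, h1, h2, -, -⟩ := hrowarc i i.2
        have := hp (i + i) (by omega)
        push_cast at this
        rw [h1, h2, (hC i i.2).1, hf.rhs i, oddExt_neg, sub_neg_eq_add, ← hsum i x u v h0] at this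
        exact this
      · have := hp (I.m + I.m + j) (by omega)
        push_cast at this
        rw [(hnn j j.2).1, (hnn j j.2).2, hC0 _ (by omega), oddExt_neg,
          oddExt_of_pos _ (by omega)] at this
        change 0 ≤ x (j + 1)
        omega
    · rintro ⟨hA, hx⟩ k hk
      rcases hcase k with ⟨r, hr, h⟩ | ⟨j, hj, h⟩ | ⟨h1, h2, h3⟩
      · obtain ⟨u, v, h0, h1, h2, h3, h4⟩ := hrowarc r hr
        have h5 := hA ⟨r, hr⟩
        rw [hsum ⟨r, hr⟩ x u v h0, ← hf.rhs ⟨r, hr⟩] at h5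
        simp only at h5
        rcases h with h | h <;> rw [h]
        · rw [h1, h2, oddExt_neg, (hC r hr).1]; linarith
        · rw [h3, h4, oddExt_neg, (hC r hr).2]; linarith
      · have := hx ⟨j, hj⟩
        simp only at this
        rw [h, (hnn j hj).1, (hnn j hj).2, hC0 _ (by omega), oddExt_neg,
          oddExt_of_pos _ (by omega)]
        omega
      · rw [h1, h2, h3, sub_self]

end UTVPI

namespace RAM

/-! ## Computing the size of the input -/

/-- A step of the computation of the size of the input: array `16` counts, array `5` holds the
position in the input, and array `6` the number whose bits are being counted. -/
def countCmd : Cmd :=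
  .ite (var 6) (.seq (.write 6 0 (var 6 / 2)) (.write 16 0 (var 16 + 1)))
    (.seq (.write 5 0 (var 5 + 1)) (.seq (.write 6 0 (.read 0 (var 5)))
      (.seq (.ite (0 - var 6) (.write 6 0 (0 - var 6)) .skip) (.write 16 0 (var 16 + 1)))))

/-- Compute the size of the input plus one, in array `4`. -/
def sizeProgram : Program :=
  .seq (.write 5 0 (0 - 1)) (.seq (.loop (var 1 - var 5) countCmd.toProgram) (.write 4 0 (var 16)))

/-- The memory in the computation of the size of the input. -/
def sizeMem (l : List ℤ) (s i t : ℤ) : Mem := fun a x =>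
  if a = 16 ∧ x = 0 then s else if a = 5 ∧ x = 0 then i else if a = 6 ∧ x = 0 then t
  else initMem l a x

theorem initMem_zero (l : List ℤ) (k : ℕ) : initMem l 0 k = l.getD k 0 := by
  simp [initMem]

theorem sizeMem_store_count (l : List ℤ) (s i t v : ℤ) :
    (sizeMem l s i t).store 16 0 v = sizeMem l v i t := by
  funext a x; simp only [Mem.store, sizeMem]; split_ifs <;> rfl

theorem sizeMem_store_pos (l : List ℤ) (s i t v : ℤ) :
    (sizeMem l s i t).store 5 0 v = sizeMem l s v t := by
  funext a x; simp only [Mem.store, sizeMem]; split_ifs <;> first | rfl | omega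

theorem sizeMem_store_num (l : List ℤ) (s i t v : ℤ) :
    (sizeMem l s i t).store 6 0 v = sizeMem l s i v := by
  funext a x; simp only [Mem.store, sizeMem]; split_ifs <;> first | rfl | omega

theorem sizeMem_count (l : List ℤ) (s i t : ℤ) : sizeMem l s i t 16 0 = s := by simp [sizeMem]
theorem sizeMem_pos (l : List ℤ) (s i t : ℤ) : sizeMem l s i t 5 0 = i := by simp [sizeMem]
theorem sizeMem_num (l : List ℤ) (s i t : ℤ) : sizeMem l s i t 6 0 = t := by simp [sizeMem]

theorem sizeMem_input (l : List ℤ) (s i t : ℤ) (k : ℕ) : sizeMem l s i t 0 k = l.getD k 0 := by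
  simp [sizeMem, initMem_zero]

theorem sizeMem_length (l : List ℤ) (s i t : ℤ) : sizeMem l s i t 1 0 = l.length := by
  simp [sizeMem, initMem]

theorem run_countCmd_of_pos (l : List ℤ) (s i : ℤ) {t : ℤ} (ht : 0 < t) :
    countCmd.run 0 (sizeMem l s i t) = sizeMem l (s + 1) i (t / 2) := by
  simp [countCmd, Cmd.run_ite, Cmd.run_seq, Cmd.run_write, sizeMem_num, ht, sizeMem_store_num,
    sizeMem_store_count, sizeMem_count]

theorem run_countCmd_zero (l : List ℤ) (s : ℤ) (k : ℕ) :
    countCmd.run 0 (sizeMem l s ((k : ℤ) - 1) 0) = sizeMem l (s + 1) k |l.getD k 0| := by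
  have h : countCmd.run 0 (sizeMem l s ((k : ℤ) - 1) 0) =
      (Cmd.write 16 0 (var 16 + 1)).run 0 ((Cmd.ite (0 - var 6) (.write 6 0 (0 - var 6)) .skip).run 0
        (sizeMem l s k (l.getD k 0))) := by
    simp [countCmd, Cmd.run_ite, Cmd.run_seq, Cmd.run_write, sizeMem_num, sizeMem_store_num,
      sizeMem_store_pos, sizeMem_pos, sizeMem_input]
  rw [h, Cmd.run_ite]
  generalize l.getD k 0 = y
  simp only [val_sub, val_zero, val_var, sizeMem_num, zero_sub, Left.neg_pos_iff]
  split_ifs with hneg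
  · simp [Cmd.run_write, sizeMem_store_num, sizeMem_store_count, sizeMem_count, sizeMem_num,
      abs_of_neg hneg]
  · simp [Cmd.run_skip, Cmd.run_write, sizeMem_store_count, sizeMem_count,
      abs_of_nonneg (not_lt.1 hneg)]

theorem natAbs_le_of_mem {l : List ℤ} {x : ℤ} (hx : x ∈ l) : x.natAbs ≤ 2 ^ inputSize l := by
  have h1 : bitLength x ≤ inputSize l :=
    List.single_le_sum (by simp) _ (List.mem_map_of_mem hx)
  calc x.natAbs ≤ 2 ^ Nat.size x.natAbs := (Nat.lt_size_self _).le
    _ ≤ _ := Nat.pow_le_pow_right (by norm_num) (by unfold bitLength at h1; omega)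

theorem natAbs_getD_le (l : List ℤ) (k : ℕ) : (l.getD k 0).natAbs ≤ 2 ^ inputSize l := by
  by_cases h : k < l.length
  · rw [List.getD_eq_getElem _ _ h]
    exact natAbs_le_of_mem (List.getElem_mem h)
  · rw [List.getD_eq_default _ _ (not_lt.1 h)]; simp

theorem length_le_inputSize (l : List ℤ) : l.length ≤ inputSize l := by
  unfold inputSize
  induction l with
  | nil => simp
  | cons x l ih => simp only [List.map_cons, List.sum_cons, List.length_cons, bitLength]; omega

theorem natAbs_initMem_le (l : List ℤ) (a : ℕ) (x : ℤ) :
    (initMem l a x).natAbs ≤ 2 ^ inputSize l := by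
  unfold initMem
  split_ifs
  · exact natAbs_getD_le l _
  · rw [Int.natAbs_natCast]
    exact (length_le_inputSize l).trans Nat.lt_two_pow_self.le
  · simp

theorem natAbs_sizeMem_le {l : List ℤ} {s i t : ℤ} (hs : s.natAbs ≤ 2 ^ (inputSize l + 1))
    (hi : i.natAbs ≤ 2 ^ (inputSize l + 1)) (ht : t.natAbs ≤ 2 ^ (inputSize l + 1)) (a : ℕ) (x : ℤ) :
    (sizeMem l s i t a x).natAbs ≤ 2 ^ (inputSize l + 1) := by
  unfold sizeMem
  split_ifs
  · exact hs
  · exact hi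
  · exact ht
  · exact (natAbs_initMem_le l a x).trans (Nat.pow_le_pow_right (by norm_num) (by omega))

theorem size_div_two {t : ℕ} (ht : 0 < t) : Nat.size t = Nat.size (t / 2) + 1 := by
  conv_lhs => rw [← Nat.bit_bodd_div2 t]
  rw [Nat.size_bit (by rw [Nat.bit_bodd_div2]; omega), Nat.div2_val]

/-- `μ` counts the remaining iterations: one per bit of the current number, one per bit of each
later entry and one for moving to it, and a last one for moving past the end. Cell `0` of array `4`
is still zero here, so costs are evaluated at bound `0`. -/
theorem exec_count_loop : ∃ q : ℕ, ∀ (l : List ℤ) (μ k t s : ℕ), k ≤ l.length →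
    μ = Nat.size t + inputSize (l.drop k) + 1 → s + μ ≤ inputSize l + 1 →
    t ≤ 2 ^ (inputSize l + 1) →
    ∃ T ≤ (μ + 1) * (q * (inputSize l + 2)),
      Exec (.loop (var 1 - var 5) countCmd.toProgram) (sizeMem l s ((k : ℤ) - 1) t) T
        (sizeMem l ((s + μ : ℕ) : ℤ) l.length 0) := by
  have hwf : countCmd.WF := by
    unfold countCmd
    repeat' first | exact trivial | rfl | decide | apply And.intro
  obtain ⟨G, Q, hexec⟩ := Cmd.exec_run countCmd hwf
  let e : Expr := var 1 - var 5
  have he : e.Tame := ⟨trivial, trivial⟩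
  let w := e.weight
  refine ⟨Q.eval 0 + w * (w + 3) + 1, fun l μ => ?_⟩
  set B := inputSize l + 1 with hB
  have hcost : ∀ M : Mem, M 4 0 = 0 → (∀ a x, (M a x).natAbs ≤ 2 ^ B) →
      e.cost M + 1 ≤ (w * (w + 3) + 1) * (B + 1) := by
    intro M h4 hM
    have := cost_le (S := 0) h4 hM e he
    have h2 : w * (B + w * (0 + 1) + 2) ≤ w * ((w + 3) * (B + 1)) := by
      gcongr; nlinarith [Nat.zero_le (w * B)]
    have h3 : e.cost M ≤ w * ((w + 3) * (B + 1)) := this.trans h2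
    nlinarith
  have h4 : ∀ s i t, sizeMem l s i t 4 0 = 0 := fun s i t => by simp [sizeMem, initMem]
  have hlen : l.length ≤ 2 ^ B := (length_le_inputSize l).trans
    (le_trans (by omega) (Nat.lt_two_pow_self (n := B)).le)
  induction μ with
  | zero => intro k t s _ h; omega
  | succ μ ih =>
    intro k t s hk hμ hs ht
    have hmem : ∀ a x, (sizeMem l s ((k : ℤ) - 1) t a x).natAbs ≤ 2 ^ B := by
      refine natAbs_sizeMem_le ?_ ?_ ?_
      · rw [Int.natAbs_natCast]
        exact le_trans (by omega) (Nat.lt_two_pow_self (n := B)).le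
      · have h1 : 1 ≤ 2 ^ B := Nat.one_le_two_pow
        have : k ≤ 2 ^ B := hk.trans hlen
        change ((k : ℤ) - 1).natAbs ≤ 2 ^ B
        omega
      · rw [Int.natAbs_natCast]; exact ht
    have hpos : 0 < e.val (sizeMem l s ((k : ℤ) - 1) t) := by
      simp only [e, val_sub, val_var, sizeMem_length, sizeMem_pos]; omega
    obtain ⟨-, T₁, hT₁, hE₁⟩ := hexec 0 B _ (h4 _ _ _) hmem
    have hc := hcost _ (h4 s ((k : ℤ) - 1) t) hmem
    suffices ∃ T ≤ (μ + 1) * ((Q.eval 0 + w * (w + 3) + 1) * (B + 1)),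
        Exec (.loop e countCmd.toProgram) (countCmd.run 0 (sizeMem l s ((k : ℤ) - 1) t)) T
          (sizeMem l ((s + (μ + 1) : ℕ) : ℤ) l.length 0) by
      obtain ⟨T, hT, hE⟩ := this
      refine ⟨e.cost (sizeMem l s ((k : ℤ) - 1) t) + 1 + T₁ + T, ?_, Exec.loop_pos hpos hE₁ hE⟩
      rw [show inputSize l + 2 = B + 1 by omega]
      nlinarith
    rcases Nat.eq_zero_or_pos t with rfl | htpos
    · rw [Nat.cast_zero, run_countCmd_zero]
      rcases hk.eq_or_lt with rfl | hk
      · have h0 : μ = 0 := by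
          simp [inputSize] at hμ; omega
        subst h0
        rw [List.getD_eq_default _ _ le_rfl, abs_zero,
          show ((s + (0 + 1) : ℕ) : ℤ) = (s : ℤ) + 1 by push_cast; ring]
        refine ⟨e.cost (sizeMem l ((s : ℤ) + 1) l.length 0) + 1, ?_, Exec.loop_nonpos ?_⟩
        · refine (hcost _ (h4 _ _ _) (natAbs_sizeMem_le ?_ ?_ ?_)).trans ?_
          · have : s + 1 ≤ 2 ^ B := le_trans (by omega) (Nat.lt_two_pow_self (n := B)).le
            change ((s : ℤ) + 1).natAbs ≤ 2 ^ B
            omega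
          · rw [Int.natAbs_natCast]; exact hlen
          · simp
          · rw [zero_add, one_mul]; gcongr; omega
        · simp [e, sizeMem_length, sizeMem_pos]
      · have hdrop : l.drop k = l.getD k 0 :: l.drop (k + 1) := by
          rw [List.getD_eq_getElem _ _ hk]; exact List.drop_eq_getElem_cons hk
        have hsz : inputSize (l.drop k) = bitLength (l.getD k 0) + inputSize (l.drop (k + 1)) := by
          rw [hdrop]; simp [inputSize]
        have hthis := ih (k + 1) (l.getD k 0).natAbs (s + 1) hk
          (by rw [hsz] at hμ; simp only [Nat.size_zero, bitLength] at hμ; omega) (by omega)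
          ((natAbs_getD_le l k).trans (Nat.pow_le_pow_right (by norm_num) (by omega)))
        rw [show inputSize l + 2 = B + 1 by omega] at hthis
        have e1 : ((k + 1 : ℕ) : ℤ) - 1 = k := by push_cast; ring
        have e2 : s + 1 + μ = s + (μ + 1) := by ring
        rw [e1, e2, Int.natCast_natAbs] at hthis
        push_cast at hthis ⊢
        exact hthis
    · rw [run_countCmd_of_pos _ _ _ (by exact_mod_cast htpos)]
      have hthis := ih k (t / 2) (s + 1) hk (by rw [size_div_two htpos] at hμ; omega) (by omega)
        ((Nat.div_le_self _ _).trans ht)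
      rw [show inputSize l + 2 = B + 1 by omega] at hthis
      have e2 : s + 1 + μ = s + (μ + 1) := by ring
      rw [e2] at hthis
      push_cast at hthis ⊢
      exact hthis

/-- The program computes the size of the input in polynomial time. -/
theorem exec_sizeProgram : ∃ q : Polynomial ℕ, ∀ l : List ℤ, ∃ (M : Mem) (T : ℕ),
    T ≤ q.eval (inputSize l) ∧ Exec sizeProgram (initMem l) T M ∧
    M 4 0 = ((inputSize l + 1 : ℕ) : ℤ) ∧ (∀ b, b ∉ [4, 5, 6, 16] → M b = initMem l b) ∧
    ∀ a x, (M a x).natAbs ≤ 2 ^ (inputSize l + 1) := by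
  obtain ⟨q, hq⟩ := exec_count_loop
  refine ⟨(Polynomial.X + 2) * (Polynomial.C q * (Polynomial.X + 2)) + (Polynomial.X + 20),
    fun l => ?_⟩
  obtain ⟨T, hT, hE⟩ := hq l (inputSize l + 1) 0 0 0 (Nat.zero_le _) (by simp) (by omega)
    (Nat.zero_le _)
  rw [zero_add] at hE
  set N := sizeMem l ((inputSize l + 1 : ℕ) : ℤ) l.length 0 with hN
  have hstart : (initMem l).store 5 0 ((0 - 1 : Expr).val (initMem l)) =
      sizeMem l ((0 : ℕ) : ℤ) (((0 : ℕ) : ℤ) - 1) ((0 : ℕ) : ℤ) := by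
    funext a x
    simp only [Mem.store, sizeMem, val_sub, val_zero, val_one, initMem]
    split_ifs <;> first | rfl | omega
  have hS : (inputSize l + 1 : ℕ) ≤ 2 ^ (inputSize l + 1) := Nat.lt_two_pow_self.le
  refine ⟨N.store 4 0 ((var 16).val N), _, ?_,
    Exec.seq (Exec.write _ 5 0 (0 - 1)) (Exec.seq (hstart ▸ hE) (Exec.write N 4 0 (var 16))),
    ?_, ?_, ?_⟩
  · have h1 : (0 : Expr).cost (initMem l) + (0 - 1 : Expr).cost (initMem l) + 1 = 7 := by
      change bitLength 0 + (bitLength 0 + bitLength 1 + bitLength (0 - 1)) + 1 = 7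
      simp [bitLength]
    have h2 : (0 : Expr).cost N + (var 16).cost N + 1 ≤ inputSize l + 13 := by
      have hb : bitLength (N 16 0) ≤ inputSize l + 1 + 2 := by
        refine bitLength_le ?_
        rw [hN, sizeMem_count, Int.natAbs_natCast]
        exact hS
      have : (var 16).cost N = 1 + bitLength (N 16 0) := rfl
      have h0 : (0 : Expr).cost N = 1 := rfl
      omega
    rw [h1]
    simp only [Polynomial.eval_add, Polynomial.eval_mul, Polynomial.eval_C, Polynomial.eval_X,
      Polynomial.eval_ofNat]
    have : inputSize l + 1 + 1 = inputSize l + 2 := by ring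
    rw [this] at hT
    omega
  · rw [Mem.store_self, Function.update_self, val_var, hN, sizeMem_count]
  · intro b hb
    simp only [List.mem_cons, List.not_mem_nil, not_or] at hb
    rw [Mem.store_ne _ hb.1, hN]
    funext x
    simp [sizeMem, hb]
  · refine Cmd.natAbs_store_le (natAbs_sizeMem_le ?_ ?_ ?_) ?_ 4 0
    · rw [Int.natAbs_natCast]; exact hS
    · rw [Int.natAbs_natCast]
      exact (length_le_inputSize l).trans (le_trans (by omega) hS)
    · simp
    · rw [val_var, hN, sizeMem_count, Int.natAbs_natCast]; exact hS

end RAM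

namespace UTVPI

open RAM RAM.Cmd

/-! ## The encoding of an instance -/

theorem getD_append_ofFn {l : List ℤ} {n k : ℕ} (g : Fin n → ℤ) (hl : l.length = k) (r : List ℤ)
    (j : Fin n) : (l ++ List.ofFn g ++ r).getD (k + j) 0 = g j := by
  rw [List.getD_append _ _ _ _ (by simp [hl]), List.getD_append_right _ _ _ _ (by omega), hl,
    Nat.add_sub_cancel_left, List.getD_eq_getElem _ _ (by simp)]
  simp

theorem flatten_ofFn {m n : ℕ} (A : Matrix (Fin m) (Fin n) ℤ) :
    (List.ofFn fun i => List.ofFn (A i)).flatten =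
      List.ofFn fun k : Fin (m * n) => A k.divNat k.modNat := by
  rw [List.ofFn_mul]
  congr 2
  funext i
  congr 1
  funext j
  have hn : 0 < n := j.pos
  congr 1
  · ext; simp [Fin.divNat, Nat.add_div_of_dvd_right, hn]
  · ext; simp [Fin.modNat, Nat.mod_eq_of_lt j.2]

theorem encodes_encode (I : UTVPIProblem) : Encodes I (initMem I.encode 0) := by
  have hcast : ∀ k : ℕ, initMem I.encode 0 (k : ℤ) = I.encode.getD k 0 := initMem_zero _
  have he : I.encode = [(I.m : ℤ), (I.n : ℤ)] ++
      (List.ofFn fun k : Fin (I.m * I.n) => I.A k.divNat k.modNat) ++ List.ofFn I.b ++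
      (List.ofFn fun j => (I.w j).num) ++ List.ofFn fun j => ((I.w j).den : ℤ) := by
    rw [UTVPIProblem.encode, flatten_ofFn]
  refine ⟨?_, ?_, fun i j => ?_, fun i => ?_, fun j => ?_, fun j => ?_⟩
  · have := hcast 0
    simpa [UTVPIProblem.encode] using this
  · have := hcast 1
    simpa [UTVPIProblem.encode] using this
  · have hlt : (i : ℕ) * I.n + j < I.m * I.n := by
      have h1 : (i + 1) * I.n ≤ I.m * I.n := Nat.mul_le_mul_right _ i.2
      have h2 : ((i : ℕ) + 1) * I.n = i * I.n + I.n := by ring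
      omega
    have := hcast (2 + (i * I.n + j))
    push_cast at this
    rw [add_assoc, this, he, List.append_assoc, List.append_assoc,
      getD_append_ofFn (k := 2) _ rfl _ ⟨i * I.n + j, hlt⟩]
    congr 1
    · ext; simp [Nat.add_div_of_dvd_right, I.n_pos]
    · ext; simp [Nat.mod_eq_of_lt j.2]
  · have := hcast (2 + I.m * I.n + i)
    push_cast at this
    rw [this, he, List.append_assoc, getD_append_ofFn _ (by simp; omega)]
  · have := hcast (2 + I.m * I.n + I.m + j)
    push_cast at this
    rw [this, he, getD_append_ofFn _ (by simp; omega)]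
  · have := hcast (2 + I.m * I.n + I.m + I.n + j)
    push_cast at this
    rw [this, he, ← List.append_nil (_ ++ List.ofFn fun j => ((I.w j).den : ℤ)),
      getD_append_ofFn _ (by simp; omega)]

theorem length_encode (I : UTVPIProblem) :
    I.encode.length = 2 + I.m * I.n + I.m + I.n + I.n := by
  rw [UTVPIProblem.encode, flatten_ofFn]
  simp
  omega

theorem sum_bitLength_le (I : UTVPIProblem) :
    ∑ j, (bitLength (I.w j).num + bitLength (I.w j).den) ≤ inputSize I.encode := by
  rw [Finset.sum_add_distrib]
  simp only [inputSize, UTVPIProblem.encode, List.map_append, List.sum_append, List.map_ofFn,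
    List.sum_ofFn, Function.comp_def]
  omega

theorem factor_eq {I : UTVPIProblem} {f : ℤ → ℤ} (hf : Encodes I f) (j i : Fin I.n) :
    factor f (2 + (I.m : ℤ) * I.n) I.m I.n j i = if i = j then (I.w i).num else (I.w i).den := by
  unfold factor
  rw [hf.num i, hf.den i]
  simp only [Fin.ext_iff]

/-- The common multiplier is the product of all denominators, so no division is needed: the
numerator replaces one denominator. -/
theorem prod_factor {I : UTVPIProblem} {f : ℤ → ℤ} (hf : Encodes I f) (j : Fin I.n) :
    ((∏ i ∈ Finset.range I.n, factor f (2 + (I.m : ℤ) * I.n) I.m I.n j i : ℤ) : ℚ) =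
      I.w j * ∏ i, ((I.w i).den : ℚ) := by
  rw [Finset.prod_range]
  simp only [factor_eq hf]
  push_cast
  have : ∀ i, ((if i = j then ((I.w i).num : ℚ) else ((I.w i).den : ℚ))) =
      (if i = j then I.w i else 1) * (I.w i).den := by
    intro i
    split_ifs
    · exact (Rat.mul_den_eq_num _).symm
    · rw [one_mul]
  simp only [this, Finset.prod_mul_distrib, Finset.prod_ite_eq', Finset.mem_univ, if_true]

theorem factor_nonneg {I : UTVPIProblem} {f : ℤ → ℤ} (hf : Encodes I f) (j i : Fin I.n) :
    0 ≤ factor f (2 + (I.m : ℤ) * I.n) I.m I.n j i := by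
  rw [factor_eq hf]
  split_ifs
  · exact Rat.num_nonneg.2 (I.w_nonneg i)
  · positivity

theorem factor_lt {I : UTVPIProblem} {f : ℤ → ℤ} (hf : Encodes I f) (j i : Fin I.n) :
    factor f (2 + (I.m : ℤ) * I.n) I.m I.n j i <
      2 ^ (bitLength (I.w i).num + bitLength (I.w i).den) := by
  have key : ∀ (z : ℤ) (k : ℕ), bitLength z ≤ k → z < 2 ^ k := by
    intro z k hk
    have h1 : z.natAbs < 2 ^ k := Nat.size_le.1 (by unfold bitLength at hk; omega)
    have h2 : (z.natAbs : ℤ) < 2 ^ k := by exact_mod_cast h1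
    omega
  rw [factor_eq hf]
  split_ifs <;> exact key _ _ (by omega)

/-- All numerators and denominators are part of the input, so the bit lengths of the factors sum to
at most the input size. -/
theorem prod_factor_lt {I : UTVPIProblem} {f : ℤ → ℤ} (hf : Encodes I f) (j : Fin I.n) :
    ∏ i ∈ Finset.range I.n, factor f (2 + (I.m : ℤ) * I.n) I.m I.n j i <
      2 ^ (inputSize I.encode + 1) := by
  rw [Finset.prod_range]
  calc _ ≤ ∏ i : Fin I.n, (2 : ℤ) ^ (bitLength (I.w i).num + bitLength (I.w i).den) :=
        Finset.prod_le_prod (fun i _ => factor_nonneg hf j i) fun i _ => (factor_lt hf j i).le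
    _ = 2 ^ ∑ i, (bitLength (I.w i).num + bitLength (I.w i).den) := Finset.prod_pow_eq_pow_sum _ _ _
    _ < _ := pow_lt_pow_right₀ (by norm_num) (Nat.lt_succ_of_le (sum_bitLength_le I))

/-! ## Optimization -/

/-- The values `z`, shifted by one and extended by zero. -/
def shiftExt {n : ℕ} (z : Fin n → ℤ) (u : ℤ) : ℤ :=
  if h : (u - 1).toNat < n then z ⟨(u - 1).toNat, h⟩ else 0

theorem shiftExt_apply {n : ℕ} (z : Fin n → ℤ) (j : Fin n) : shiftExt z ((j : ℤ) + 1) = z j := by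
  simp [shiftExt]

theorem two_mul_oddExt_half {n : ℕ} {X : ℤ → ℤ} (hneg : ∀ u ∈ nodes n, X (-u) = -X u)
    (heven : ∀ j : ℕ, j < n → Even (X (j + 1))) {u : ℤ} (hu : u ∈ nodes n) :
    2 * oddExt (fun u => X u / 2) u = X u := by
  have hpos : ∀ v ∈ nodes n, 0 < v → 2 * (X v / 2) = X v := by
    intro v hv h0
    rw [mem_nodes] at hv
    have := heven (v - 1).toNat (by omega)
    rw [show (((v - 1).toNat : ℕ) : ℤ) + 1 = v by omega] at this
    exact Int.two_mul_ediv_two_of_even this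
  unfold oddExt
  split_ifs with h1 h2
  · exact hpos u hu h1
  · have h3 := hpos (-u) (neg_mem_nodes hu) (by omega)
    rw [hneg u hu] at h3
    simp only [hneg u hu]
    linarith
  · obtain rfl : u = 0 := by omega
    have := hneg 0 hu
    rw [neg_zero] at this
    omega

theorem Rounded.potential_half {S n : ℕ} {T H C X₀ X : ℤ → ℤ} (hN : Net S n T H)
    (hX : Rounded S n T H C X₀ X) (heven : ∀ j : ℕ, j < n → Even (X (j + 1))) :
    Potential S T H C (oddExt fun u => X u / 2) := by
  intro k hk
  have h1 := hX.potential k hk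
  have h2 := two_mul_oddExt_half hX.neg heven (hN.tail k hk)
  have h3 := two_mul_oddExt_half hX.neg heven (hN.head k hk)
  simp only at h1
  linarith

/-- Solve the relaxed problem, round its solution, and output. -/
def optimizeCmd : Cmd := initPotCmd ;; solveCmd ;; symmetrizeCmd ;; roundCmd ;; outputCmd

/-- The guarantees of the phases depend on a feasible `z`, so they are kept as functions of it and
combined only in `key`; the final check then separates the two cases. -/
theorem run_optimizeCmd {I : UTVPIProblem} {S : ℕ} {M : Mem} (hS : M aSize 0 = S)
    (hn : M aN 0 = I.n) (hI : Represents I S (M aTail) (M aHead) (M aCost))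
    (hF : ∀ k, M aFlow k = 0) (hP : ∀ k, M aPot k = 0)
    (hW : ∀ u, (I.n : ℤ) < u → M aWeight u = 0) (hW0 : ∀ u, 0 ≤ M aWeight u)
    (hW2 : ∀ u, M aWeight u < 2 ^ S) :
    (∃ x, I.Feasible x ∧ output (optimizeCmd.run S M) = 1 :: List.ofFn x ∧
      ∀ z, I.Feasible z → ∑ j : Fin I.n, M aWeight ((j : ℤ) + 1) * x j ≤
        2 * ∑ j : Fin I.n, M aWeight ((j : ℤ) + 1) * z j) ∨
    ((¬ ∃ x, I.Feasible x) ∧ output (optimizeCmd.run S M) = [0]) := by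
  have hN := hI.net
  rw [optimizeCmd, run_seq, run_seq, run_seq, run_seq]
  have hf₁ := run_frame_of_subset S initPotCmd
    [aSrc, aBound, aDist, aPot, cMap, cRound, cArc] (by decide) M
  have hinit := fun z => run_initPotCmd (z := z) hS hn hN hF hP
  generalize initPotCmd.run S M = M₁ at *
  have hf₂ := run_frame_of_subset S solveCmd
    [aPow, aSrc, aBound, aDist, aCur, aFlow, aPot, cMap, cRound, cArc, cVar, cBit] (by decide) M₁
  have hsolve := fun h => run_solveCmd (S := S) (n := I.n) (M := M₁)
    (by rw [hf₁ _ (by decide), hS]) (by rw [hf₁ _ (by decide), hn])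
    (by rw [hf₁ aTail (by decide), hf₁ aHead (by decide)]; exact hN)
    (by rw [hf₁ aTail (by decide), hf₁ aHead (by decide), hf₁ aCost (by decide)]; exact hI.nonneg)
    (by rw [hf₁ aFlow (by decide)]; exact hF) (by rw [hf₁ aWeight (by decide)]; exact hW)
    (by rw [hf₁ aWeight (by decide)]; exact hW0) (by rw [hf₁ aWeight (by decide)]; exact hW2) h
  rw [hf₁ aTail (by decide), hf₁ aHead (by decide), hf₁ aCost (by decide),
    hf₁ aWeight (by decide)] at hsolve
  generalize solveCmd.run S M₁ = M₂ at *
  have hg₂ : ∀ b ∉ [aPow, aSrc, aBound, aDist, aCur, aFlow, aPot, cMap, cRound, cArc, cVar, cBit],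
      M₂ b = M b := fun b hb => by rw [hf₂ b hb, hf₁ b (notMem_of_subset hb (by decide))]
  have hf₃ := run_frame_of_subset S symmetrizeCmd [aDist, aPot, aCost, aFlow, cMap, cArc]
    (by decide) M₂
  obtain ⟨hP₃, hC₃, hF₃⟩ := run_symmetrizeCmd (S := S) (n := I.n) (M := M₂)
    (by rw [hg₂ _ (by decide), hn]) hN.size (by rw [hg₂ aCost (by decide)]; exact hI.cost_eq_zero)
  rw [hg₂ aCost (by decide)] at hC₃
  generalize symmetrizeCmd.run S M₂ = M₃ at *
  have hg₃ : ∀ b ∉ [aPow, aSrc, aBound, aDist, aCur, aFlow, aPot, cMap, cRound, cArc, cVar, cBit,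
      aCost], M₃ b = M b := fun b hb => by
    rw [hf₃ b (notMem_of_subset hb (by decide)), hg₂ b (notMem_of_subset hb (by decide))]
  have hneg₃ : ∀ u ∈ nodes I.n, M₃ aPot (-u) = -M₃ aPot u := by
    intro u hu
    rw [hP₃ u hu, hP₃ _ (neg_mem_nodes hu), neg_neg]
    ring
  have hf₄ := run_frame_of_subset S roundCmd
    [aSrc, aBound, aDist, aPot, cMap, cRound, cArc, cVar] (by decide) M₃
  have hround := fun z hp hz hzneg => run_roundCmd (S := S) (n := I.n) (M := M₃) (C := M aCost)
    (z := z) (by rw [hg₃ _ (by decide), hS]) (by rw [hg₃ _ (by decide), hn])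
    (by rw [hg₃ aTail (by decide), hg₃ aHead (by decide)]; exact hN)
    (by rw [hg₃ aTail (by decide), hg₃ aHead (by decide)]; exact hI.symm)
    hC₃ hF₃ hp hneg₃ hz hzneg
  rw [hg₃ aTail (by decide), hg₃ aHead (by decide)] at hround
  generalize roundCmd.run S M₃ = M₄ at *
  have hg₄ : ∀ b ∉ [aPow, aSrc, aBound, aDist, aCur, aFlow, aPot, cMap, cRound, cArc, cVar, cBit,
      aCost], M₄ b = M b := fun b hb => by
    rw [hf₄ b (notMem_of_subset hb (by decide)), hg₃ b hb]
  have hout := run_outputCmd (S := S) (n := I.n) (M := M₄) (C := M aCost)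
    (by rw [hg₄ _ (by decide), hn])
    (by rw [hg₄ aTail (by decide), hg₄ aHead (by decide)]; exact hN)
    (by rw [hf₄ aCost (by decide), hC₃])
  rw [hg₄ aTail (by decide), hg₄ aHead (by decide)] at hout
  have key : ∀ z, I.Feasible z →
      Potential S (M aTail) (M aHead) (M aCost) (oddExt fun u => M₄ aPot u / 2) ∧
      ∑ j : Fin I.n, M aWeight ((j : ℤ) + 1) * (M₄ aPot ((j : ℤ) + 1) / 2) ≤
        2 * ∑ j : Fin I.n, M aWeight ((j : ℤ) + 1) * z j := by
    intro z hz
    have hzp : Potential S (M aTail) (M aHead) (M aCost) (oddExt (shiftExt z)) := by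
      rw [hI.iff_feasible]
      simpa only [shiftExt_apply] using hz
    have hsol := hsolve (hinit _ hzp)
    have hp₃ : Potential S (M aTail) (M aHead) (fun k => 2 * M aCost k) (M₃ aPot) := by
      intro k hk
      obtain ⟨k', hk', hT', hH', hC'⟩ := hI.symm k hk
      have h1 := hsol.potential k hk
      have h2 := hsol.potential k' hk'
      rw [hT', hH', hC'] at h2
      rw [hP₃ _ (hN.tail k hk), hP₃ _ (hN.head k hk)]
      simp only
      linarith
    obtain ⟨hR, hev⟩ := hround _ hp₃ hzp (oddExt_neg _)
    refine ⟨hR.potential_half hN hev, ?_⟩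
    -- The comparison potential is odd, so its objective in the relaxation is twice that of `z`.
    have hdual := weak_duality hN hsol.compl hzp
    simp only [hsol.div, sum_oddExt_mul] at hdual
    rw [Finset.sum_range, Finset.sum_range] at hdual
    -- The arc of `0 ≤ x j` makes the value `X` before rounding nonnegative. If it is odd it is at
    -- least `1`, and `(X + 1) / 2 ≤ X`.
    have hle : ∀ j : Fin I.n, M₄ aPot ((j : ℤ) + 1) / 2 ≤
        M₂ aPot ((j : ℤ) + 1) - M₂ aPot (-((j : ℤ) + 1)) := by
      intro j
      have hj : ((j : ℕ) : ℤ) + 1 ∈ nodes I.n := by rw [mem_nodes]; omega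
      rw [← hP₃ _ hj]
      obtain ⟨k, hk, hT, hH, hC⟩ := hI.nonneg j j.2
      have h0 := hp₃ k hk
      rw [hT, hH, hneg₃ _ hj] at h0
      simp only [hC] at h0
      rcases hR.near _ hj with h | ⟨⟨c, hc⟩, -, h | h⟩ <;> omega
    refine (Finset.sum_le_sum fun j _ => mul_le_mul_of_nonneg_left (hle j) (hW0 _)).trans
      (hdual.trans (le_of_eq ?_))
    rw [Finset.mul_sum]
    refine Finset.sum_congr rfl fun j _ => ?_
    rw [oddExt_neg, oddExt_of_pos _ (by omega), shiftExt_apply]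
    ring
  rcases hout with ⟨hp, ho⟩ | ⟨hp, ho⟩
  · exact Or.inl ⟨_, (hI.iff_feasible _).1 hp, ho, fun z hz => (key z hz).2⟩
  · exact Or.inr ⟨fun ⟨z, hz⟩ => hp (key z hz).1, ho⟩

/-! ## The algorithm -/

/-- Set up the network and the weights. -/
def readCmd : Cmd := headerCmd ;; matrixCmd ;; rhsCmd ;; nonnegCmd ;; weightCmd

/-- The memory after reading the instance `I`. -/
structure Loaded (I : UTVPIProblem) (S : ℕ) (M : Mem) : Prop where
  size : M aSize 0 = S
  num : M aN 0 = I.n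
  represents : Represents I S (M aTail) (M aHead) (M aCost)
  flow : ∀ k, M aFlow k = 0
  pot : ∀ u, M aPot u = 0
  weight : ∀ j : Fin I.n, (M aWeight ((j : ℤ) + 1) : ℚ) = I.w j * ∏ i, ((I.w i).den : ℚ)
  weight_eq_zero : ∀ u, (I.n : ℤ) < u → M aWeight u = 0
  weight_nonneg : ∀ u, 0 ≤ M aWeight u
  weight_lt : ∀ u, M aWeight u < 2 ^ S

theorem run_readCmd {I : UTVPIProblem} {S : ℕ} {M : Mem} (hSI : S = inputSize I.encode + 1)
    (hS : M aSize 0 = S) (hin : Encodes I (M aIn))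
    (hzero : ∀ a ∈ [aPtr, aTail, aHead, aCost, aFlow, aPot, aWeight], ∀ k, M a k = 0) :
    Loaded I S (readCmd.run S M) := by
  -- Every entry of the encoding takes at least one bit, so `S` exceeds the number of nodes and is
  -- at least the number `2 * m + n` of arcs.
  have hlen := length_le_inputSize I.encode
  rw [length_encode] at hlen
  have hmn : I.m ≤ I.m * I.n := Nat.le_mul_of_pos_right _ I.n_pos
  have hnm : I.n ≤ I.m * I.n := Nat.le_mul_of_pos_left _ I.m_pos
  have hnS : 2 * I.n + 1 < S := by omega
  have hmS : 2 * I.m + I.n ≤ S := by omega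
  rw [readCmd, run_seq, run_seq, run_seq, run_seq]
  have hf₀ := run_frame_of_subset S headerCmd [aM, aN, aPtr] (by decide) M
  have hm₀ : headerCmd.run S M aM 0 = I.m := by
    simp [headerCmd, run_seq, run_write, Mem.store_apply, hin.rows]
  have hn₀ : headerCmd.run S M aN 0 = I.n := by
    simp [headerCmd, run_seq, run_write, Mem.store_apply, hin.cols]
  have hptr₀ : headerCmd.run S M aPtr 0 = 2 := by
    simp [headerCmd, run_seq, run_write, Mem.store_apply]
  generalize headerCmd.run S M = M₀ at *
  have hf₁ := run_frame_of_subset S matrixCmd [aTail, aHead, aPtr, aLit, aPrev, cMap, cVar]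
    (by decide) M₀
  obtain ⟨hrow, hptr₁⟩ := run_matrixCmd (S := S) hn₀ hm₀ (by omega) (by omega) hptr₀
    (by rw [hf₀ aTail (by decide)]; exact hzero _ (by decide))
    (by rw [hf₀ aHead (by decide)]; exact hzero _ (by decide))
  rw [hf₀ aIn (by decide)] at hrow
  generalize matrixCmd.run S M₀ = M₁ at *
  have hf₂ := run_frame_of_subset S rhsCmd [aCost, cVar] (by decide) M₁
  obtain ⟨hC, hC0⟩ := run_rhsCmd (S := S) (m := I.m) (M := M₁)
    (by rw [hf₁ _ (by decide), hm₀]) (by omega)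
    (by rw [hf₁ aCost (by decide), hf₀ aCost (by decide)]; exact hzero _ (by decide))
  rw [hptr₁, hf₁ aIn (by decide), hf₀ aIn (by decide)] at hC
  generalize rhsCmd.run S M₁ = M₂ at *
  have hf₃ := run_frame_of_subset S nonnegCmd [aTail, aHead, cVar] (by decide) M₂
  obtain ⟨hnn, hTH⟩ := run_nonnegCmd (S := S) (n := I.n) (m := I.m) (M := M₂)
    (by rw [hf₂ _ (by decide), hf₁ _ (by decide), hn₀])
    (by rw [hf₂ _ (by decide), hf₁ _ (by decide), hm₀]) (by omega)
  rw [hf₂ aTail (by decide), hf₂ aHead (by decide)] at hTH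
  generalize nonnegCmd.run S M₂ = M₃ at *
  have hrep := represents hin hnS hmS hrow hC hC0 hnn hTH
  have hg₃ : ∀ b ∉ [aM, aN, aPtr, aTail, aHead, aLit, aPrev, aCost, cMap, cVar],
      M₃ b = M b := fun b hb => by
    rw [hf₃ b (notMem_of_subset hb (by decide)), hf₂ b (notMem_of_subset hb (by decide)),
      hf₁ b (notMem_of_subset hb (by decide)), hf₀ b (notMem_of_subset hb (by decide))]
  have hptr₃ : M₃ aPtr 0 = 2 + (I.m : ℤ) * I.n := by
    rw [hf₃ aPtr (by decide), hf₂ aPtr (by decide), hptr₁]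
  have hm₃ : M₃ aM 0 = I.m := by
    rw [hf₃ aM (by decide), hf₂ aM (by decide), hf₁ aM (by decide), hm₀]
  have hn₃ : M₃ aN 0 = I.n := by
    rw [hf₃ aN (by decide), hf₂ aN (by decide), hf₁ aN (by decide), hn₀]
  have hf₄ := run_frame_of_subset S weightCmd
    [aWeight, aBits, aAcc, aMul, cMap, cVar, cBit] (by decide) M₃
  obtain ⟨hW, hW0⟩ := run_weightCmd (S := S) (n := I.n) (M := M₃) hn₃ (by omega)
    (by rw [hg₃ aWeight (by decide)]; exact hzero _ (by decide)) (by
      rw [hptr₃, hm₃, hg₃ aIn (by decide)]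
      refine fun j i hj hi => ⟨factor_nonneg hin ⟨j, hj⟩ ⟨i, hi⟩,
        (factor_lt hin ⟨j, hj⟩ ⟨i, hi⟩).trans_le (pow_le_pow_right₀ (by norm_num) ?_)⟩
      have h1 := sum_bitLength_le I
      have h2 := Finset.single_le_sum (f := fun i => bitLength (I.w i).num +
        bitLength (I.w i).den) (fun _ _ => Nat.zero_le _) (Finset.mem_univ (⟨i, hi⟩ : Fin I.n))
      omega)
  rw [hptr₃, hm₃, hg₃ aIn (by decide)] at hW
  generalize weightCmd.run S M₃ = M₄ at *
  have hcase : ∀ u : ℤ, (u ≤ 0 ∨ (I.n : ℤ) < u) ∨ ∃ j : Fin I.n, u = (j : ℤ) + 1 := by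
    intro u
    by_cases h : u ≤ 0 ∨ (I.n : ℤ) < u
    · exact Or.inl h
    · exact Or.inr ⟨⟨(u - 1).toNat, by omega⟩, by simp; omega⟩
  constructor
  · rw [hf₄ _ (by decide), hg₃ _ (by decide), hS]
  · rw [hf₄ _ (by decide), hn₃]
  · rw [hf₄ aTail (by decide), hf₄ aHead (by decide), hf₄ aCost (by decide), hf₃ aCost (by decide)]
    exact hrep
  · rw [hf₄ aFlow (by decide), hg₃ aFlow (by decide)]
    exact hzero _ (by decide)
  · rw [hf₄ aPot (by decide), hg₃ aPot (by decide)]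
    exact hzero _ (by decide)
  · intro j
    rw [hW j j.2, prod_factor hin]
  · exact fun u hu => hW0 u (Or.inr hu)
  · intro u
    rcases hcase u with h | ⟨j, rfl⟩
    · rw [hW0 u h]
    · rw [hW j j.2, Finset.prod_range]
      exact Finset.prod_nonneg fun i _ => factor_nonneg hin j i
  · intro u
    rcases hcase u with h | ⟨j, rfl⟩
    · rw [hW0 u h]; positivity
    · rw [hW j j.2, hSI]
      exact prod_factor_lt hin j

/-- The algorithm, once the size of the input is known. -/
def mainCmd : Cmd := readCmd ;; optimizeCmd

theorem wf_mainCmd : mainCmd.WF := by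
  unfold mainCmd
  repeat' first | exact trivial | rfl | decide | apply And.intro

theorem prod_den_pos (I : UTVPIProblem) : (0 : ℚ) < ∏ i, ((I.w i).den : ℚ) :=
  Finset.prod_pos fun i _ => by exact_mod_cast (I.w i).pos

/-- Multiplied by the product of the denominators, the objective is a natural number at every
feasible point. -/
theorem exists_isOptimal {I : UTVPIProblem} (h : ∃ x, I.Feasible x) : ∃ z, I.IsOptimal z := by
  have hD := prod_den_pos I
  have hnat : ∀ x, ∃ k : ℕ, I.Feasible x → I.objective x * ∏ i, ((I.w i).den : ℚ) = k := by
    intro x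
    refine ⟨(∑ j : Fin I.n, (∏ i ∈ Finset.range I.n,
      factor (initMem I.encode 0) (2 + (I.m : ℤ) * I.n) I.m I.n j i) * x j).toNat, fun hx => ?_⟩
    have h0 : 0 ≤ I.objective x := Finset.sum_nonneg fun j _ =>
      mul_nonneg (I.w_nonneg j) (by exact_mod_cast hx.2 j)
    have heq : I.objective x * ∏ i, ((I.w i).den : ℚ) = ((∑ j : Fin I.n, (∏ i ∈ Finset.range I.n,
        factor (initMem I.encode 0) (2 + (I.m : ℤ) * I.n) I.m I.n j i) * x j : ℤ) : ℚ) := by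
      rw [UTVPIProblem.objective, Finset.sum_mul, Int.cast_sum]
      refine Finset.sum_congr rfl fun j _ => ?_
      rw [Int.cast_mul, prod_factor (encodes_encode I)]
      ring
    have h1 := mul_nonneg h0 hD.le
    rw [heq] at h1 ⊢
    exact_mod_cast (Int.toNat_of_nonneg (Int.cast_nonneg_iff.1 h1)).symm
  choose μ hμ using hnat
  obtain ⟨z, hz, hmin⟩ := (measure μ).wf.has_min {x | I.Feasible x} h
  refine ⟨z, hz, fun y hy => le_of_mul_le_mul_right ?_ hD⟩
  rw [hμ z hz, hμ y hy]
  exact_mod_cast not_lt.1 (hmin y hy)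

theorem isApproxAnswer_run_mainCmd {I : UTVPIProblem} {S : ℕ} {M : Mem}
    (hSI : S = inputSize I.encode + 1) (hS : M aSize 0 = S) (hin : Encodes I (M aIn))
    (hzero : ∀ a ∈ [aPtr, aTail, aHead, aCost, aFlow, aPot, aWeight], ∀ k, M a k = 0) :
    I.IsApproxAnswer 2 (output (mainCmd.run S M)) := by
  have hL := run_readCmd hSI hS hin hzero
  rw [mainCmd, run_seq]
  rcases run_optimizeCmd hL.size hL.num hL.represents hL.flow hL.pot hL.weight_eq_zero
    hL.weight_nonneg hL.weight_lt with ⟨x, hx, ho, hopt⟩ | h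
  swap
  · exact Or.inr h
  obtain ⟨z, hz⟩ := exists_isOptimal ⟨x, hx⟩
  refine Or.inl ⟨x, ⟨hx, z, hz, ?_⟩, ho⟩
  have hobj : ∀ y : Fin I.n → ℤ,
      ((∑ j : Fin I.n, readCmd.run S M aWeight ((j : ℤ) + 1) * y j : ℤ) : ℚ) =
      I.objective y * ∏ i, ((I.w i).den : ℚ) := by
    intro y
    rw [UTVPIProblem.objective, Finset.sum_mul]
    push_cast
    refine Finset.sum_congr rfl fun j _ => ?_
    rw [hL.weight]
    ring
  have h1 : ((∑ j : Fin I.n, readCmd.run S M aWeight ((j : ℤ) + 1) * x j : ℤ) : ℚ) ≤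
      2 * ((∑ j : Fin I.n, readCmd.run S M aWeight ((j : ℤ) + 1) * z j : ℤ) : ℚ) := by
    exact_mod_cast hopt z hz.1
  rw [hobj, hobj, ← mul_assoc] at h1
  exact le_of_mul_le_mul_right h1 (prod_den_pos I)

end UTVPI

theorem mainTheorem3 :
    ∃ (p : RAM.Program) (q : Polynomial ℕ), ∀ I : UTVPIProblem, ∃ out : List ℤ,
      p.OutputsWithin I.encode out (q.eval (RAM.inputSize I.encode)) ∧
        I.IsApproxAnswer 2 out := by
  obtain ⟨q, hq⟩ := RAM.exec_sizeProgram
  obtain ⟨_, Q, hQ⟩ := RAM.Cmd.exec_run UTVPI.mainCmd UTVPI.wf_mainCmd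
  -- Computing the size leaves numbers of at most `2 ^ S` with `S` the input size plus one, so the
  -- cost bound `Q S * (k + 1)` applies with `k = S`.
  refine ⟨.seq RAM.sizeProgram UTVPI.mainCmd.toProgram,
    q + Q.comp (Polynomial.X + 1) * (Polynomial.X + 2), fun I => ?_⟩
  obtain ⟨M, T, hT, hE, h4, hf, hM⟩ := hq I.encode
  obtain ⟨-, t, ht, hE'⟩ := hQ (RAM.inputSize I.encode + 1) (RAM.inputSize I.encode + 1) M h4 hM
  refine ⟨_, ⟨T + t, _, RAM.Exec.seq hE hE', ?_, rfl⟩,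
    UTVPI.isApproxAnswer_run_mainCmd rfl h4 ?_ ?_⟩
  · simp only [Polynomial.eval_add, Polynomial.eval_mul, Polynomial.eval_comp, Polynomial.eval_X,
      Polynomial.eval_one, Polynomial.eval_ofNat]
    exact Nat.add_le_add hT ht
  · rw [hf _ (by decide)]
    exact UTVPI.encodes_encode I
  · intro a ha k
    rw [hf a (by revert a; decide)]
    have : a ≠ 0 ∧ a ≠ 1 := by revert a; decide
    simp [RAM.initMem, this]
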